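/- **Setting.** Let $d\ge 2$, let $\Omega\subset\mathbb R^d$ be bounded and open, and let $A\in L^\infty(\Omega;\mathbb R^{d\times d}_{\rm sym})$ be uniformly positive definite, $\mathbf b\in L^\infty(\Omega)^d$, $c\in L^\infty(\Omega)$, such that $a(u,v)=\int_\Omega A\nabla u\cdot\nabla v+\int_\Omega(\mathbf b\cdot\nabla u)\,v+\int_\Omega cuv$ is elliptic on $H^1_0(\Omega)$, i.e. $a(v,v)\ge C_{\rm ell}\|v\|_{H^1}^2$ for some $C_{\rm ell}>0$. Put $|\!|\!|v|\!|\!|^2=\int_\Omega A\nabla v\cdot\nabla v$. Let $\mathcal K:H^1_0(\Omega)\to H^{-1}(\Omega)=H^1_0(\Omega)'$ be linear and compact. For $f\in L^2(\Omega)$, $\mathbf f\in L^2(\Omega)^d$ let $u\in H^1_0(\Omega)$ solve $a(u,v)=\int_\Omega fv-\int_\Omega\mathbf f\cdot\nabla v$ for all $v\in H^1_0(\Omega)$, and for $w\in H^1_0(\Omega)$ let $z[w]\in H^1_0(\Omega)$ solve $a(v,z[w])=\langle\mathcal Kv,w\rangle+\langle\mathcal Kw,v\rangle$ for all $v\in H^1_0(\Omega)$.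 For a conforming triangulation $\mathcal T_H$ of $\Omega$ into compact simplices let $\mathcal X_H\subset H^1_0(\Omega)$ be the functions that are on each element a polynomial of degree at most $p$ ($p\ge1$ fixed), and let $u_H,z_H[w]\in\mathcal X_H$ be the Galerkin solutions of the two problems in $\mathcal X_H$. **Refinement.** Let $\mathcal T_0$ be a conforming triangulation of $\Omega$ and ${\tt refine}$ a deterministic rule that turns a triangulation $\mathcal T_H$ and a set $\mathcal M\subseteq\mathcal T_H$ into a conforming triangulation of $\Omega$ whose elements are contained in elements of $\mathcal T_H$ and which contains no $T\in\mathcal M$. Let $\mathbb T(\mathcal T_H)$ be the set of all triangulations obtained from $\mathcal T_H$ by finitely many such steps, $\mathbb T=\mathbb T(\mathcal T_0)$, $\mathbb T_N=\{\mathcal T\in\mathbb T:\#\mathcal T-\#\mathcal T_0\le N\}$. Assume: $\#(\mathcal T_H\setminus\mathcal T_h)+\#\mathcal T_H\le\#\mathcal T_h$ for $\mathcal T_H\in\mathbb T$, $\mathcal T_h\in\mathbb T(\mathcal T_H)$; $\#\mathcal T_\ell-\#\mathcal T_0\le C_{\rm mesh}\sum_{j<\ell}\#\mathcal M_j$ whenever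 $\mathcal T_{j+1}={\tt refine}(\mathcal T_j,\mathcal M_j)$ with $\mathcal M_j\subseteq\mathcal T_j$ for all $j$; any $\mathcal T_H,\mathcal T_h\in\mathbb T$ have a common refinement in $\mathbb T(\mathcal T_H)\cap\mathbb T(\mathcal T_h)$ with at most $\#\mathcal T_H+\#\mathcal T_h-\#\mathcal T_0$ elements. **Estimators.** For $\mathcal T_H\in\mathbb T$, $T\in\mathcal T_H$, $v_H\in\mathcal X_H$, $w\in H^1_0(\Omega)$ let indicators $\eta_H(T,v_H)\ge0$ and $\zeta_H(w;T,v_H)\ge0$ be given, the latter for the dual problem linearized at $w$; put $\eta_H(\mathcal U,v_H)=(\sum_{T\in\mathcal U}\eta_H(T,v_H)^2)^{1/2}$, $\eta_H(v_H)=\eta_H(\mathcal T_H,v_H)$, likewise $\zeta_H(w;\mathcal U,v_H)$ and $\zeta_H(w;v_H)$. For a discrete function of the form $z_H[w]$ write $\zeta_H(\mathcal U,z_H[w])=\zeta_H(w;\mathcal U,z_H[w])$ and $\zeta_H(z_H[w])=\zeta_H(w;z_H[w])$. With $C_{\rm stab},C_{\rm rel},C_{\rm drel}>0$ and $0<q_{\rm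 red}<1$, suppose for all $\mathcal T_H\in\mathbb T$ and $\mathcal T_h\in\mathbb T(\mathcal T_H)$: (A1) for all $v_h\in\mathcal X_h$, $v_H\in\mathcal X_H$, $w_h,w_H\in H^1_0(\Omega)$, $\mathcal U\subseteq\mathcal T_h\cap\mathcal T_H$: $|\eta_h(\mathcal U,v_h)-\eta_H(\mathcal U,v_H)|+|\zeta_h(w_h;\mathcal U,v_h)-\zeta_H(w_H;\mathcal U,v_H)|\le C_{\rm stab}\big(|\!|\!|v_h-v_H|\!|\!|+|\!|\!|w_h-w_H|\!|\!|\big)$; (A2) for all $v_H\in\mathcal X_H$, $w\in H^1_0(\Omega)$: $\eta_h(\mathcal T_h\setminus\mathcal T_H,v_H)\le q_{\rm red}\,\eta_H(\mathcal T_H\setminus\mathcal T_h,v_H)$ and $\zeta_h(w;\mathcal T_h\setminus\mathcal T_H,v_H)\le q_{\rm red}\,\zeta_H(w;\mathcal T_H\setminus\mathcal T_h,v_H)$; (A3) for all $w\in H^1_0(\Omega)$: $|\!|\!|u-u_H|\!|\!|\le C_{\rm rel}\,\eta_H(u_H)$ and $|\!|\!|z[w]-z_H[w]|\!|\!|\le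 C_{\rm rel}\,\zeta_H(z_H[w])$; (A4) for all $w\in H^1_0(\Omega)$: $|\!|\!|u_h-u_H|\!|\!|\le C_{\rm drel}\,\eta_H(\mathcal T_H\setminus\mathcal T_h,u_H)$ and $|\!|\!|z_h[w]-z_H[w]|\!|\!|\le C_{\rm drel}\,\zeta_H(\mathcal T_H\setminus\mathcal T_h,z_H[w])$. (If $\zeta_H$ does not depend on $w$, (A1) is implied by the usual stability with right-hand side $C_{\rm stab}|\!|\!|v_h-v_H|\!|\!|$.) **Algorithm A** with parameters $0<\theta\le1$, $C_{\rm mark}\ge1$: starting from $\mathcal T_0$, for $\ell=0,1,2,\dots$ choose sets $\overline{\mathcal M}{}_\ell^{u},\overline{\mathcal M}{}_\ell^{uz}\subseteq\mathcal T_\ell$ of, up to the factor $C_{\rm mark}$, minimal cardinality with $\theta\,\eta_\ell(u_\ell)^2\le\eta_\ell(\overline{\mathcal M}{}_\ell^{u},u_\ell)^2$ and $\theta[\eta_\ell(u_\ell)^2+\zeta_\ell(z_\ell[u_\ell])^2]\le\eta_\ell(\overline{\mathcal M}{}_\ell^{uz},u_\ell)^2+\zeta_\ell(\overline{\mathcal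 M}{}_\ell^{uz},z_\ell[u_\ell])^2$, respectively; choose $\mathcal M_\ell^u\subseteq\overline{\mathcal M}{}_\ell^u$ and $\mathcal M_\ell^{uz}\subseteq\overline{\mathcal M}{}_\ell^{uz}$ with $\#\mathcal M_\ell^u=\#\mathcal M_\ell^{uz}=\min\{\#\overline{\mathcal M}{}_\ell^u,\#\overline{\mathcal M}{}_\ell^{uz}\}$; put $\mathcal T_{\ell+1}={\tt refine}(\mathcal T_\ell,\mathcal M_\ell^u\cup\mathcal M_\ell^{uz})$. Write $P_\ell=\eta_\ell(u_\ell)\,[\eta_\ell(u_\ell)^2+\zeta_\ell(z_\ell[u_\ell])^2]^{1/2}$ and, for $s,t>0$, $\|u\|_{\mathbb A_s}=\sup_{N\in\mathbb N_0}(N+1)^s\min_{\mathcal T_H\in\mathbb T_N}\eta_H(u_H)$, $\|z[u]\|_{\mathbb A_t}=\sup_{N\in\mathbb N_0}(N+1)^t\min_{\mathcal T_H\in\mathbb T_N}\zeta_H(z_H[u])$ in $[0,\infty]$. **Theorem.** (i) For all $0<\theta\le1$ and $C_{\rm mark}\ge1$ there are $\ell_0\in\mathbb N_0$, $C_{\rm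 lin}>0$ and $0<q_{\rm lin}<1$ such that every run of Algorithm A satisfies $P_n\le C_{\rm lin}\,q_{\rm lin}^{\,n-\ell}\,P_\ell$ for all $n\ge\ell\ge\ell_0$. (ii) If moreover $\theta<\theta_{\rm opt}:=(1+C_{\rm stab}^2C_{\rm drel}^2)^{-1}$, then for every $\alpha>0$ there is $C_{\rm opt}>0$ such that, with the same $\ell_0$, every run of Algorithm A satisfies $$P_\ell\le C_{\rm opt}\,\|u\|_{\mathbb A_s}\big(\|u\|_{\mathbb A_s}+\|z[u]\|_{\mathbb A_t}\big)\,(\#\mathcal T_\ell-\#\mathcal T_0)^{-\alpha}$$ for all $s,t>0$ with $\alpha=\min\{2s,s+t\}$ and $\|u\|_{\mathbb A_s}+\|z[u]\|_{\mathbb A_t}<\infty$ and all $\ell\ge\ell_0$ with $\#\mathcal T_\ell>\#\mathcal T_0$. The constants $\ell_0,C_{\rm lin},q_{\rm lin}$ depend only on $\theta$, $q_{\rm red}$, $C_{\rm stab}$, $C_{\rm rel}$, $a(\cdot,\cdot)$ (hence on $\Omega$) and $\mathcal K$; $C_{\rm opt}$ depends in addition only on $C_{\rm drel}$, $C_{\rm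 mesh}$, $C_{\rm mark}$ and $\alpha$. -/

import Mathlib

open MeasureTheory Matrix
open scoped ENNReal

namespace GOAFEM

/-- Euclidean space `ℝ^d`. -/
abbrev E (d : ℕ) : Type := EuclideanSpace ℝ (Fin d)

/-! ### The Sobolev space `H^1_0(Ω)` and its dual -/

/-- Pairs `(v, g)` in `L²(Ω) × L²(Ω)^d` with the norm `(‖v‖² + ‖g‖²)^{1/2}`. -/
abbrev L2Pair {d : ℕ} (Ω : Set (E d)) : Type :=
  WithLp 2 (Lp ℝ 2 (volume.restrict Ω) × Lp (E d) 2 (volume.restrict Ω))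

/-- The pairs `(φ, ∇φ)` with `φ` smooth and compactly supported in `Ω`. -/
def testPairs {d : ℕ} (Ω : Set (E d)) : Set (L2Pair Ω) :=
  {w | ∃ φ : E d → ℝ, ContDiff ℝ ((⊤ : ℕ∞) : WithTop ℕ∞) φ ∧ HasCompactSupport φ ∧ tsupport φ ⊆ Ω ∧
    w.fst =ᵐ[volume.restrict Ω] φ ∧ w.snd =ᵐ[volume.restrict Ω] gradient φ}

/-- `H^1_0(Ω)`: the closure of `C_c^∞(Ω)` in the `H^1`-norm. A function is stored together with its
weak gradient, so the norm inherited from `L2Pair Ω` is the `H^1(Ω)`-norm. -/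
noncomputable def H10 {d : ℕ} (Ω : Set (E d)) : Submodule ℝ (L2Pair Ω) :=
  (Submodule.span ℝ (testPairs Ω)).topologicalClosure

/-- The values of `v ∈ H^1_0(Ω)`. -/
noncomputable def fn {d : ℕ} {Ω : Set (E d)} (v : H10 Ω) : E d → ℝ := (v : L2Pair Ω).fst

/-- The weak gradient of `v ∈ H^1_0(Ω)`. -/
noncomputable def wgrad {d : ℕ} {Ω : Set (E d)} (v : H10 Ω) : E d → E d := (v : L2Pair Ω).snd

/-- `H^{-1}(Ω)`, the dual space of `H^1_0(Ω)`. -/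
abbrev Hneg1 {d : ℕ} (Ω : Set (E d)) : Type := H10 Ω →L[ℝ] ℝ

/-! ### The bilinear form, the energy norm, Galerkin solutions -/

/-- `∫ A ∇u · ∇v`. -/
noncomputable def principalForm {d : ℕ} {Ω : Set (E d)} (A : E d → Matrix (Fin d) (Fin d) ℝ)
    (u v : H10 Ω) : ℝ :=
  ∫ x in Ω, (A x *ᵥ (wgrad u x).ofLp) ⬝ᵥ (wgrad v x).ofLp

/-- `a(u,v) = ∫ A ∇u · ∇v + ∫ (b · ∇u) v + ∫ c u v`. -/
noncomputable def bilin {d : ℕ} {Ω : Set (E d)} (A : E d → Matrix (Fin d) (Fin d) ℝ)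
    (b : E d → E d) (c : E d → ℝ) (u v : H10 Ω) : ℝ :=
  principalForm A u v + (∫ x in Ω, ((b x).ofLp ⬝ᵥ (wgrad u x).ofLp) * fn v x)
    + ∫ x in Ω, c x * fn u x * fn v x

/-- The energy norm `(∫ A ∇v · ∇v)^{1/2}`. -/
noncomputable def energyNorm {d : ℕ} {Ω : Set (E d)} (A : E d → Matrix (Fin d) (Fin d) ℝ)
    (v : H10 Ω) : ℝ :=
  √(principalForm A v v)

/-- The assumptions on the coefficients: essentially bounded and measurable, `A` symmetric and
uniformly positive definite, and `a` elliptic on `H^1_0(Ω)`. -/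
structure AdmissibleCoefficients {d : ℕ} (Ω : Set (E d)) (A : E d → Matrix (Fin d) (Fin d) ℝ)
    (b : E d → E d) (c : E d → ℝ) : Prop where
  memLp_A : ∀ i j, MemLp (fun x => A x i j) ⊤ (volume.restrict Ω)
  memLp_b : MemLp b ⊤ (volume.restrict Ω)
  memLp_c : MemLp c ⊤ (volume.restrict Ω)
  symm : ∀ᵐ x ∂(volume.restrict Ω), (A x).IsSymm
  posDef : ∃ α : ℝ, 0 < α ∧ ∀ᵐ x ∂(volume.restrict Ω), ∀ y : E d,
    α * ‖y‖ ^ 2 ≤ (A x *ᵥ y.ofLp) ⬝ᵥ y.ofLp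
  elliptic : ∃ Cell : ℝ, 0 < Cell ∧ ∀ v : H10 Ω, Cell * ‖v‖ ^ 2 ≤ bilin A b c v v

/-- `F(v) = ∫ f v - ∫ 𝐟 · ∇v`. -/
noncomputable def load {d : ℕ} {Ω : Set (E d)} (f : E d → ℝ) (ff : E d → E d) (v : H10 Ω) : ℝ :=
  (∫ x in Ω, f x * fn v x) - ∫ x in Ω, (ff x).ofLp ⬝ᵥ (wgrad v x).ofLp

/-- The element `u ∈ X` with `a(u, v) = F(v)` for all `v ∈ X` (it exists and is unique by the
Lax--Milgram lemma in all the situations in which it is used). -/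
noncomputable def galerkin {V : Type} [AddCommGroup V] [Module ℝ V] (a : V → V → ℝ) (F : V → ℝ)
    (X : Submodule ℝ V) : V :=
  Classical.epsilon fun u => u ∈ X ∧ ∀ v ∈ X, a u v = F v

/-- Solution of the primal problem in `X`. For `X = ⊤` this is the exact solution `u`. -/
noncomputable def primal {d : ℕ} {Ω : Set (E d)} (A : E d → Matrix (Fin d) (Fin d) ℝ)
    (b : E d → E d) (c : E d → ℝ) (f : E d → ℝ) (ff : E d → E d)
    (X : Submodule ℝ (H10 Ω)) : H10 Ω :=
  galerkin (bilin A b c) (load f ff) X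

/-- Solution in `X` of the dual problem linearized at `w`, i.e.
`a(v, z) = ⟨K v, w⟩ + ⟨K w, v⟩` for all `v ∈ X`. For `X = ⊤` this is the exact solution `z[w]`. -/
noncomputable def dual {d : ℕ} {Ω : Set (E d)} (A : E d → Matrix (Fin d) (Fin d) ℝ)
    (b : E d → E d) (c : E d → ℝ) (K : H10 Ω →L[ℝ] Hneg1 Ω) (w : H10 Ω)
    (X : Submodule ℝ (H10 Ω)) : H10 Ω :=
  galerkin (fun z v => bilin A b c v z) (fun v => K v w + K w v) X

/-! ### Triangulations and finite element spaces -/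

/-- A simplex, given by its finite set of vertices. -/
abbrev Elem (d : ℕ) : Type := Finset (E d)

/-- The compact set spanned by the vertices. -/
def Elem.hull {d : ℕ} (T : Elem d) : Set (E d) := convexHull ℝ (T : Set (E d))

/-- A finite set of simplices. -/
abbrev Mesh (d : ℕ) : Type := Finset (Elem d)

/-- Conforming triangulations of `Ω` into nondegenerate compact simplices: two elements meet in the
simplex spanned by their common vertices. -/
structure IsTriangulation {d : ℕ} (Ω : Set (E d)) (TH : Mesh d) : Prop where
  simplex : ∀ T ∈ TH, T.card = d + 1 ∧ AffineIndependent ℝ (fun x : T => (x : E d))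
  cover : ⋃ T ∈ TH, Elem.hull T = closure Ω
  conforming : ∀ T ∈ TH, ∀ T' ∈ TH,
    Elem.hull T ∩ Elem.hull T' = convexHull ℝ ((T : Set (E d)) ∩ (T' : Set (E d)))

/-- `v` coincides a.e. on the element `T` with a polynomial of total degree at most `p`. -/
def IsPolyOn {d : ℕ} {Ω : Set (E d)} (p : ℕ) (T : Elem d) (v : H10 Ω) : Prop :=
  ∃ q : MvPolynomial (Fin d) ℝ, q.totalDegree ≤ p ∧
    ∀ᵐ x ∂(volume.restrict Ω), x ∈ Elem.hull T → fn v x = MvPolynomial.eval x.ofLp q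

/-- The conforming finite element space of degree `p` on the mesh `TH`. -/
noncomputable def feSpace {d : ℕ} (Ω : Set (E d)) (p : ℕ) (TH : Mesh d) :
    Submodule ℝ (H10 Ω) where
  carrier := {v | ∀ T ∈ TH, IsPolyOn p T v}
  zero_mem' := by
    intro T _
    refine ⟨0, by simp, ?_⟩
    filter_upwards [Lp.coeFn_zero ℝ 2 (volume.restrict Ω)] with x hx _
    simpa [fn] using hx
  add_mem' := by
    intro v w hv hw T hT
    obtain ⟨q, hq, hvq⟩ := hv T hT
    obtain ⟨r, hr, hwr⟩ := hw T hT
    refine ⟨q + r, (MvPolynomial.totalDegree_add q r).trans (max_le hq hr), ?_⟩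
    filter_upwards [hvq, hwr,
      Lp.coeFn_add (v : L2Pair Ω).fst (w : L2Pair Ω).fst] with x h1 h2 h3 hx
    have h4 : fn (v + w) x = fn v x + fn w x := h3
    rw [h4, h1 hx, h2 hx, map_add]
  smul_mem' := by
    intro t v hv T hT
    obtain ⟨q, hq, hvq⟩ := hv T hT
    refine ⟨t • q, (MvPolynomial.totalDegree_smul_le t q).trans hq, ?_⟩
    filter_upwards [hvq, Lp.coeFn_smul t (v : L2Pair Ω).fst] with x h1 h3 hx
    have h4 : fn (t • v) x = t * fn v x := h3
    rw [h4, h1 hx, MvPolynomial.smul_eval]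

/-! ### Mesh refinement -/

/-- A deterministic refinement rule: `refine TH M` is the mesh obtained from `TH` by refining
(at least) the marked elements `M`. -/
abbrev RefineRule (d : ℕ) : Type := Mesh d → Finset (Elem d) → Mesh d

/-- `Refines refine TH Th`: the mesh `Th` results from `TH` by finitely many steps of refinement,
i.e. `Th ∈ 𝕋(TH)`. -/
def Refines {d : ℕ} (refine : RefineRule d) (TH Th : Mesh d) : Prop :=
  Relation.ReflTransGen (fun T T' => ∃ M ⊆ T, T' = refine T M) TH Th

open Classical in
/-- The assumptions on the initial mesh and on the refinement rule, with mesh-closure constant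
`Cmesh`. -/
structure AdmissibleRefinement {d : ℕ} (Ω : Set (E d)) (T0 : Mesh d) (refine : RefineRule d)
    (Cmesh : ℝ) : Prop where
  initial : IsTriangulation Ω T0
  triangulation : ∀ TH, Refines refine T0 TH → ∀ M ⊆ TH, IsTriangulation Ω (refine TH M)
  /-- Every new element is contained in an old one. -/
  subdivision : ∀ TH, Refines refine T0 TH → ∀ M ⊆ TH,
    ∀ T ∈ refine TH M, ∃ T' ∈ TH, Elem.hull T ⊆ Elem.hull T'
  /-- Marked elements are refined. -/
  marked : ∀ TH, Refines refine T0 TH → ∀ M ⊆ TH, M ⊆ TH \ refine TH M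
  /-- Each refined element has at least two sons. -/
  sons : ∀ TH Th, Refines refine T0 TH → Refines refine TH Th →
    (TH \ Th).card + TH.card ≤ Th.card
  /-- Mesh-closure estimate. -/
  meshClosure : ∀ (𝒯 : ℕ → Mesh d) (M : ℕ → Finset (Elem d)), 𝒯 0 = T0 →
    (∀ l, M l ⊆ 𝒯 l ∧ 𝒯 (l + 1) = refine (𝒯 l) (M l)) →
    ∀ l, ((𝒯 l).card : ℝ) - T0.card ≤ Cmesh * ∑ j ∈ Finset.range l, ((M j).card : ℝ)
  /-- Overlay estimate. -/
  overlay : ∀ TH Th, Refines refine T0 TH → Refines refine T0 Th →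
    ∃ To, Refines refine TH To ∧ Refines refine Th To ∧
      To.card + T0.card ≤ TH.card + Th.card

/-! ### Discretization data: everything but `Ω`, the form `a`, and the operator `K` -/

/-- The data of the adaptive finite element discretization: the right-hand side `(f, ff)` of the
primal problem, the polynomial degree `p`, the initial mesh, the refinement rule, and the refinement
indicators `eta TH T v` and `zeta w TH T v`. The latter is the indicator for the dual problem
linearized at `w` (for an indicator that does not use the right-hand side of the dual problem, the
argument `w` is idle). Only values at `T ∈ TH ∈ 𝕋` and `v` in the finite element space on `TH`
matter. -/
structure Discretization {d : ℕ} (Ω : Set (E d)) where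
  f : E d → ℝ
  ff : E d → E d
  p : ℕ
  T0 : Mesh d
  refine : RefineRule d
  eta : Mesh d → Elem d → H10 Ω → ℝ
  zeta : H10 Ω → Mesh d → Elem d → H10 Ω → ℝ

namespace Discretization

variable {d : ℕ} {Ω : Set (E d)} (D : Discretization Ω)

/-- The finite element space on `TH`. -/
noncomputable def X (TH : Mesh d) : Submodule ℝ (H10 Ω) := feSpace Ω D.p TH

/-- `𝕋`, the set of all meshes obtained from the initial mesh. -/
def meshes : Set (Mesh d) := {TH | Refines D.refine D.T0 TH}

/-- `𝕋_N`, the meshes with at most `N` elements more than the initial mesh. -/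
def meshesUpTo (N : ℕ) : Set (Mesh d) := {TH | TH ∈ D.meshes ∧ TH.card ≤ D.T0.card + N}

/-- `η_H(U, v) = (∑_{T ∈ U} η_H(T, v)²)^{1/2}`. -/
noncomputable def etaOn (TH : Mesh d) (U : Finset (Elem d)) (v : H10 Ω) : ℝ :=
  √(∑ T ∈ U, D.eta TH T v ^ 2)

/-- `ζ_H[w](U, v) = (∑_{T ∈ U} ζ_H[w](T, v)²)^{1/2}`. -/
noncomputable def zetaOn (w : H10 Ω) (TH : Mesh d) (U : Finset (Elem d)) (v : H10 Ω) : ℝ :=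
  √(∑ T ∈ U, D.zeta w TH T v ^ 2)

variable (A : E d → Matrix (Fin d) (Fin d) ℝ) (b : E d → E d) (c : E d → ℝ)
  (K : H10 Ω →L[ℝ] Hneg1 Ω)

/-- The exact primal solution `u`. -/
noncomputable def u : H10 Ω := primal A b c D.f D.ff ⊤

/-- The discrete primal solution `u_H`. -/
noncomputable def uH (TH : Mesh d) : H10 Ω := primal A b c D.f D.ff (D.X TH)

/-- The discrete dual solution `z_H[w]`. -/
noncomputable def zH (w : H10 Ω) (TH : Mesh d) : H10 Ω := dual A b c K w (D.X TH)

open Classical in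
/-- The axioms of adaptivity: stability, reduction, reliability, discrete reliability. -/
structure AdaptivityAxioms (Cstab qred Crel Cdrel : ℝ) : Prop where
  eta_nonneg : ∀ TH ∈ D.meshes, ∀ T ∈ TH, ∀ v ∈ D.X TH, 0 ≤ D.eta TH T v
  zeta_nonneg : ∀ w, ∀ TH ∈ D.meshes, ∀ T ∈ TH, ∀ v ∈ D.X TH, 0 ≤ D.zeta w TH T v
  stability : ∀ TH ∈ D.meshes, ∀ Th, Refines D.refine TH Th →
    ∀ vh ∈ D.X Th, ∀ vH ∈ D.X TH, ∀ wh wH : H10 Ω, ∀ U ⊆ Th ∩ TH,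
      |D.etaOn Th U vh - D.etaOn TH U vH| + |D.zetaOn wh Th U vh - D.zetaOn wH TH U vH|
        ≤ Cstab * (energyNorm A (vh - vH) + energyNorm A (wh - wH))
  reduction_eta : ∀ TH ∈ D.meshes, ∀ Th, Refines D.refine TH Th → ∀ vH ∈ D.X TH,
    D.etaOn Th (Th \ TH) vH ≤ qred * D.etaOn TH (TH \ Th) vH
  reduction_zeta : ∀ TH ∈ D.meshes, ∀ Th, Refines D.refine TH Th → ∀ vH ∈ D.X TH,
    ∀ w : H10 Ω, D.zetaOn w Th (Th \ TH) vH ≤ qred * D.zetaOn w TH (TH \ Th) vH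
  reliability_eta : ∀ TH ∈ D.meshes,
    energyNorm A (D.u A b c - D.uH A b c TH) ≤ Crel * D.etaOn TH TH (D.uH A b c TH)
  reliability_zeta : ∀ TH ∈ D.meshes, ∀ w : H10 Ω,
    energyNorm A (dual A b c K w ⊤ - D.zH A b c K w TH)
      ≤ Crel * D.zetaOn w TH TH (D.zH A b c K w TH)
  discreteReliability_eta : ∀ TH ∈ D.meshes, ∀ Th, Refines D.refine TH Th →
    energyNorm A (D.uH A b c Th - D.uH A b c TH)
      ≤ Cdrel * D.etaOn TH (TH \ Th) (D.uH A b c TH)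
  discreteReliability_zeta : ∀ TH ∈ D.meshes, ∀ Th, Refines D.refine TH Th → ∀ w : H10 Ω,
    energyNorm A (D.zH A b c K w Th - D.zH A b c K w TH)
      ≤ Cdrel * D.zetaOn w TH (TH \ Th) (D.zH A b c K w TH)

/-- All standing assumptions on the discretization, with the constants that occur in them. -/
structure Admissible (Cmesh Cstab qred Crel Cdrel : ℝ) : Prop where
  memLp_f : MemLp D.f 2 (volume.restrict Ω)
  memLp_ff : MemLp D.ff 2 (volume.restrict Ω)
  one_le_p : 1 ≤ D.p
  refinement : AdmissibleRefinement Ω D.T0 D.refine Cmesh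
  adaptivity : D.AdaptivityAxioms A b c K Cstab qred Crel Cdrel

/-! ### The adaptive algorithm -/

/-- `η_H(U, u_H)` -/
noncomputable def etaU (TH : Mesh d) (U : Finset (Elem d)) : ℝ := D.etaOn TH U (D.uH A b c TH)

/-- `ζ_H(U, z_H[u_H])`: the dual problem is linearized at `u_H`. -/
noncomputable def zetaZ (TH : Mesh d) (U : Finset (Elem d)) : ℝ :=
  D.zetaOn (D.uH A b c TH) TH U (D.zH A b c K (D.uH A b c TH) TH)

/-- The Dörfler criterion for the primal estimator. -/
def DoerflerU (θ : ℝ) (TH : Mesh d) (M : Finset (Elem d)) : Prop :=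
  θ * D.etaU A b c TH TH ^ 2 ≤ D.etaU A b c TH M ^ 2

/-- The Dörfler criterion for the combined estimator. -/
def DoerflerUZ (θ : ℝ) (TH : Mesh d) (M : Finset (Elem d)) : Prop :=
  θ * (D.etaU A b c TH TH ^ 2 + D.zetaZ A b c K TH TH ^ 2)
    ≤ D.etaU A b c TH M ^ 2 + D.zetaZ A b c K TH M ^ 2

/-- `M ⊆ TH` satisfies `P` and has minimal cardinality up to the factor `Cmark`. -/
def AlmostMinimal (Cmark : ℝ) (TH : Mesh d) (P : Finset (Elem d) → Prop)
    (M : Finset (Elem d)) : Prop :=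
  M ⊆ TH ∧ P M ∧ ∀ M' ⊆ TH, P M' → (M.card : ℝ) ≤ Cmark * M'.card

open Classical in
/-- One step of the adaptive algorithm may lead from the mesh `TH` to the mesh `Th`. -/
def Step (θ Cmark : ℝ) (TH Th : Mesh d) : Prop :=
  ∃ Mu' Muz' Mu Muz : Finset (Elem d),
    AlmostMinimal Cmark TH (D.DoerflerU A b c θ TH) Mu' ∧
    AlmostMinimal Cmark TH (D.DoerflerUZ A b c K θ TH) Muz' ∧
    Mu ⊆ Mu' ∧ Muz ⊆ Muz' ∧
    Mu.card = min Mu'.card Muz'.card ∧ Muz.card = min Mu'.card Muz'.card ∧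
    Th = D.refine TH (Mu ∪ Muz)

/-- `𝒯` is a sequence of meshes that the adaptive algorithm with parameters `θ`, `Cmark` may
produce. -/
def IsRun (θ Cmark : ℝ) (𝒯 : ℕ → Mesh d) : Prop :=
  𝒯 0 = D.T0 ∧ ∀ l, D.Step A b c K θ Cmark (𝒯 l) (𝒯 (l + 1))

/-- The estimator product `η_H(u_H) [η_H(u_H)² + ζ_H(z_H[u_H])²]^{1/2}`. -/
noncomputable def estProduct (TH : Mesh d) : ℝ :=
  D.etaU A b c TH TH * √(D.etaU A b c TH TH ^ 2 + D.zetaZ A b c K TH TH ^ 2)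

/-! ### Approximation classes -/

/-- `‖u‖_{𝔸_s} = sup_N (N+1)^s min_{𝕋_N} η_H(u_H)`. -/
noncomputable def approxU (s : ℝ) : ℝ≥0∞ :=
  ⨆ N : ℕ, ENNReal.ofReal (((N : ℝ) + 1) ^ s) *
    ⨅ TH ∈ D.meshesUpTo N, ENNReal.ofReal (D.etaOn TH TH (D.uH A b c TH))

/-- `‖z[u]‖_{𝔸_t} = sup_N (N+1)^t min_{𝕋_N} ζ_H(z_H[u])`, linearized at the exact solution `u`. -/
noncomputable def approxZ (t : ℝ) : ℝ≥0∞ :=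
  ⨆ N : ℕ, ENNReal.ofReal (((N : ℝ) + 1) ^ t) *
    ⨅ TH ∈ D.meshesUpTo N,
      ENNReal.ofReal (D.zetaOn (D.u A b c) TH TH (D.zH A b c K (D.u A b c) TH))

end Discretization

end GOAFEM

/-! ### Sequences that are nearly constant on few intervals -/

namespace GOAFEM

/-! The core is a compactness-like statement about Galerkin solutions on nested spaces, uniform in
the spaces and in the load. Projections of a fixed vector onto an increasing sequence of subspaces
have nondecreasing norms, and by Pythagoras their distance is controlled by the growth of the
squared norm. Hence `ℕ` splits into boundedly many intervals on which they vary by at most `ε`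
(`oscLE_starProjection`). A Richardson iteration approximates Galerkin solutions of a nonsymmetric
coercive form at a rate independent of the space, and each iterate is built from finitely many
projections. So Galerkin solutions inherit the property (`exists_oscLE_galerkin`), and so do the
pairs formed with the dual solutions linearized at them (`exists_oscLE_primal_dual`), with `ε`
measured relative to the error at the start of the sequence.

Linear convergence follows without any orthogonality of `a`. Write `η` for the primal and `ρ` for
the combined estimator, so that the product is `η * ρ`. A step satisfying the Dörfler criterion for
`η` or for `ρ` contracts that estimator up to a perturbation by the change of the discrete
solutions. Among enough contracting steps for the same estimator many lie in one interval of small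
oscillation. There the perturbations are negligible against the starting value, so this estimator
becomes as small as desired (`exists_marks_suffice`). The other one grows at most by a constant
factor, and every step contracts one of the two. Hence the product is halved every fixed number of
steps (`exists_linear_convergence`).

For the rates, a sufficient reduction of the product on a refinement forces the refined elements to
satisfy one of the two Dörfler criteria (`exists_doerfler_of_reduction`). The overlay of the current
mesh with near-best meshes for `u` and `z[u]` provides such a refinement with few new elements
(`exists_comparison_mesh`). Almost minimal marking then bounds the marked elements of each step by a
negative power of the current product (`exists_card_marked_le`). Mesh closure and the geometric
series given by linear convergence sum these bounds (`le_rpow_neg_of_linear_convergence`). -/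

/-- `ℕ` splits into at most `M` intervals (the level sets of a monotone labelling) on each of which
the sequence `x` oscillates by at most `ε`. -/
def OscLE {V : Type*} [NormedAddCommGroup V] (x : ℕ → V) (ε : ℝ) (M : ℕ) : Prop :=
  ∃ φ : ℕ → ℕ, Monotone φ ∧ (∀ k, φ k < M) ∧ ∀ k l, φ k = φ l → ‖x k - x l‖ ≤ ε

namespace OscLE

variable {V W : Type*} [NormedAddCommGroup V] [NormedAddCommGroup W]

theorem mono_eps {x : ℕ → V} {ε ε' : ℝ} {M : ℕ} (h : OscLE x ε M) (hε : ε ≤ ε') :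
    OscLE x ε' M := by
  obtain ⟨φ, h1, h2, h3⟩ := h
  exact ⟨φ, h1, h2, fun k l hkl => (h3 k l hkl).trans hε⟩

theorem mono_count {x : ℕ → V} {ε : ℝ} {M M' : ℕ} (h : OscLE x ε M) (hM : M ≤ M') :
    OscLE x ε M' := by
  obtain ⟨φ, h1, h2, h3⟩ := h
  exact ⟨φ, h1, fun k => (h2 k).trans_le hM, h3⟩

theorem const (v : V) {ε : ℝ} (hε : 0 ≤ ε) : OscLE (fun _ => v) ε 1 :=
  ⟨fun _ => 0, monotone_const, fun _ => one_pos, fun _ _ _ => by simpa using hε⟩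

theorem comp_lipschitz {x : ℕ → V} {ε C : ℝ} {M : ℕ} (h : OscLE x ε M) (hC : 0 ≤ C)
    {y : ℕ → W} (hy : ∀ k l, ‖y k - y l‖ ≤ C * ‖x k - x l‖) : OscLE y (C * ε) M := by
  obtain ⟨φ, h1, h2, h3⟩ := h
  exact ⟨φ, h1, h2, fun k l hkl =>
    (hy k l).trans (mul_le_mul_of_nonneg_left (h3 k l hkl) hC)⟩

theorem of_close {x y : ℕ → V} {ε δ : ℝ} {M : ℕ} (h : OscLE x ε M)
    (hxy : ∀ k, ‖x k - y k‖ ≤ δ) : OscLE y (ε + 2 * δ) M := by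
  obtain ⟨φ, h1, h2, h3⟩ := h
  refine ⟨φ, h1, h2, fun k l hkl => ?_⟩
  have e : y k - y l = (x k - x l) - (x k - y k) + (x l - y l) := by abel
  calc ‖y k - y l‖ ≤ ‖x k - x l‖ + ‖x k - y k‖ + ‖x l - y l‖ := by
        rw [e]; exact (norm_add_le _ _).trans (add_le_add_left (norm_sub_le _ _) _)
    _ ≤ ε + 2 * δ := by linarith [h3 k l hkl, hxy k, hxy l]

/-- Diagonal sequences `T k (y k)` of uniformly Lipschitz maps. -/
theorem diagonal {y : ℕ → V} {δ ε C : ℝ} {M M' : ℕ} (T : ℕ → V → W) (hC : 0 ≤ C)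
    (hT : ∀ k j l, ‖T k (y j) - T k (y l)‖ ≤ C * ‖y j - y l‖) (hy : OscLE y δ M)
    (hTy : ∀ j, OscLE (fun k => T k (y j)) ε M') :
    OscLE (fun k => T k (y k)) (ε + 2 * (C * δ)) (M * M') := by
  obtain ⟨φ, h1, h2, h3⟩ := hy
  choose ψ hψ1 hψ2 hψ3 using hTy
  -- `r c` is a representative of the block `c` of `y`. Inside a block the argument of `T k` is
  -- frozen at `y (r c)`, and the block is subdivided by the labelling of that frozen sequence. The
  -- label below is lexicographic: the block first, then the subdivision. Freezing the argument at
  -- both ends costs `2 * (C * δ)`.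
  let r : ℕ → ℕ := fun c => Classical.epsilon fun j => φ j = c
  have hr : ∀ k, φ (r (φ k)) = φ k := fun k =>
    Classical.epsilon_spec (p := fun j => φ j = φ k) ⟨k, rfl⟩
  refine ⟨fun k => φ k * M' + ψ (r (φ k)) k, ?_, ?_, ?_⟩
  · intro k l hkl
    rcases (h1 hkl).eq_or_lt with h | h
    · simp only [h]
      exact Nat.add_le_add_left (hψ1 _ hkl) _
    · have h4 := hψ2 (r (φ k)) k
      have h5 : (φ k + 1) * M' ≤ φ l * M' := Nat.mul_le_mul_right _ h
      simp only
      nlinarith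
  · intro k
    have h4 := hψ2 (r (φ k)) k
    have h5 : (φ k + 1) * M' ≤ M * M' := Nat.mul_le_mul_right _ (h2 k)
    simp only
    nlinarith
  · intro k l hkl
    simp only at hkl
    have hM' : 0 < M' := (Nat.zero_le _).trans_lt (hψ2 0 0)
    have key : ∀ k, (φ k * M' + ψ (r (φ k)) k) / M' = φ k := fun k => by
      rw [mul_comm, Nat.mul_add_div hM', Nat.div_eq_of_lt (hψ2 _ _), add_zero]
    have hφ : φ k = φ l := by rw [← key k, ← key l, hkl]
    rw [hφ] at hkl
    have hψ : ψ (r (φ l)) k = ψ (r (φ l)) l := Nat.add_left_cancel hkl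
    have a1 := hψ3 (r (φ l)) k l hψ
    have a2 := (hT k k (r (φ l))).trans
      (mul_le_mul_of_nonneg_left (h3 k (r (φ l)) (by rw [hr, hφ])) hC)
    have a3 := (hT l (r (φ l)) l).trans
      (mul_le_mul_of_nonneg_left (h3 (r (φ l)) l (hr l)) hC)
    have e : T k (y k) - T l (y l) = (T k (y k) - T k (y (r (φ l)))) +
      (T k (y (r (φ l))) - T l (y (r (φ l)))) + (T l (y (r (φ l))) - T l (y l)) := by abel
    simp only at a1 ⊢
    rw [e]
    exact norm_add₃_le.trans (by linarith)

end OscLE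

/-! ### Orthogonal projections onto nested subspaces. -/

section Hilbert

variable {V : Type*} [NormedAddCommGroup V] [InnerProductSpace ℝ V]

/-- Projections of a fixed vector onto an increasing sequence of subspaces. -/
theorem oscLE_starProjection (X : ℕ → Submodule ℝ V) [∀ k, (X k).HasOrthogonalProjection]
    (hX : Monotone X) (g : V) {R ε : ℝ} (hg : ‖g‖ ≤ R) (hε : 0 < ε) :
    OscLE (fun k => (X k).starProjection g) ε (⌊R ^ 2 / ε ^ 2⌋₊ + 1) := by
  have pyth : ∀ k l, k ≤ l → ‖(X l).starProjection g‖ ^ 2 =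
      ‖(X k).starProjection g‖ ^ 2 + ‖(X l).starProjection g - (X k).starProjection g‖ ^ 2 := by
    intro k l hkl
    have h0 : inner ℝ ((X k).starProjection g)
        ((X l).starProjection g - (X k).starProjection g) = 0 := by
      have m : (X k).starProjection g ∈ X k := (X k).starProjection_apply_mem g
      have e1 := (X k).starProjection_inner_eq_zero g _ m
      have e2 := (X l).starProjection_inner_eq_zero g _ (hX hkl m)
      rw [inner_sub_left] at e1 e2
      rw [real_inner_comm, inner_sub_left]
      linarith
    have := norm_add_sq_real ((X k).starProjection g)
      ((X l).starProjection g - (X k).starProjection g)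
    rw [add_sub_cancel, h0] at this
    linarith
  have hε2 : 0 < ε ^ 2 := by positivity
  -- The label is the squared norm measured in units of `ε ^ 2`. Equal labels mean squared norms
  -- less than `ε ^ 2` apart, and by `pyth` this difference is the squared distance of the
  -- projections.
  have key : ∀ k l, k ≤ l → ⌊‖(X k).starProjection g‖ ^ 2 / ε ^ 2⌋₊ =
      ⌊‖(X l).starProjection g‖ ^ 2 / ε ^ 2⌋₊ →
      ‖(X l).starProjection g - (X k).starProjection g‖ ≤ ε := by
    intro k l hkl h
    have p := pyth k l hkl
    have h1 := Nat.floor_le (a := ‖(X k).starProjection g‖ ^ 2 / ε ^ 2) (by positivity)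
    have h2 := Nat.lt_floor_add_one (‖(X l).starProjection g‖ ^ 2 / ε ^ 2)
    rw [← h] at h2
    rw [le_div_iff₀ hε2] at h1
    rw [div_lt_iff₀ hε2] at h2
    exact le_of_sq_le_sq (by nlinarith) hε.le
  refine ⟨fun k => ⌊‖(X k).starProjection g‖ ^ 2 / ε ^ 2⌋₊, ?_, ?_, ?_⟩
  · intro k l hkl
    apply Nat.floor_le_floor
    gcongr
    have := pyth k l hkl
    exact le_of_sq_le_sq (by nlinarith [sq_nonneg ‖(X l).starProjection g - (X k).starProjection g‖])
      (norm_nonneg _)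
  · intro k
    apply Nat.lt_succ_of_le
    apply Nat.floor_le_floor
    gcongr
    exact ((X k).norm_starProjection_apply_le g).trans hg
  · intro k l h
    rcases le_total k l with hkl | hkl
    · rw [norm_sub_rev]; exact key k l hkl h
    · exact key l k hkl h.symm

/-! ### Galerkin solutions of coercive problems -/

/-- `u ∈ X` and `a(u, v) = F(v)` for all `v ∈ X`. -/
def IsGalerkin (a : V →L[ℝ] V →L[ℝ] ℝ) (F : V →L[ℝ] ℝ) (X : Submodule ℝ V) (u : V) : Prop :=
  u ∈ X ∧ ∀ v ∈ X, a u v = F v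

/-- Coercivity with a given constant. -/
def Coercive (a : V →L[ℝ] V →L[ℝ] ℝ) (c : ℝ) : Prop :=
  0 < c ∧ ∀ v, c * ‖v‖ ^ 2 ≤ a v v

variable {a : V →L[ℝ] V →L[ℝ] ℝ} {c : ℝ}

theorem Coercive.flip (ha : Coercive a c) : Coercive a.flip c := ⟨ha.1, fun v => ha.2 v⟩

theorem IsGalerkin.norm_le (ha : Coercive a c) {F : V →L[ℝ] ℝ} {X : Submodule ℝ V} {u : V}
    (hu : IsGalerkin a F X u) : ‖u‖ ≤ c⁻¹ * ‖F‖ := by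
  have h1 := ha.2 u
  rw [hu.2 u hu.1] at h1
  have h2 := (le_abs_self _).trans (F.le_opNorm u)
  have hc := ha.1
  rcases (norm_nonneg u).eq_or_lt with h | h
  · rw [← h]; positivity
  · rw [inv_mul_eq_div, le_div_iff₀ hc]
    nlinarith

theorem IsGalerkin.sub {F G : V →L[ℝ] ℝ} {X : Submodule ℝ V} {u v : V}
    (hu : IsGalerkin a F X u) (hv : IsGalerkin a G X v) : IsGalerkin a (F - G) X (u - v) :=
  ⟨X.sub_mem hu.1 hv.1, fun w hw => by simp [hu.2 w hw, hv.2 w hw]⟩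

/-- Galerkin solutions on `X`, shifted by an element of `X`. -/
theorem IsGalerkin.sub_mem {F : V →L[ℝ] ℝ} {X : Submodule ℝ V} {u v : V}
    (hu : IsGalerkin a F X u) (hv : v ∈ X) : IsGalerkin a (F - a v) X (u - v) :=
  hu.sub ⟨hv, fun _ _ => rfl⟩

theorem IsGalerkin.unique (ha : Coercive a c) {F : V →L[ℝ] ℝ} {X : Submodule ℝ V} {u v : V}
    (hu : IsGalerkin a F X u) (hv : IsGalerkin a F X v) : u = v := by
  have := (hu.sub hv).norm_le ha
  rw [sub_self, norm_zero, mul_zero] at this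
  exact sub_eq_zero.1 (norm_le_zero_iff.1 this)

theorem exists_isGalerkin [CompleteSpace V] (ha : Coercive a c) (F : V →L[ℝ] ℝ)
    (X : Submodule ℝ V) (hX : IsClosed (X : Set V)) : ∃ u, IsGalerkin a F X u := by
  have : CompleteSpace X := hX.completeSpace_coe
  let B : X →L[ℝ] X →L[ℝ] ℝ := a.bilinearComp X.subtypeL X.subtypeL
  have hB : IsCoercive B := ⟨c, ha.1, fun v => by
    have := ha.2 (v : V)
    simp only [B, ContinuousLinearMap.bilinearComp_apply, Submodule.subtypeL_apply]
    rw [mul_assoc, ← sq]; exact this⟩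
  let g : X := (InnerProductSpace.toDual ℝ X).symm (F.comp X.subtypeL)
  let u : X := hB.continuousLinearEquivOfBilin.symm g
  refine ⟨u, u.2, fun v hv => ?_⟩
  have h1 := hB.continuousLinearEquivOfBilin_apply u ⟨v, hv⟩
  rw [ContinuousLinearEquiv.apply_symm_apply] at h1
  have h2 : inner ℝ g (⟨v, hv⟩ : X) = F v := by
    simp only [g, InnerProductSpace.toDual_symm_apply]
    rfl
  rw [h2] at h1
  exact h1.symm

/-- One step of the Richardson iteration contracts the error. -/
theorem exists_richardson_contraction [CompleteSpace V] (ha : Coercive a c) :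
    ∃ τ ρ : ℝ, 0 < τ ∧ 0 ≤ ρ ∧ ρ < 1 ∧ ∀ (X : Submodule ℝ V) [X.HasOrthogonalProjection],
      ∀ e ∈ X, ‖e - τ • X.starProjection (InnerProductSpace.continuousLinearMapOfBilin (𝕜 := ℝ) a e)‖
        ≤ ρ * ‖e‖ := by
  set A := InnerProductSpace.continuousLinearMapOfBilin (𝕜 := ℝ) a with hA
  have hc := ha.1
  set C := ‖A‖ + c with hCdef
  have hC : 0 < C := by positivity
  have hcC : c ≤ C := by simp [hCdef]
  -- This `τ` minimizes the upper bound `1 - 2 * τ * c + τ ^ 2 * C ^ 2` for the squared contraction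
  -- factor. Only the constants of `a` enter, so `τ` and `ρ` serve all subspaces. Adding `c` to
  -- `‖A‖` gives `0 < C` and `c ≤ C`.
  refine ⟨c / C ^ 2, √(1 - c ^ 2 / C ^ 2), by positivity, Real.sqrt_nonneg _, ?_, ?_⟩
  · rw [Real.sqrt_lt' one_pos]
    have : 0 < c ^ 2 / C ^ 2 := by positivity
    linarith
  · intro X _ e he
    have h1 : inner ℝ e (X.starProjection (A e)) = a e e := by
      have := X.starProjection_inner_eq_zero (A e) e he
      rw [inner_sub_left] at this
      rw [real_inner_comm, ← InnerProductSpace.continuousLinearMapOfBilin_apply (𝕜 := ℝ) a e e]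
      linarith
    have h2 : ‖X.starProjection (A e)‖ ≤ C * ‖e‖ :=
      (X.norm_starProjection_apply_le _).trans ((A.le_opNorm e).trans
        (mul_le_mul_of_nonneg_right (by simp [hCdef, hc.le]) (norm_nonneg _)))
    have h3 : ‖X.starProjection (A e)‖ ^ 2 ≤ C ^ 2 * ‖e‖ ^ 2 := by
      rw [← mul_pow]; exact pow_le_pow_left₀ (norm_nonneg _) h2 2
    have h4 := ha.2 e
    have hsq : ‖e - (c / C ^ 2) • X.starProjection (A e)‖ ^ 2 ≤
        (1 - c ^ 2 / C ^ 2) * ‖e‖ ^ 2 := by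
      rw [norm_sub_sq_real, inner_smul_right, h1, norm_smul, mul_pow, Real.norm_eq_abs, sq_abs]
      have e1 : (c / C ^ 2) ^ 2 * ‖X.starProjection (A e)‖ ^ 2 ≤
          (c / C ^ 2) ^ 2 * (C ^ 2 * ‖e‖ ^ 2) := by gcongr
      have e2 : (c / C ^ 2) ^ 2 * (C ^ 2 * ‖e‖ ^ 2) = c ^ 2 / C ^ 2 * ‖e‖ ^ 2 := by
        field_simp
      have e3 : c / C ^ 2 * (c * ‖e‖ ^ 2) ≤ c / C ^ 2 * a e e := by gcongr
      have e4 : c / C ^ 2 * (c * ‖e‖ ^ 2) = c ^ 2 / C ^ 2 * ‖e‖ ^ 2 := by ring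
      linarith
    have hnn : 0 ≤ 1 - c ^ 2 / C ^ 2 := by
      rw [sub_nonneg, div_le_one (by positivity)]
      exact pow_le_pow_left₀ hc.le hcC 2
    have : ‖e - (c / C ^ 2) • X.starProjection (A e)‖ ≤ √((1 - c ^ 2 / C ^ 2) * ‖e‖ ^ 2) :=
      Real.le_sqrt_of_sq_le hsq
    rwa [Real.sqrt_mul hnn, Real.sqrt_sq (norm_nonneg _)] at this

/-- The Richardson iteration for the Galerkin system on `X k`. -/
noncomputable def richardson (A : V →L[ℝ] V) (g : V) (τ : ℝ) (X : ℕ → Submodule ℝ V)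
    [∀ k, (X k).HasOrthogonalProjection] : ℕ → ℕ → V
  | 0, _ => 0
  | n + 1, k => richardson A g τ X n k +
      τ • (X k).starProjection (g - A (richardson A g τ X n k))

/-- One iteration is a diagonal sequence of the maps `x ↦ x + τ • P_k (g - A x)`. They are Lipschitz
with constant `1 + τ * ‖A‖`, and for frozen `x` only the projection of a fixed residual varies with
`k`. The bound `B` on the iterates bounds these residuals, which makes the number of intervals
independent of the spaces and of `g`. -/
theorem exists_oscLE_richardson (A : V →L[ℝ] V) {τ : ℝ} (hτ : 0 < τ) (n : ℕ) :
    ∃ B : ℝ, 0 ≤ B ∧ ∀ ε : ℝ, 0 < ε → ∃ M : ℕ, ∀ (X : ℕ → Submodule ℝ V)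
      [∀ k, (X k).HasOrthogonalProjection], Monotone X → ∀ g : V, ‖g‖ ≤ 1 →
      (∀ k, ‖richardson A g τ X n k‖ ≤ B) ∧ OscLE (richardson A g τ X n) ε M := by
  induction n with
  | zero =>
    refine ⟨0, le_rfl, fun ε hε => ⟨1, fun X _ _ g _ => ⟨fun k => by simp [richardson], ?_⟩⟩⟩
    exact OscLE.const 0 hε.le
  | succ n ih =>
    obtain ⟨B, hB, ih⟩ := ih
    have hAn := norm_nonneg A
    refine ⟨B + τ * (1 + ‖A‖ * B), by positivity, fun ε hε => ?_⟩
    set C := 1 + τ * ‖A‖ with hC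
    have hCpos : 0 < C := by positivity
    obtain ⟨M, hM⟩ := ih (ε / (4 * C)) (by positivity)
    refine ⟨M * (⌊(1 + ‖A‖ * B) ^ 2 / (ε / (2 * τ)) ^ 2⌋₊ + 1), fun X _ hX g hg => ?_⟩
    obtain ⟨hb, ho⟩ := hM X hX g hg
    have hres : ∀ k, ‖g - A (richardson A g τ X n k)‖ ≤ 1 + ‖A‖ * B := fun k =>
      (norm_sub_le _ _).trans (add_le_add hg ((A.le_opNorm _).trans (by gcongr; exact hb k)))
    refine ⟨fun k => ?_, ?_⟩
    · rw [richardson]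
      refine (norm_add_le _ _).trans (add_le_add (hb k) ?_)
      rw [norm_smul, Real.norm_of_nonneg hτ.le]
      gcongr
      exact ((X k).norm_starProjection_apply_le _).trans (hres k)
    · have hd := ho.diagonal (ε := ε / 2)
        (M' := ⌊(1 + ‖A‖ * B) ^ 2 / (ε / (2 * τ)) ^ 2⌋₊ + 1)
        (fun k x => x + τ • (X k).starProjection (g - A x)) hCpos.le ?_ ?_
      · refine (hd.mono_eps (le_of_eq ?_))
        field_simp; ring
      · intro k j l
        set x := richardson A g τ X n j
        set y := richardson A g τ X n l
        have e : x + τ • (X k).starProjection (g - A x) - (y + τ • (X k).starProjection (g - A y))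
            = (x - y) - τ • (X k).starProjection (A (x - y)) := by
          simp only [map_sub, smul_sub]; abel
        rw [e, hC, add_mul, one_mul]
        refine (norm_sub_le _ _).trans (add_le_add le_rfl ?_)
        rw [norm_smul, Real.norm_of_nonneg hτ.le, mul_assoc]
        gcongr
        exact ((X k).norm_starProjection_apply_le _).trans (A.le_opNorm _)
      · intro j
        have hp := oscLE_starProjection X hX _ (hres j) (ε := ε / (2 * τ)) (by positivity)
        refine (hp.comp_lipschitz hτ.le (y := fun k => richardson A g τ X n j +
          τ • (X k).starProjection (g - A (richardson A g τ X n j))) ?_).mono_eps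
          (le_of_eq (by field_simp))
        intro k l
        rw [add_sub_add_left_eq_sub, ← smul_sub, norm_smul, Real.norm_of_nonneg hτ.le]

/-- Galerkin approximations on nested spaces have a uniformly bounded number of large
oscillations. -/
theorem exists_oscLE_galerkin [CompleteSpace V] (ha : Coercive a c) {ε : ℝ} (hε : 0 < ε) :
    ∃ M : ℕ, ∀ X : ℕ → Submodule ℝ V, (∀ k, IsClosed (X k : Set V)) → Monotone X →
      ∀ (R : ℝ) (F : V →L[ℝ] ℝ), ‖F‖ ≤ R → ∀ u : ℕ → V, (∀ k, IsGalerkin a F (X k) (u k)) →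
      OscLE u (ε * R) M := by
  obtain ⟨τ, ρ, hτ, hρ0, hρ1, hcontr⟩ := exists_richardson_contraction ha
  set A := InnerProductSpace.continuousLinearMapOfBilin (𝕜 := ℝ) a with hA
  have hc := ha.1
  -- Since `‖u k‖ ≤ c⁻¹` for loads of norm at most one, `n` iterations starting at zero leave an
  -- error of at most `ε / 4`. Replacing the iterates by `u` therefore enlarges the oscillation from
  -- `ε / 2` to `ε`.
  obtain ⟨n, hn⟩ := exists_pow_lt_of_lt_one (show 0 < ε / 4 * c by positivity) hρ1
  obtain ⟨B, hB, hrich⟩ := exists_oscLE_richardson A hτ n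
  obtain ⟨M, hM⟩ := hrich (ε / 2) (by positivity)
  refine ⟨M, fun X hXc hX => ?_⟩
  have : ∀ k, CompleteSpace (X k) := fun k => (hXc k).completeSpace_coe
  have unit : ∀ F : V →L[ℝ] ℝ, ‖F‖ ≤ 1 → ∀ u : ℕ → V, (∀ k, IsGalerkin a F (X k) (u k)) →
      OscLE u ε M := by
    intro F hF u hu
    set g := (InnerProductSpace.toDual ℝ V).symm F with hg
    have hgF : ∀ v, inner ℝ g v = F v := fun v => InnerProductSpace.toDual_symm_apply
    have hgn : ‖g‖ ≤ 1 := by rw [hg, LinearIsometryEquiv.norm_map]; exact hF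
    obtain ⟨-, ho⟩ := hM X hX g hgn
    -- The Galerkin solution is the fixed point of the iteration on `X k`, so the error is
    -- propagated by the contraction.
    have hfix : ∀ k, (X k).starProjection (g - A (u k)) = 0 := by
      intro k
      rw [Submodule.starProjection_apply_eq_zero_iff]
      intro v hv
      rw [real_inner_comm, inner_sub_left, hgF,
        InnerProductSpace.continuousLinearMapOfBilin_apply, (hu k).2 v hv, sub_self]
    have hmem : ∀ m k, richardson A g τ X m k ∈ X k := by
      intro m k
      induction m with
      | zero => exact (X k).zero_mem
      | succ m ih => exact (X k).add_mem ih ((X k).smul_mem _ ((X k).starProjection_apply_mem _))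
    have herr : ∀ m k, ‖u k - richardson A g τ X m k‖ ≤ ρ ^ m * ‖u k‖ := by
      intro m k
      induction m with
      | zero => simp [richardson]
      | succ m ih =>
        have e : u k - richardson A g τ X (m + 1) k = (u k - richardson A g τ X m k) -
            τ • (X k).starProjection (A (u k - richardson A g τ X m k)) := by
          have h1 := hfix k
          rw [map_sub, sub_eq_zero] at h1
          rw [richardson]
          simp only [map_sub, smul_sub, h1]
          abel
        rw [e]
        refine (hcontr (X k) _ ((X k).sub_mem (hu k).1 (hmem m k))).trans ?_
        rw [pow_succ', mul_assoc]
        gcongr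
    refine (ho.of_close (δ := ε / 4) fun k => ?_).mono_eps (by linarith)
    rw [norm_sub_rev]
    refine (herr n k).trans ?_
    have h1 : ‖u k‖ ≤ c⁻¹ * 1 := ((hu k).norm_le ha).trans (by gcongr)
    calc ρ ^ n * ‖u k‖ ≤ (ε / 4 * c) * (c⁻¹ * 1) := by gcongr
      _ = ε / 4 := by field_simp
  intro R F hF u hu
  have hR : 0 ≤ R := (norm_nonneg F).trans hF
  rcases hR.eq_or_lt with h0 | hpos
  · have hu0 : ∀ k, u k = 0 := fun k => by
      have := (hu k).norm_le ha
      have hF0 : ‖F‖ = 0 := le_antisymm (hF.trans h0.symm.le) (norm_nonneg F)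
      rw [hF0, mul_zero] at this
      exact norm_le_zero_iff.1 this
    -- For `R = 0` all solutions vanish, and only some monotone labelling with values below `M` is
    -- needed.
    obtain ⟨φ, h1, h2, -⟩ := unit 0 (by simp) (fun _ => 0)
      (fun k => ⟨(X k).zero_mem, by simp⟩)
    exact ⟨φ, h1, h2, fun k l _ => by simp [hu0, ← h0]⟩
  · have h := unit (R⁻¹ • F) (by
      rw [norm_smul, Real.norm_of_nonneg (by positivity), inv_mul_eq_div]
      exact (div_le_one hpos).2 hF) (fun k => R⁻¹ • u k)
      (fun k => ⟨(X k).smul_mem _ (hu k).1, fun v hv => by simp [(hu k).2 v hv]⟩)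
    have := h.comp_lipschitz (y := u) hpos.le (fun k l => by
      rw [← smul_sub, norm_smul, Real.norm_of_nonneg (by positivity : 0 ≤ R⁻¹),
        mul_inv_cancel_left₀ hpos.ne'])
    rwa [mul_comm] at this

end Hilbert

/-! ### Contraction of estimator sequences -/

/-- If `n` marked indices precede `k` in its interval, then `e k` is reduced `n` times. -/
theorem le_of_le_card_marked {e : ℕ → ℝ} {δ : ℕ → ℕ → ℝ} {φ : ℕ → ℕ} {S : Finset ℕ}
    {q Q E ε : ℝ} (hq0 : 0 ≤ q) (hq1 : q < 1) (hε : 0 ≤ ε) (hE : 0 ≤ E)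
    (hbd : ∀ k, e k ≤ Q * E) (hstab : ∀ k l, k ≤ l → e l ≤ e k + δ k l)
    (hred : ∀ k ∈ S, e (k + 1) ≤ q * e k + δ k (k + 1)) (hφ : Monotone φ)
    (hδ : ∀ k l, k ≤ l → φ k = φ l → δ k l ≤ ε * E) (n k : ℕ)
    (hn : n ≤ (S.filter fun j => j < k ∧ φ j = φ k).card) :
    e k ≤ (q ^ n * Q + 2 * ε / (1 - q)) * E := by
  have h1q : 0 < 1 - q := by linarith
  induction n generalizing k with
  | zero =>
    have : 0 ≤ 2 * ε / (1 - q) * E := by positivity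
    rw [pow_zero, one_mul, add_mul]
    linarith [hbd k]
  | succ n ih =>
    set B := S.filter fun j => j < k ∧ φ j = φ k with hB
    have hne : B.Nonempty := Finset.card_pos.1 (by omega)
    -- The last marked index before `k` in its interval. Then `j` has `n` marked predecessors there,
    -- and `j + 1` still lies in the interval, because the labels of `j` and `k` agree.
    set j := B.max' hne with hj
    have hjB : j ∈ B := B.max'_mem hne
    obtain ⟨hjS, hjk, hjφ⟩ := Finset.mem_filter.1 hjB
    have hsub : B.erase j ⊆ S.filter fun i => i < j ∧ φ i = φ j := by
      intro i hi
      obtain ⟨hij, hiB⟩ := Finset.mem_erase.1 hi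
      obtain ⟨hiS, -, hiφ⟩ := Finset.mem_filter.1 hiB
      exact Finset.mem_filter.2 ⟨hiS, (B.le_max' i hiB).lt_of_ne hij, hiφ.trans hjφ.symm⟩
    have hcard : n ≤ (S.filter fun i => i < j ∧ φ i = φ j).card := by
      have := Finset.card_le_card hsub
      rw [Finset.card_erase_of_mem hjB] at this
      omega
    have h1 := ih j hcard
    have hφ1 : φ (j + 1) = φ k :=
      le_antisymm (hφ hjk) (hjφ ▸ hφ (Nat.le_succ j))
    have h2 := hstab (j + 1) k hjk
    have h3 := hred j hjS
    have h4 := hδ (j + 1) k hjk hφ1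
    have h5 := hδ j (j + 1) (Nat.le_succ j) (hjφ.trans hφ1.symm)
    have h6 := mul_le_mul_of_nonneg_left h1 hq0
    -- Two perturbations occur, one from `j` to `j + 1` and one from `j + 1` to `k`. The term `2 * ε
    -- / (1 - q)` is the fixed point of `y ↦ q * y + 2 * ε`.
    have h7 : q * ((q ^ n * Q + 2 * ε / (1 - q)) * E) + 2 * (ε * E) =
        (q ^ (n + 1) * Q + 2 * ε / (1 - q)) * E := by
      field_simp; ring
    linarith

/-- Sufficiently many marked steps make the estimator small, if it is nearly constant up to
reduction on few intervals. -/
theorem exists_marks_suffice {q Q κ : ℝ} (hq0 : 0 ≤ q) (hq1 : q < 1) (hQ : 0 < Q) (hκ : 0 < κ) :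
    ∃ ε : ℝ, 0 < ε ∧ ∀ M : ℕ, ∃ m : ℕ, ∀ (e : ℕ → ℝ) (δ : ℕ → ℕ → ℝ) (φ : ℕ → ℕ)
      (S : Finset ℕ) (N : ℕ) (E : ℝ), 0 ≤ E → (∀ k, e k ≤ Q * E) →
      (∀ k l, k ≤ l → e l ≤ Q * e k) → (∀ k l, k ≤ l → e l ≤ e k + δ k l) →
      (∀ k ∈ S, e (k + 1) ≤ q * e k + δ k (k + 1)) → Monotone φ → (∀ k, φ k < M) →
      (∀ k l, k ≤ l → φ k = φ l → δ k l ≤ ε * E) → S ⊆ Finset.range N → m ≤ S.card →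
      e N ≤ κ * E := by
  have h1q : 0 < 1 - q := by linarith
  obtain ⟨n, hn⟩ := exists_pow_lt_of_lt_one (show 0 < κ / (2 * Q ^ 2) by positivity) hq1
  -- `ε` must not depend on `M`, since the number of intervals is known only after `ε` is fixed.
  -- With `M * n + 1` marked steps some interval contains more than `n`, so the last of them has `n`
  -- predecessors. The contraction and the perturbations then contribute at most `κ / (2 * Q)` each,
  -- and passing on to `N` costs the factor `Q`.
  refine ⟨κ * (1 - q) / (4 * Q), by positivity, fun M => ⟨M * n + 1, ?_⟩⟩
  intro e δ φ S N E hE hbd hmono hstab hred hφ hφM hδ hSN hm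
  obtain ⟨c, -, hc⟩ := Finset.exists_lt_card_fiber_of_mul_lt_card_of_maps_to
    (s := S) (t := Finset.range M) (f := φ) (n := n)
    (fun k _ => Finset.mem_range.2 (hφM k)) (by rw [Finset.card_range]; omega)
  set B := S.filter fun j => φ j = c with hB
  have hne : B.Nonempty := Finset.card_pos.1 (by omega)
  set k := B.max' hne with hk
  have hkB : k ∈ B := B.max'_mem hne
  obtain ⟨hkS, hkc⟩ := Finset.mem_filter.1 hkB
  have hsub : B.erase k ⊆ S.filter fun i => i < k ∧ φ i = φ k := by
    intro i hi
    obtain ⟨hij, hiB⟩ := Finset.mem_erase.1 hi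
    obtain ⟨hiS, hiφ⟩ := Finset.mem_filter.1 hiB
    exact Finset.mem_filter.2 ⟨hiS, (B.le_max' i hiB).lt_of_ne hij, hiφ.trans hkc.symm⟩
  have hcard : n ≤ (S.filter fun i => i < k ∧ φ i = φ k).card := by
    have := Finset.card_le_card hsub
    rw [Finset.card_erase_of_mem hkB] at this
    omega
  have h1 := le_of_le_card_marked hq0 hq1 (ε := κ * (1 - q) / (4 * Q)) (by positivity) hE hbd
    hstab hred hφ hδ n k hcard
  have h2 := hmono k N (Finset.mem_range.1 (hSN hkS)).le
  have h3 : q ^ n * Q + 2 * (κ * (1 - q) / (4 * Q)) / (1 - q) ≤ κ / Q := by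
    have e1 : q ^ n * Q ≤ κ / (2 * Q ^ 2) * Q := by gcongr
    have e2 : κ / (2 * Q ^ 2) * Q + 2 * (κ * (1 - q) / (4 * Q)) / (1 - q) = κ / Q := by
      field_simp; ring
    linarith
  calc e N ≤ Q * ((q ^ n * Q + 2 * (κ * (1 - q) / (4 * Q)) / (1 - q)) * E) :=
        h2.trans (by gcongr)
    _ ≤ Q * (κ / Q * E) := by gcongr
    _ = κ * E := by field_simp

/-- Halving every `N` steps, together with quasi-monotonicity, is linear convergence. -/
theorem linear_convergence_of_halving {P : ℕ → ℝ} {Q : ℝ} {N : ℕ} (hN : 0 < N) (hQ : 0 < Q)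
    (hP : ∀ k, 0 ≤ P k) (hmono : ∀ l n, l ≤ n → P n ≤ Q * P l)
    (hhalf : ∀ k, P (k + N) ≤ 1 / 2 * P k) (l n : ℕ) (hln : l ≤ n) :
    P n ≤ 2 * Q * ((1 / 2 : ℝ) ^ (1 / N : ℝ)) ^ (n - l) * P l := by
  set q := (1 / 2 : ℝ) ^ (1 / N : ℝ) with hq
  have hNR : (0 : ℝ) < N := by exact_mod_cast hN
  have hq0 : 0 < q := by positivity
  have hq1 : q ≤ 1 := Real.rpow_le_one (by norm_num) (by norm_num) (by positivity)
  have hqN : q ^ N = 1 / 2 := by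
    rw [hq, ← Real.rpow_natCast, ← Real.rpow_mul (by norm_num), one_div_mul_cancel hNR.ne',
      Real.rpow_one]
  have hiter : ∀ i k, P (k + N * i) ≤ (1 / 2) ^ i * P k := by
    intro i k
    induction i with
    | zero => simp
    | succ i ih =>
      rw [Nat.mul_succ, ← Nat.add_assoc, pow_succ']
      linarith [hhalf (k + N * i)]
  obtain ⟨m, rfl⟩ := Nat.exists_eq_add_of_le hln
  rw [Nat.add_sub_cancel_left]
  have hm := Nat.div_add_mod m N
  have hmod := Nat.mod_lt m hN
  have h1 := hiter (m / N) l
  have h2 := hmono (l + N * (m / N)) (l + m) (by omega)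
  -- The factor two pays for the incomplete last period: its length is `m % N < N`, and `q ^ N = 1 /
  -- 2`.
  have h3 : (1 / 2 : ℝ) ^ (m / N) ≤ 2 * q ^ m := by
    have e1 : q ^ N ≤ q ^ (m % N) := pow_le_pow_of_le_one hq0.le hq1 hmod.le
    have e2 : q ^ m = (1 / 2) ^ (m / N) * q ^ (m % N) := by
      rw [← hqN, ← pow_mul, ← pow_add, hm]
    rw [e2]
    rw [hqN] at e1
    have : (0 : ℝ) < (1 / 2) ^ (m / N) := by positivity
    nlinarith
  calc P (l + m) ≤ Q * ((1 / 2) ^ (m / N) * P l) := h2.trans (by gcongr)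
    _ ≤ Q * (2 * q ^ m * P l) := by have := hP l; gcongr
    _ = 2 * Q * q ^ m * P l := by ring

/-- Inequalities between components give inequalities between Euclidean norms. -/
theorem sqrt_sum_sq_le_add {x₁ x₂ x₃ x₄ y₁ y₂ y₃ y₄ D : ℝ} (hx₁ : 0 ≤ x₁) (hx₂ : 0 ≤ x₂)
    (hx₃ : 0 ≤ x₃) (hx₄ : 0 ≤ x₄) (hD : 0 ≤ D) (h₁ : x₁ ≤ y₁ + D) (h₂ : x₂ ≤ y₂ + D)
    (h₃ : x₃ ≤ y₃ + D) (h₄ : x₄ ≤ y₄ + D) :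
    √(x₁ ^ 2 + x₂ ^ 2 + x₃ ^ 2 + x₄ ^ 2) ≤ √(y₁ ^ 2 + y₂ ^ 2 + y₃ ^ 2 + y₄ ^ 2) + 2 * D := by
  set Y := √(y₁ ^ 2 + y₂ ^ 2 + y₃ ^ 2 + y₄ ^ 2) with hY
  have hY2 : Y ^ 2 = y₁ ^ 2 + y₂ ^ 2 + y₃ ^ 2 + y₄ ^ 2 := Real.sq_sqrt (by positivity)
  have hY0 : 0 ≤ Y := Real.sqrt_nonneg _
  -- Cauchy–Schwarz with the vector of four ones, which is also the source of the factor two in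
  -- front of `D`.
  have hsum : y₁ + y₂ + y₃ + y₄ ≤ 2 * Y := by
    apply le_of_sq_le_sq _ (by positivity)
    nlinarith [sq_nonneg (y₁ - y₂), sq_nonneg (y₁ - y₃), sq_nonneg (y₁ - y₄),
      sq_nonneg (y₂ - y₃), sq_nonneg (y₂ - y₄), sq_nonneg (y₃ - y₄)]
  rw [Real.sqrt_le_left (by positivity)]
  have e₁ := pow_le_pow_left₀ hx₁ h₁ 2
  have e₂ := pow_le_pow_left₀ hx₂ h₂ 2
  have e₃ := pow_le_pow_left₀ hx₃ h₃ 2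
  have e₄ := pow_le_pow_left₀ hx₄ h₄ 2
  nlinarith [mul_le_mul_of_nonneg_left hsum hD]

/-! ### Bounded bilinear integral forms on `L²` -/

section L2

variable {α : Type*} [MeasurableSpace α] {μ : Measure α}
  {F G : Type*} [NormedAddCommGroup F] [NormedAddCommGroup G]

theorem integral_norm_sq_eq [InnerProductSpace ℝ F] (f : Lp F 2 μ) : ∫ x, ‖f x‖ ^ 2 ∂μ = ‖f‖ ^ 2 := by
  rw [← real_inner_self_eq_norm_sq, L2.inner_def]
  simp only [real_inner_self_eq_norm_sq]

theorem integrable_norm_mul_norm (f : Lp F 2 μ) (g : Lp G 2 μ) :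
    Integrable (fun x => ‖f x‖ * ‖g x‖) μ :=
  (Lp.memLp f).norm.integrable_mul (Lp.memLp g).norm

theorem integral_norm_mul_norm_le [InnerProductSpace ℝ F] [InnerProductSpace ℝ G] (f : Lp F 2 μ) (g : Lp G 2 μ) :
    ∫ x, ‖f x‖ * ‖g x‖ ∂μ ≤ ‖f‖ * ‖g‖ := by
  have hpq : (2 : ℝ).HolderConjugate 2 := Real.HolderConjugate.two_two
  have h := integral_mul_le_Lp_mul_Lq_of_nonneg (μ := μ) hpq
    (f := fun x => ‖f x‖) (g := fun x => ‖g x‖)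
    (Filter.Eventually.of_forall fun _ => norm_nonneg _)
    (Filter.Eventually.of_forall fun _ => norm_nonneg _)
    (by simpa using (Lp.memLp f).norm) (by simpa using (Lp.memLp g).norm)
  simp only [Real.rpow_two, integral_norm_sq_eq, ← Real.sqrt_eq_rpow,
    Real.sqrt_sq (norm_nonneg _)] at h
  exact h

theorem integrable_of_le_norm_mul_norm {k : α → ℝ} {C : ℝ} (f : Lp F 2 μ) (g : Lp G 2 μ)
    (hk : AEStronglyMeasurable k μ) (hle : ∀ᵐ x ∂μ, |k x| ≤ C * (‖f x‖ * ‖g x‖)) :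
    Integrable k μ := by
  refine ((integrable_norm_mul_norm f g).const_mul C).mono' hk ?_
  filter_upwards [hle] with x hx using hx

theorem abs_integral_le_of_le_norm_mul_norm [InnerProductSpace ℝ F] [InnerProductSpace ℝ G]
    {k : α → ℝ} {C : ℝ} (hC : 0 ≤ C) (f : Lp F 2 μ)
    (g : Lp G 2 μ) (hle : ∀ᵐ x ∂μ, |k x| ≤ C * (‖f x‖ * ‖g x‖)) :
    |∫ x, k x ∂μ| ≤ C * (‖f‖ * ‖g‖) := by
  have h := norm_integral_le_of_norm_le (f := k) ((integrable_norm_mul_norm f g).const_mul C) hle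
  rw [integral_const_mul] at h
  exact h.trans (mul_le_mul_of_nonneg_left (integral_norm_mul_norm_le f g) hC)

end L2

theorem exists_ae_norm_le {α F : Type*} [MeasurableSpace α] {μ : Measure α}
    [NormedAddCommGroup F] {f : α → F} (hf : MemLp f ⊤ μ) :
    ∃ C : ℝ, 0 ≤ C ∧ ∀ᵐ x ∂μ, ‖f x‖ ≤ C := by
  refine ⟨(eLpNorm f ⊤ μ).toReal, ENNReal.toReal_nonneg, ?_⟩
  rw [eLpNorm_exponent_top]
  filter_upwards [ae_le_eLpNormEssSup (f := f) (μ := μ)] with x hx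
  have hfin : eLpNormEssSup f μ ≠ ⊤ := by
    have := hf.2
    rw [eLpNorm_exponent_top] at this
    exact this.ne
  have := ENNReal.toReal_mono hfin hx
  simpa using this

/-! ### The bilinear form as a continuous bilinear map -/

section Form

variable {d : ℕ} {Ω : Set (E d)}

theorem abs_ofLp_le (y : E d) (i : Fin d) : |y.ofLp i| ≤ ‖y‖ := PiLp.norm_apply_le y i

theorem abs_mulVec_dotProduct_le (B : Matrix (Fin d) (Fin d) ℝ) (y z : E d) :
    |(B *ᵥ y.ofLp) ⬝ᵥ z.ofLp| ≤ (∑ i, ∑ j, |B i j|) * (‖y‖ * ‖z‖) := by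
  simp only [dotProduct, mulVec, Finset.sum_mul]
  refine (Finset.abs_sum_le_sum_abs _ _).trans (Finset.sum_le_sum fun i _ => ?_)
  refine (Finset.abs_sum_le_sum_abs _ _).trans (Finset.sum_le_sum fun j _ => ?_)
  rw [abs_mul, abs_mul, mul_assoc]
  gcongr
  · exact abs_ofLp_le y j
  · exact abs_ofLp_le z i

theorem abs_dotProduct_le (y z : E d) : |y.ofLp ⬝ᵥ z.ofLp| ≤ ‖y‖ * ‖z‖ := by
  have h := abs_real_inner_le_norm z y
  rw [EuclideanSpace.inner_eq_star_dotProduct] at h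
  rw [mul_comm]
  simpa using h

theorem wgrad_memLp (u : H10 Ω) : MemLp (wgrad u) 2 (volume.restrict Ω) := Lp.memLp _

theorem fn_memLp (u : H10 Ω) : MemLp (fn u) 2 (volume.restrict Ω) := Lp.memLp _

theorem wgrad_add (u v : H10 Ω) :
    wgrad (u + v) =ᵐ[volume.restrict Ω] fun x => wgrad u x + wgrad v x :=
  Lp.coeFn_add (u : L2Pair Ω).snd (v : L2Pair Ω).snd

theorem wgrad_smul (t : ℝ) (u : H10 Ω) :
    wgrad (t • u) =ᵐ[volume.restrict Ω] fun x => t • wgrad u x :=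
  Lp.coeFn_smul t (u : L2Pair Ω).snd

theorem fn_add (u v : H10 Ω) :
    fn (u + v) =ᵐ[volume.restrict Ω] fun x => fn u x + fn v x :=
  Lp.coeFn_add (u : L2Pair Ω).fst (v : L2Pair Ω).fst

theorem fn_smul (t : ℝ) (u : H10 Ω) :
    fn (t • u) =ᵐ[volume.restrict Ω] fun x => t * fn u x :=
  Lp.coeFn_smul t (u : L2Pair Ω).fst

theorem norm_sq_eq (u : H10 Ω) :
    ‖u‖ ^ 2 = ‖(u : L2Pair Ω).fst‖ ^ 2 + ‖(u : L2Pair Ω).snd‖ ^ 2 := by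
  rw [← WithLp.prod_norm_sq_eq_of_L2]; rfl

theorem norm_fst_le (u : H10 Ω) : ‖(u : L2Pair Ω).fst‖ ≤ ‖u‖ :=
  le_of_sq_le_sq (by rw [norm_sq_eq]; nlinarith [sq_nonneg ‖(u : L2Pair Ω).snd‖]) (norm_nonneg _)

theorem norm_snd_le (u : H10 Ω) : ‖(u : L2Pair Ω).snd‖ ≤ ‖u‖ :=
  le_of_sq_le_sq (by rw [norm_sq_eq]; nlinarith [sq_nonneg ‖(u : L2Pair Ω).fst‖]) (norm_nonneg _)

/-- The embedding of `H^1_0(Ω)` into `L²(Ω)`. -/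
noncomputable def fnL : H10 Ω →L[ℝ] Lp ℝ 2 (volume.restrict Ω) :=
  LinearMap.mkContinuous
    { toFun := fun u => (u : L2Pair Ω).fst
      map_add' := fun _ _ => rfl
      map_smul' := fun _ _ => rfl } 1 (fun u => by rw [one_mul]; exact norm_fst_le u)

/-- The weak gradient as an operator into `L²(Ω)^d`. -/
noncomputable def wgradL : H10 Ω →L[ℝ] Lp (E d) 2 (volume.restrict Ω) :=
  LinearMap.mkContinuous
    { toFun := fun u => (u : L2Pair Ω).snd
      map_add' := fun _ _ => rfl
      map_smul' := fun _ _ => rfl } 1 (fun u => by rw [one_mul]; exact norm_snd_le u)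

theorem aestronglyMeasurable_apply {f : E d → E d}
    (hf : AEStronglyMeasurable f (volume.restrict Ω)) (i : Fin d) :
    AEStronglyMeasurable (fun x => (f x).ofLp i) (volume.restrict Ω) :=
  (EuclideanSpace.proj i : E d →L[ℝ] ℝ).continuous.comp_aestronglyMeasurable hf

theorem aestronglyMeasurable_dotProduct {f g : E d → E d}
    (hf : AEStronglyMeasurable f (volume.restrict Ω))
    (hg : AEStronglyMeasurable g (volume.restrict Ω)) :
    AEStronglyMeasurable (fun x => (f x).ofLp ⬝ᵥ (g x).ofLp) (volume.restrict Ω) := by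
  simp only [dotProduct]
  exact Finset.aestronglyMeasurable_fun_sum _ fun i _ =>
    (aestronglyMeasurable_apply hf i).mul (aestronglyMeasurable_apply hg i)

theorem aestronglyMeasurable_mulVec_dotProduct {A : E d → Matrix (Fin d) (Fin d) ℝ}
    {f g : E d → E d}
    (hA : ∀ i j, AEStronglyMeasurable (fun x => A x i j) (volume.restrict Ω))
    (hf : AEStronglyMeasurable f (volume.restrict Ω))
    (hg : AEStronglyMeasurable g (volume.restrict Ω)) :
    AEStronglyMeasurable (fun x => (A x *ᵥ (f x).ofLp) ⬝ᵥ (g x).ofLp) (volume.restrict Ω) := by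
  simp only [dotProduct, mulVec]
  exact Finset.aestronglyMeasurable_fun_sum _ fun i _ =>
    (Finset.aestronglyMeasurable_fun_sum _ fun j _ =>
      (hA i j).mul (aestronglyMeasurable_apply hf j)).mul (aestronglyMeasurable_apply hg i)

/-- A bounded bilinear form on `H^1_0(Ω)` given by integrals of pointwise bilinear integrands. -/
theorem exists_continuousBilinear_of_integrand (k : H10 Ω → H10 Ω → E d → ℝ)
    (hint : ∀ u v, Integrable (k u v) (volume.restrict Ω))
    (hadd₁ : ∀ u u' v, k (u + u') v =ᵐ[volume.restrict Ω] fun x => k u v x + k u' v x)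
    (hsmul₁ : ∀ (t : ℝ) u v, k (t • u) v =ᵐ[volume.restrict Ω] fun x => t * k u v x)
    (hadd₂ : ∀ u v v', k u (v + v') =ᵐ[volume.restrict Ω] fun x => k u v x + k u v' x)
    (hsmul₂ : ∀ (t : ℝ) u v, k u (t • v) =ᵐ[volume.restrict Ω] fun x => t * k u v x)
    {C : ℝ} (hC : ∀ u v, |∫ x in Ω, k u v x| ≤ C * ‖u‖ * ‖v‖) :
    ∃ a : H10 Ω →L[ℝ] H10 Ω →L[ℝ] ℝ, ∀ u v, a u v = ∫ x in Ω, k u v x := by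
  refine ⟨(LinearMap.mk₂ ℝ (fun u v => ∫ x in Ω, k u v x) ?_ ?_ ?_ ?_).mkContinuous₂ C hC,
    fun u v => rfl⟩
  · intro u u' v
    rw [integral_congr_ae (hadd₁ u u' v), integral_add (hint _ _) (hint _ _)]
  · intro t u v
    rw [integral_congr_ae (hsmul₁ t u v), integral_const_mul, smul_eq_mul]
  · intro u v v'
    rw [integral_congr_ae (hadd₂ u v v'), integral_add (hint _ _) (hint _ _)]
  · intro t u v
    rw [integral_congr_ae (hsmul₂ t u v), integral_const_mul, smul_eq_mul]

theorem exists_principalForm_clm {A : E d → Matrix (Fin d) (Fin d) ℝ}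
    (hA : ∀ i j, MemLp (fun x => A x i j) ⊤ (volume.restrict Ω)) :
    ∃ a : H10 Ω →L[ℝ] H10 Ω →L[ℝ] ℝ, ∀ u v, a u v = principalForm A u v := by
  choose CA hCA0 hCA using fun i j => exists_ae_norm_le (hA i j)
  have hS : 0 ≤ ∑ i, ∑ j, CA i j :=
    Finset.sum_nonneg fun i _ => Finset.sum_nonneg fun j _ => hCA0 i j
  have hle : ∀ u v : H10 Ω, ∀ᵐ x ∂(volume.restrict Ω),
      |(A x *ᵥ (wgrad u x).ofLp) ⬝ᵥ (wgrad v x).ofLp| ≤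
        (∑ i, ∑ j, CA i j) * (‖(u : L2Pair Ω).snd x‖ * ‖(v : L2Pair Ω).snd x‖) := by
    intro u v
    have h : ∀ᵐ x ∂(volume.restrict Ω), ∀ i j, ‖A x i j‖ ≤ CA i j := by
      rw [ae_all_iff]; intro i; rw [ae_all_iff]; exact fun j => hCA i j
    filter_upwards [h] with x hx
    refine (abs_mulVec_dotProduct_le _ _ _).trans ?_
    refine mul_le_mul_of_nonneg_right ?_ (by positivity)
    exact Finset.sum_le_sum fun i _ => Finset.sum_le_sum fun j _ => hx i j
  refine exists_continuousBilinear_of_integrand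
    (fun u v x => (A x *ᵥ (wgrad u x).ofLp) ⬝ᵥ (wgrad v x).ofLp) ?_ ?_ ?_ ?_ ?_
    (C := ∑ i, ∑ j, CA i j) ?_
  · exact fun u v => integrable_of_le_norm_mul_norm _ _
      (aestronglyMeasurable_mulVec_dotProduct (fun i j => (hA i j).1) (wgrad_memLp u).1
        (wgrad_memLp v).1) (hle u v)
  · intro u u' v
    filter_upwards [wgrad_add u u'] with x hx
    simp only [hx, WithLp.ofLp_add, mulVec_add, add_dotProduct]
  · intro t u v
    filter_upwards [wgrad_smul t u] with x hx
    simp only [hx, WithLp.ofLp_smul, mulVec_smul, smul_dotProduct, smul_eq_mul]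
  · intro u v v'
    filter_upwards [wgrad_add v v'] with x hx
    simp only [hx, WithLp.ofLp_add, dotProduct_add]
  · intro t u v
    filter_upwards [wgrad_smul t v] with x hx
    simp only [hx, WithLp.ofLp_smul, dotProduct_smul, smul_eq_mul]
  · intro u v
    refine (abs_integral_le_of_le_norm_mul_norm hS _ _ (hle u v)).trans ?_
    rw [mul_assoc]
    gcongr
    · exact norm_snd_le u
    · exact norm_snd_le v

theorem exists_convectionForm_clm {b : E d → E d} (hb : MemLp b ⊤ (volume.restrict Ω)) :
    ∃ a : H10 Ω →L[ℝ] H10 Ω →L[ℝ] ℝ, ∀ u v,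
      a u v = ∫ x in Ω, ((b x).ofLp ⬝ᵥ (wgrad u x).ofLp) * fn v x := by
  obtain ⟨C, hC0, hC⟩ := exists_ae_norm_le hb
  have hle : ∀ u v : H10 Ω, ∀ᵐ x ∂(volume.restrict Ω),
      |((b x).ofLp ⬝ᵥ (wgrad u x).ofLp) * fn v x| ≤
        C * (‖(u : L2Pair Ω).snd x‖ * ‖(v : L2Pair Ω).fst x‖) := by
    intro u v
    filter_upwards [hC] with x hx
    rw [abs_mul, ← mul_assoc]
    refine mul_le_mul_of_nonneg_right ?_ (abs_nonneg _)
    refine (abs_dotProduct_le _ _).trans ?_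
    exact mul_le_mul_of_nonneg_right hx (norm_nonneg _)
  refine exists_continuousBilinear_of_integrand
    (fun u v x => ((b x).ofLp ⬝ᵥ (wgrad u x).ofLp) * fn v x) ?_ ?_ ?_ ?_ ?_ (C := C) ?_
  · exact fun u v => integrable_of_le_norm_mul_norm _ _
      ((aestronglyMeasurable_dotProduct hb.1 (wgrad_memLp u).1).mul (fn_memLp v).1) (hle u v)
  · intro u u' v
    filter_upwards [wgrad_add u u'] with x hx
    simp only [hx, WithLp.ofLp_add, dotProduct_add, add_mul]
  · intro t u v
    filter_upwards [wgrad_smul t u] with x hx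
    simp only [hx, WithLp.ofLp_smul, dotProduct_smul, smul_eq_mul, mul_assoc]
  · intro u v v'
    filter_upwards [fn_add v v'] with x hx
    simp only [hx, mul_add]
  · intro t u v
    filter_upwards [fn_smul t v] with x hx
    simp only [hx]; ring
  · intro u v
    refine (abs_integral_le_of_le_norm_mul_norm hC0 _ _ (hle u v)).trans ?_
    rw [mul_assoc]
    gcongr
    · exact norm_snd_le u
    · exact norm_fst_le v

theorem exists_reactionForm_clm {c : E d → ℝ} (hc : MemLp c ⊤ (volume.restrict Ω)) :
    ∃ a : H10 Ω →L[ℝ] H10 Ω →L[ℝ] ℝ, ∀ u v, a u v = ∫ x in Ω, c x * fn u x * fn v x := by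
  obtain ⟨C, hC0, hC⟩ := exists_ae_norm_le hc
  have hle : ∀ u v : H10 Ω, ∀ᵐ x ∂(volume.restrict Ω), |c x * fn u x * fn v x| ≤
        C * (‖(u : L2Pair Ω).fst x‖ * ‖(v : L2Pair Ω).fst x‖) := by
    intro u v
    filter_upwards [hC] with x hx
    rw [abs_mul, abs_mul, mul_assoc]
    exact mul_le_mul_of_nonneg_right hx (by positivity)
  refine exists_continuousBilinear_of_integrand
    (fun u v x => c x * fn u x * fn v x) ?_ ?_ ?_ ?_ ?_ (C := C) ?_
  · exact fun u v => integrable_of_le_norm_mul_norm _ _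
      ((hc.1.mul (fn_memLp u).1).mul (fn_memLp v).1) (hle u v)
  · intro u u' v
    filter_upwards [fn_add u u'] with x hx
    simp only [hx]; ring
  · intro t u v
    filter_upwards [fn_smul t u] with x hx
    simp only [hx]; ring
  · intro u v v'
    filter_upwards [fn_add v v'] with x hx
    simp only [hx, mul_add]
  · intro t u v
    filter_upwards [fn_smul t v] with x hx
    simp only [hx]; ring
  · intro u v
    refine (abs_integral_le_of_le_norm_mul_norm hC0 _ _ (hle u v)).trans ?_
    rw [mul_assoc]
    gcongr
    · exact norm_fst_le u
    · exact norm_fst_le v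

theorem exists_bilin_clm {A : E d → Matrix (Fin d) (Fin d) ℝ} {b : E d → E d} {c : E d → ℝ}
    (h : AdmissibleCoefficients Ω A b c) :
    ∃ (a : H10 Ω →L[ℝ] H10 Ω →L[ℝ] ℝ) (C : ℝ), Coercive a C ∧ ∀ u v, a u v = bilin A b c u v := by
  obtain ⟨a₁, h₁⟩ := exists_principalForm_clm h.memLp_A
  obtain ⟨a₂, h₂⟩ := exists_convectionForm_clm h.memLp_b
  obtain ⟨a₃, h₃⟩ := exists_reactionForm_clm h.memLp_c
  have ha : ∀ u v, (a₁ + a₂ + a₃) u v = bilin A b c u v := fun u v => by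
    simp only [_root_.add_apply, h₁, h₂, h₃, bilin]
  exact h.elliptic.elim fun C hC =>
    ⟨a₁ + a₂ + a₃, C, ⟨hC.1, fun v => by rw [ha]; exact hC.2 v⟩, ha⟩

theorem exists_load_clm {f : E d → ℝ} {ff : E d → E d} (hf : MemLp f 2 (volume.restrict Ω))
    (hff : MemLp ff 2 (volume.restrict Ω)) :
    ∃ F : H10 Ω →L[ℝ] ℝ, ∀ v, F v = load f ff v := by
  let p : H10 Ω →L[ℝ] ℝ := (innerSL ℝ (hf.toLp f)).comp fnL
  let q : H10 Ω →L[ℝ] ℝ := (innerSL ℝ (hff.toLp ff)).comp wgradL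
  refine ⟨p - q, fun v => ?_⟩
  have h1 : p v = ∫ x in Ω, f x * fn v x := by
    change inner ℝ (hf.toLp f) (v : L2Pair Ω).fst = _
    rw [L2.inner_def]
    refine integral_congr_ae ?_
    filter_upwards [hf.coeFn_toLp] with x hx
    rw [hx, real_inner_eq_re_inner, RCLike.inner_apply]
    simp [fn, mul_comm]
  have h2 : q v = ∫ x in Ω, (ff x).ofLp ⬝ᵥ (wgrad v x).ofLp := by
    change inner ℝ (hff.toLp ff) (v : L2Pair Ω).snd = _
    rw [L2.inner_def]
    refine integral_congr_ae ?_
    filter_upwards [hff.coeFn_toLp] with x hx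
    rw [hx, EuclideanSpace.inner_eq_star_dotProduct, dotProduct_comm]
    simp [wgrad]
  rw [_root_.sub_apply, h1, h2, load]

instance : CompleteSpace (H10 Ω) :=
  (Submodule.isClosed_topologicalClosure (Submodule.span ℝ (testPairs Ω))).completeSpace_coe

end Form

theorem exists_one_le_bound {V : Type*} [NormedAddCommGroup V] [NormedSpace ℝ V]
    (a : V →L[ℝ] V →L[ℝ] ℝ) : ∃ C : ℝ, 1 ≤ C ∧ ∀ u v, |a u v| ≤ C * (‖u‖ * ‖v‖) := by
  refine ⟨‖a‖ + 1, by linarith [norm_nonneg a], fun u v => ?_⟩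
  refine (a.le_opNorm₂ u v).trans ?_
  rw [mul_assoc]
  gcongr
  simp

/-! ### The Poincaré inequality and the equivalence of the energy norm and the `H¹`-norm. -/

section Poincare

variable {d : ℕ} {Ω : Set (E d)}

theorem zero_mem_testPairs : (0 : L2Pair Ω) ∈ testPairs Ω := by
  refine ⟨0, contDiff_const, HasCompactSupport.zero, by simp, ?_, ?_⟩
  · exact Lp.coeFn_zero ℝ 2 (volume.restrict Ω)
  · have h : gradient (0 : E d → ℝ) = 0 := by
      funext x
      simp [gradient]
    rw [h]
    exact Lp.coeFn_zero (E d) 2 (volume.restrict Ω)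

theorem add_mem_testPairs {v w : L2Pair Ω} (hv : v ∈ testPairs Ω) (hw : w ∈ testPairs Ω) :
    v + w ∈ testPairs Ω := by
  obtain ⟨φ, h1, h2, h3, h4, h5⟩ := hv
  obtain ⟨ψ, k1, k2, k3, k4, k5⟩ := hw
  refine ⟨φ + ψ, h1.add k1, h2.add k2, (tsupport_add φ ψ).trans (Set.union_subset h3 k3), ?_, ?_⟩
  · filter_upwards [h4, k4, Lp.coeFn_add v.fst w.fst] with x a1 a2 a3
    rw [WithLp.add_fst, a3, Pi.add_apply, Pi.add_apply, a1, a2]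
  · filter_upwards [h5, k5, Lp.coeFn_add v.snd w.snd] with x a1 a2 a3
    rw [WithLp.add_snd, a3, Pi.add_apply, a1, a2, gradient, gradient, gradient,
      fderiv_add (h1.differentiable (by simp) x) (k1.differentiable (by simp) x), map_add]

theorem smul_mem_testPairs {v : L2Pair Ω} (t : ℝ) (hv : v ∈ testPairs Ω) :
    t • v ∈ testPairs Ω := by
  obtain ⟨φ, h1, h2, h3, h4, h5⟩ := hv
  refine ⟨t • φ, h1.const_smul t, h2.smul_left (f := fun _ => t),
    (tsupport_smul_subset_right (fun _ => t) φ).trans h3, ?_, ?_⟩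
  · filter_upwards [h4, Lp.coeFn_smul t v.fst] with x a1 a3
    rw [WithLp.smul_fst, a3, Pi.smul_apply, Pi.smul_apply, a1]
  · filter_upwards [h5, Lp.coeFn_smul t v.snd] with x a1 a3
    rw [WithLp.smul_snd, a3, Pi.smul_apply, a1, gradient, gradient,
      fderiv_const_smul (h1.differentiable (by simp) x)]
    simp

/-- An inequality between the norms of the two components is not inherited by sums, so checking it
on generators of the span would not suffice for the Poincaré inequality. -/
theorem mem_testPairs_of_mem_span {v : L2Pair Ω} (hv : v ∈ Submodule.span ℝ (testPairs Ω)) :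
    v ∈ testPairs Ω := by
  induction hv using Submodule.span_induction with
  | mem x hx => exact hx
  | zero => exact zero_mem_testPairs
  | add x y _ _ hx hy => exact add_mem_testPairs hx hy
  | smul t x _ hx => exact smul_mem_testPairs t hx

/-- Poincaré inequality for test functions, by integration by parts against `x ↦ x i`. -/
theorem integral_sq_testFunction (i : Fin d) {φ : E d → ℝ}
    (h1 : ContDiff ℝ ((⊤ : ℕ∞) : WithTop ℕ∞) φ) (h2 : HasCompactSupport φ) :
    ∫ x, φ x ^ 2 = - ∫ x, x.ofLp i * (2 * φ x * fderiv ℝ φ x (EuclideanSpace.single i 1)) := by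
  set e : E d := EuclideanSpace.single i 1
  have hdiff : Differentiable ℝ φ := h1.differentiable (by simp)
  have hcont : Continuous φ := h1.continuous
  have hcont' : Continuous fun x => fderiv ℝ φ x e :=
    (h1.continuous_fderiv (by simp)).clm_apply continuous_const
  let f : E d →L[ℝ] ℝ := EuclideanSpace.proj i
  have hf : ∀ x, fderiv ℝ (fun x => f x) x e = 1 := by
    intro x
    rw [f.fderiv]
    simp [f, e]
  have hg : ∀ x, fderiv ℝ (fun x => φ x ^ 2) x e = 2 * φ x * fderiv ℝ φ x e := by
    intro x
    rw [((hdiff x).hasFDerivAt.pow 2).fderiv]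
    simp
  have hsupp : HasCompactSupport fun x => φ x ^ 2 := by
    apply h2.mono
    intro x hx
    simp only [Function.mem_support] at hx ⊢
    exact fun h0 => hx (by simp [h0])
  have hsupp' : ∀ k : E d → ℝ, HasCompactSupport fun x => k x * (2 * φ x * fderiv ℝ φ x e) := by
    intro k
    apply h2.mono
    intro x hx
    simp only [Function.mem_support] at hx ⊢
    exact fun h0 => hx (by simp [h0])
  have key := integral_mul_fderiv_eq_neg_fderiv_mul_of_integrable (μ := (volume : Measure (E d)))
    (f := fun x => f x) (g := fun x => φ x ^ 2) (v := e) ?_ ?_ ?_ ?_ ?_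
  · simp only [hf, hg, one_mul] at key
    have hff : ∀ x, f x = x.ofLp i := fun x => rfl
    simp only [hff] at key
    rw [key, neg_neg]
  · simp only [hf, one_mul]
    exact (hcont.pow 2).integrable_of_hasCompactSupport hsupp
  · simp only [hg]
    exact (f.continuous.mul ((continuous_const.mul hcont).mul hcont')).integrable_of_hasCompactSupport
      (hsupp' f)
  · refine (f.continuous.mul (hcont.pow 2)).integrable_of_hasCompactSupport ?_
    apply h2.mono
    intro x hx
    simp only [Function.mem_support] at hx ⊢
    exact fun h0 => hx (by simp [h0])
  · exact fun x _ => f.differentiableAt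
  · exact fun x _ => (hdiff x).pow 2

/-- In the integration by parts formula the coordinate is bounded by `R` on `Ω`. Cauchy–Schwarz
gives `‖φ‖² ≤ 2 * R * ‖φ‖ * ‖∇φ‖`, and one factor `‖φ‖` cancels. -/
theorem norm_fst_le_of_mem_testPairs (i : Fin d) {R : ℝ} (hR : 0 ≤ R)
    (hΩ : ∀ x ∈ Ω, ‖x‖ ≤ R) (hΩm : MeasurableSet Ω) {w : L2Pair Ω} (hw : w ∈ testPairs Ω) :
    ‖w.fst‖ ≤ 2 * R * ‖w.snd‖ := by
  obtain ⟨φ, h1, h2, h3, h4, h5⟩ := hw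
  have h0 : ∀ x ∉ Ω, φ x = 0 := fun x hx => image_eq_zero_of_notMem_tsupport fun hx' => hx (h3 hx')
  have e1 : ‖w.fst‖ ^ 2 = ∫ x, φ x ^ 2 := by
    rw [← integral_norm_sq_eq, ← setIntegral_eq_integral_of_forall_compl_eq_zero (s := Ω)
      (f := fun x => φ x ^ 2) (fun x hx => by rw [h0 x hx]; simp)]
    refine integral_congr_ae ?_
    filter_upwards [h4] with x hx
    rw [hx, Real.norm_eq_abs, sq_abs]
  have e2 : ‖w.fst‖ ^ 2 ≤ 2 * R * (‖w.fst‖ * ‖w.snd‖) := by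
    rw [e1, integral_sq_testFunction i h1 h2,
      ← setIntegral_eq_integral_of_forall_compl_eq_zero (s := Ω)
      (fun x hx => by rw [h0 x hx]; simp)]
    refine (neg_le_abs _).trans (abs_integral_le_of_le_norm_mul_norm (by positivity) w.fst w.snd ?_)
    filter_upwards [h4, h5, ae_restrict_mem hΩm] with x a1 a2 a3
    rw [a1, a2]
    have b1 : |x.ofLp i| ≤ R := (abs_ofLp_le x i).trans (hΩ x a3)
    have b2 : |fderiv ℝ φ x (EuclideanSpace.single i 1)| ≤ ‖gradient φ x‖ := by
      have := (fderiv ℝ φ x).le_opNorm (EuclideanSpace.single i (1 : ℝ))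
      rw [gradient, LinearIsometryEquiv.norm_map]
      simpa using this
    rw [abs_mul, abs_mul, abs_mul, abs_two, Real.norm_eq_abs]
    calc |x.ofLp i| * (2 * |φ x| * |fderiv ℝ φ x (EuclideanSpace.single i 1)|)
        ≤ R * (2 * |φ x| * ‖gradient φ x‖) := by gcongr
      _ = _ := by ring
  rcases (norm_nonneg w.fst).eq_or_lt with h | h
  · rw [← h]; positivity
  · have : ‖w.fst‖ * ‖w.fst‖ ≤ ‖w.fst‖ * (2 * R * ‖w.snd‖) := by nlinarith
    exact le_of_mul_le_mul_left this h

/-- Poincaré inequality on `H^1_0(Ω)`. -/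
theorem exists_poincare (hd : 0 < d) (hΩo : IsOpen Ω) (hΩb : Bornology.IsBounded Ω) :
    ∃ C : ℝ, 0 ≤ C ∧ ∀ v : H10 Ω, ‖(v : L2Pair Ω).fst‖ ≤ C * ‖(v : L2Pair Ω).snd‖ := by
  obtain ⟨R, hR0, hR⟩ := hΩb.exists_pos_norm_le
  refine ⟨2 * R, by positivity, fun v => ?_⟩
  have hcl : IsClosed {w : L2Pair Ω | ‖w.fst‖ ≤ 2 * R * ‖w.snd‖} := by
    apply isClosed_le
    · exact ((WithLp.prod_continuous_ofLp 2 _ _).fst).norm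
    · exact continuous_const.mul ((WithLp.prod_continuous_ofLp 2 _ _).snd).norm
  have hsub : (Submodule.span ℝ (testPairs Ω) : Set (L2Pair Ω)) ⊆
      {w : L2Pair Ω | ‖w.fst‖ ≤ 2 * R * ‖w.snd‖} := fun w hw =>
    norm_fst_le_of_mem_testPairs ⟨0, hd⟩ hR0.le hR hΩo.measurableSet (mem_testPairs_of_mem_span hw)
  exact closure_minimal hsub hcl v.2

theorem exists_energyNorm_le {A : E d → Matrix (Fin d) (Fin d) ℝ}
    (hA : ∀ i j, MemLp (fun x => A x i j) ⊤ (volume.restrict Ω)) :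
    ∃ C : ℝ, 0 < C ∧ ∀ v : H10 Ω, energyNorm A v ≤ C * ‖v‖ := by
  obtain ⟨a, ha⟩ := exists_principalForm_clm hA
  obtain ⟨C, hC, hle⟩ := exists_one_le_bound a
  refine ⟨C, by positivity, fun v => ?_⟩
  rw [energyNorm, Real.sqrt_le_left (by positivity), ← ha, mul_pow]
  refine (le_abs_self _).trans ((hle v v).trans ?_)
  rw [← sq]
  gcongr
  nlinarith

/-- Positive definiteness of `A` controls the gradient, and the Poincaré inequality adds the
function itself. The axioms of adaptivity are stated in the energy norm, the Galerkin theory in the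
`H¹`-norm. -/
theorem exists_norm_le_energyNorm (hd : 0 < d) (hΩo : IsOpen Ω) (hΩb : Bornology.IsBounded Ω)
    {A : E d → Matrix (Fin d) (Fin d) ℝ}
    (hA : ∀ i j, MemLp (fun x => A x i j) ⊤ (volume.restrict Ω))
    (hpos : ∃ α : ℝ, 0 < α ∧ ∀ᵐ x ∂(volume.restrict Ω), ∀ y : E d,
      α * ‖y‖ ^ 2 ≤ (A x *ᵥ y.ofLp) ⬝ᵥ y.ofLp) :
    ∃ C : ℝ, 0 < C ∧ ∀ v : H10 Ω, ‖v‖ ≤ C * energyNorm A v := by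
  obtain ⟨P, hP0, hP⟩ := exists_poincare hd hΩo hΩb
  obtain ⟨α, hα, hAα⟩ := hpos
  refine ⟨√((P ^ 2 + 1) / α), by positivity, fun v => ?_⟩
  have h1 : α * ‖(v : L2Pair Ω).snd‖ ^ 2 ≤ principalForm A v v := by
    rw [← integral_norm_sq_eq, ← integral_const_mul, principalForm]
    refine integral_mono_ae (((Lp.memLp (v : L2Pair Ω).snd).integrable_norm_pow
      (by norm_num)).const_mul α) ?_ ?_
    · choose CA hCA0 hCA using fun i j => exists_ae_norm_le (hA i j)
      refine integrable_of_le_norm_mul_norm (C := ∑ i, ∑ j, CA i j)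
        (v : L2Pair Ω).snd (v : L2Pair Ω).snd
        (aestronglyMeasurable_mulVec_dotProduct (fun i j => (hA i j).1) (wgrad_memLp v).1
        (wgrad_memLp v).1) ?_
      have h : ∀ᵐ x ∂(volume.restrict Ω), ∀ i j, ‖A x i j‖ ≤ CA i j := by
        rw [ae_all_iff]; intro i; rw [ae_all_iff]; exact fun j => hCA i j
      filter_upwards [h] with x hx
      refine (abs_mulVec_dotProduct_le _ _ _).trans ?_
      refine mul_le_mul_of_nonneg_right ?_ (by positivity)
      exact Finset.sum_le_sum fun i _ => Finset.sum_le_sum fun j _ => hx i j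
    · filter_upwards [hAα] with x hx using hx _
  have h2 : ‖v‖ ^ 2 ≤ (P ^ 2 + 1) * ‖(v : L2Pair Ω).snd‖ ^ 2 := by
    rw [norm_sq_eq, add_mul, one_mul, ← mul_pow]
    gcongr
    exact hP v
  rw [energyNorm, ← Real.sqrt_mul (by positivity)]
  apply Real.le_sqrt_of_sq_le
  rw [div_mul_eq_mul_div, le_div_iff₀ hα]
  nlinarith [mul_le_mul_of_nonneg_left h1 (by positivity : 0 ≤ P ^ 2 + 1)]

end Poincare

/-! ### Finite element spaces are closed and nested -/

section FESpace

variable {d : ℕ} {Ω : Set (E d)}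

theorem Elem.isCompact_hull (T : Elem d) : IsCompact (Elem.hull T) :=
  T.finite_toSet.isCompact_convexHull ℝ

theorem continuous_evalPoly (q : MvPolynomial (Fin d) ℝ) :
    Continuous fun x : E d => MvPolynomial.eval x.ofLp q :=
  (MvPolynomial.continuous_eval q).comp (PiLp.continuous_ofLp 2 _)

theorem memLp_evalPoly (T : Elem d)
    (q : MvPolynomial (Fin d) ℝ) :
    MemLp (fun x : E d => MvPolynomial.eval x.ofLp q) 2
      ((volume.restrict Ω).restrict (Elem.hull T)) := by
  obtain ⟨C, hC⟩ := (Elem.isCompact_hull T).exists_bound_of_continuousOn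
    (continuous_evalPoly q).continuousOn
  have : IsFiniteMeasure ((volume.restrict Ω).restrict (Elem.hull T)) := by
    refine ⟨?_⟩
    rw [Measure.restrict_apply_univ]
    exact (Measure.restrict_apply_le _ _).trans_lt (Elem.isCompact_hull T).measure_lt_top
  refine MemLp.of_bound (continuous_evalPoly q).aestronglyMeasurable C ?_
  filter_upwards [ae_restrict_mem (Elem.isCompact_hull T).measurableSet] with x hx using hC x hx

/-- Polynomials of bounded degree as elements of `L²` on an element. -/
noncomputable def polyToLp (Ω : Set (E d)) (p : ℕ) (T : Elem d) :
    MvPolynomial.restrictTotalDegree (Fin d) ℝ p →ₗ[ℝ]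
      Lp ℝ 2 ((volume.restrict Ω).restrict (Elem.hull T)) where
  toFun q := (memLp_evalPoly (Ω := Ω) T (q : MvPolynomial (Fin d) ℝ)).toLp _
  map_add' q r := by
    rw [← MemLp.toLp_add]
    congr 1
    funext x
    simp
  map_smul' t q := by
    rw [RingHom.id_apply, ← MemLp.toLp_const_smul]
    congr 1
    funext x
    simp [MvPolynomial.smul_eval]

/-- This is the route to closedness of the finite element space: the condition is the preimage,
under a continuous linear map, of a finite-dimensional and hence closed subspace of `L²(T ∩ Ω)`. -/
theorem isPolyOn_iff (p : ℕ) (T : Elem d) (v : H10 Ω) :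
    IsPolyOn p T v ↔ LpToLpRestrictCLM (E d) ℝ ℝ (volume.restrict Ω) 2 (Elem.hull T) (fnL v) ∈
      LinearMap.range (polyToLp Ω p T) := by
  have hm := (Elem.isCompact_hull T).measurableSet
  have hv := LpToLpRestrictCLM_coeFn ℝ (Elem.hull T) (fnL v)
  constructor
  · rintro ⟨q, hq, h⟩
    refine ⟨⟨q, (MvPolynomial.mem_restrictTotalDegree _ _ _).2 hq⟩, ?_⟩
    apply Lp.ext
    rw [← ae_restrict_iff' hm] at h
    filter_upwards [h, hv, (memLp_evalPoly (Ω := Ω) T q).coeFn_toLp] with x h1 h2 h3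
    rw [h2]
    exact h3.trans h1.symm
  · rintro ⟨q, hq⟩
    refine ⟨q, (MvPolynomial.mem_restrictTotalDegree _ _ _).1 q.2, ?_⟩
    rw [← ae_restrict_iff' hm]
    filter_upwards [hv, (memLp_evalPoly (Ω := Ω) T (q : MvPolynomial (Fin d) ℝ)).coeFn_toLp]
      with x h2 h3
    rw [← hq] at h2
    exact h2.symm.trans h3

theorem isClosed_feSpace (p : ℕ) (TH : Mesh d) :
    IsClosed (feSpace Ω p TH : Set (H10 Ω)) := by
  have h : (feSpace Ω p TH : Set (H10 Ω)) = ⋂ T ∈ TH, {v | IsPolyOn p T v} := by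
    ext v
    rw [Set.mem_iInter₂]
    exact Iff.rfl
  rw [h]
  refine isClosed_biInter fun T _ => ?_
  have h' : {v : H10 Ω | IsPolyOn p T v} = (fun v : H10 Ω =>
      LpToLpRestrictCLM (E d) ℝ ℝ (volume.restrict Ω) 2 (Elem.hull T) (fnL v)) ⁻¹'
      (LinearMap.range (polyToLp Ω p T) : Set _) := by
    ext v
    exact isPolyOn_iff p T v
  rw [h']
  exact (Submodule.closed_of_finiteDimensional _).preimage
    ((ContinuousLinearMap.continuous _).comp fnL.continuous)

theorem feSpace_le_of_subdivision {p : ℕ} {TH Th : Mesh d}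
    (h : ∀ T ∈ Th, ∃ T' ∈ TH, Elem.hull T ⊆ Elem.hull T') :
    feSpace Ω p TH ≤ feSpace Ω p Th := by
  intro v hv T hT
  obtain ⟨T', hT', hTT'⟩ := h T hT
  obtain ⟨q, hq, hvq⟩ := hv T' hT'
  exact ⟨q, hq, hvq.mono fun x hx hxT => hx (hTT' hxT)⟩

end FESpace

/-! ### Primal and dual Galerkin solutions -/

section Hilbert

variable {V : Type*} [NormedAddCommGroup V] [InnerProductSpace ℝ V]
  {a : V →L[ℝ] V →L[ℝ] ℝ} {c : ℝ}

/-- Stability of the Galerkin projection. -/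
theorem IsGalerkin.norm_sub_le (ha : Coercive a c) {F : V →L[ℝ] ℝ} {X : Submodule ℝ V} {u w v : V}
    (hu : IsGalerkin a F ⊤ u) (hw : IsGalerkin a F X w) (hv : v ∈ X) :
    ‖w - v‖ ≤ c⁻¹ * ‖a‖ * ‖u - v‖ := by
  have hF : F = a u := by ext x; exact (hu.2 x trivial).symm
  have h := (hw.sub_mem hv).norm_le ha
  rw [hF, ← map_sub] at h
  have hc := ha.1
  refine h.trans ?_
  rw [mul_assoc]
  gcongr
  exact a.le_opNorm _

/-- By nestedness `u 0` lies in every `X k`, so `u k - u 0` is itself a Galerkin solution, with load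
`a (w - u 0)`. The norm of this load is at most `‖a‖ * ‖w - u 0‖`, which makes the oscillation
relative to the initial error. -/
theorem exists_oscLE_primal [CompleteSpace V] (ha : Coercive a c) {ε : ℝ} (hε : 0 < ε) :
    ∃ M : ℕ, ∀ X : ℕ → Submodule ℝ V, (∀ k, IsClosed (X k : Set V)) → Monotone X →
      ∀ (F : V →L[ℝ] ℝ) (u : ℕ → V) (w : V), (∀ k, IsGalerkin a F (X k) (u k)) →
      IsGalerkin a F ⊤ w → OscLE (fun k => u k - u 0) (ε * ‖w - u 0‖) M := by
  have hn := norm_nonneg a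
  obtain ⟨M, hM⟩ := exists_oscLE_galerkin ha (show 0 < ε / (‖a‖ + 1) by positivity)
  refine ⟨M, fun X hXc hX F u w hu hw => ?_⟩
  have hF : F = a w := by ext x; exact (hw.2 x trivial).symm
  have h := hM X hXc hX (‖a‖ * ‖w - u 0‖) (F - a (u 0))
    (by rw [hF, ← map_sub]; exact a.le_opNorm _) (fun k => u k - u 0)
    (fun k => (hu k).sub_mem (hX (Nat.zero_le k) (hu 0).1))
  refine h.mono_eps ?_
  calc ε / (‖a‖ + 1) * (‖a‖ * ‖w - u 0‖) ≤ ε / (‖a‖ + 1) * ((‖a‖ + 1) * ‖w - u 0‖) := by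
        gcongr; linarith
    _ = ε * ‖w - u 0‖ := by field_simp

/-- The pairs of discrete primal solutions and dual solutions linearized at them. -/
theorem exists_oscLE_primal_dual [CompleteSpace V] (ha : Coercive a c) (H : V →L[ℝ] V →L[ℝ] ℝ)
    {ε : ℝ} (hε : 0 < ε) :
    ∃ M : ℕ, ∀ X : ℕ → Submodule ℝ V, (∀ k, IsClosed (X k : Set V)) → Monotone X →
      ∀ (F : V →L[ℝ] ℝ) (u z : ℕ → V) (w y : V), (∀ k, IsGalerkin a F (X k) (u k)) →
      IsGalerkin a F ⊤ w → (∀ k, IsGalerkin a.flip (H (u k)) (X k) (z k)) →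
      IsGalerkin a.flip (H (u 0)) ⊤ y →
      OscLE (fun k => (u k, z k)) (ε * (‖w - u 0‖ + ‖y - z 0‖)) M := by
  have hn := norm_nonneg a
  have hnf := norm_nonneg a.flip
  have hnH := norm_nonneg H
  have hc := ha.1
  set B := ‖H‖ * (c⁻¹ * ‖a‖) + ‖a.flip‖ + 1 with hB
  have hB0 : 0 < B := by positivity
  set L := 1 + c⁻¹ * ‖H‖ with hL
  have hL0 : 0 < L := by positivity
  obtain ⟨M, hM⟩ := exists_oscLE_primal ha (show 0 < ε / (4 * L) by positivity)
  obtain ⟨M', hM'⟩ := exists_oscLE_galerkin ha.flip (show 0 < ε / (2 * B) by positivity)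
  refine ⟨M * M', fun X hXc hX F u z w y hu hw hz hy => ?_⟩
  set S := ‖w - u 0‖ + ‖y - z 0‖ with hS
  have hwS : ‖w - u 0‖ ≤ S := by simp [hS]
  have hyS : ‖y - z 0‖ ≤ S := by simp [hS]
  have hS0 : 0 ≤ S := by positivity
  -- The difference `z k - z 0` is the dual Galerkin solution on `X k` with load `G (u k - u 0)`. If
  -- `t k x` denotes the solution with load `G x`, then the pairs, up to the shift by `(u 0, z 0)`,
  -- form the diagonal sequence of the maps `x ↦ (x, t k x)`.
  set G : V → V →L[ℝ] ℝ := fun x => H x + (H (u 0) - a.flip (z 0)) with hG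
  choose t ht using fun (k : ℕ) (x : V) => exists_isGalerkin ha.flip (G x) (X k) (hXc k)
  have hy' : H (u 0) = a.flip y := by ext x; exact (hy.2 x trivial).symm
  have htz : ∀ k, t k (u k - u 0) = z k - z 0 := by
    intro k
    have h1 := (hz k).sub_mem (hX (Nat.zero_le k) (hz 0).1)
    have h2 : H (u k) - a.flip (z 0) = G (u k - u 0) := by
      simp only [hG, map_sub]; abel
    rw [h2] at h1
    exact (ht k _).unique ha.flip h1
  have htL : ∀ k x x', ‖t k x - t k x'‖ ≤ c⁻¹ * ‖H‖ * ‖x - x'‖ := by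
    intro k x x'
    have h1 := ((ht k x).sub (ht k x')).norm_le ha.flip
    have h2 : G x - G x' = H (x - x') := by simp only [hG, map_sub]; abel
    rw [h2] at h1
    refine h1.trans ?_
    rw [mul_assoc]
    gcongr
    exact H.le_opNorm _
  -- The load splits into a part linear in `u j - u 0`, controlled by Galerkin stability, and the
  -- residual of `z 0` in the initial dual problem. Both are bounded by the initial errors.
  have hGn : ∀ j, ‖G (u j - u 0)‖ ≤ B * S := by
    intro j
    have h1 : ‖u j - u 0‖ ≤ c⁻¹ * ‖a‖ * ‖w - u 0‖ :=
      hw.norm_sub_le ha (hu j) (hX (Nat.zero_le j) (hu 0).1)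
    have h2 : G (u j - u 0) = H (u j - u 0) + a.flip (y - z 0) := by
      simp only [hG]
      rw [hy', map_sub (a.flip)]
    rw [h2]
    calc ‖H (u j - u 0) + a.flip (y - z 0)‖
        ≤ ‖H‖ * (c⁻¹ * ‖a‖ * S) + ‖a.flip‖ * S := by
          refine (norm_add_le _ _).trans (add_le_add ((H.le_opNorm _).trans ?_)
            ((a.flip.le_opNorm _).trans ?_))
          · gcongr
            exact h1.trans (by gcongr)
          · gcongr
      _ ≤ B * S := by rw [hB]; nlinarith
  have hd := (hM X hXc hX F u w hu hw).diagonal (M' := M') (ε := ε / (2 * B) * (B * S))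
    (fun k x => (x, t k x)) hL0.le ?_ ?_
  · have h1 := (hd.comp_lipschitz (y := fun k => (u k, z k)) zero_le_one ?_)
    · refine h1.mono_eps ?_
      calc 1 * (ε / (2 * B) * (B * S) + 2 * (L * (ε / (4 * L) * ‖w - u 0‖)))
          = ε / 2 * S + ε / 2 * ‖w - u 0‖ := by field_simp; ring
        _ ≤ ε / 2 * S + ε / 2 * S := by gcongr
        _ = ε * S := by ring
    · intro k l
      simp only [htz]
      rw [one_mul]
      apply le_of_eq
      congr 1
      simp
  · intro k j l
    rw [Prod.mk_sub_mk, Prod.norm_mk]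
    apply max_le
    · rw [hL, add_mul, one_mul]
      have : 0 ≤ c⁻¹ * ‖H‖ * ‖u j - u 0 - (u l - u 0)‖ := by positivity
      linarith
    · refine (htL k _ _).trans ?_
      rw [hL]
      gcongr
      simp
  · intro j
    have h1 := hM' X hXc hX (B * S) (G (u j - u 0)) (hGn j) (fun k => t k (u j - u 0))
      (fun k => ht k _)
    have h2 := h1.comp_lipschitz (y := fun k => (u j - u 0, t k (u j - u 0))) zero_le_one ?_
    · rwa [one_mul] at h2
    · intro k l
      rw [Prod.mk_sub_mk, Prod.norm_mk, sub_self, norm_zero, one_mul]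
      exact max_le (norm_nonneg _) le_rfl

end Hilbert

theorem exists_cea_constant {V : Type*} [NormedAddCommGroup V] [InnerProductSpace ℝ V]
    {a : V →L[ℝ] V →L[ℝ] ℝ} {c : ℝ} (ha : Coercive a c) : ∃ C : ℝ, ∀ (F : V →L[ℝ] ℝ)
      (X : Submodule ℝ V) (u w v : V), IsGalerkin a F ⊤ u → IsGalerkin a F X w → v ∈ X →
      ‖w - v‖ ≤ C * ‖u - v‖ :=
  ⟨c⁻¹ * ‖a‖, fun _ _ _ _ _ hu hw hv => hu.norm_sub_le ha hw hv⟩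

theorem exists_lipschitz_constant {V : Type*} [NormedAddCommGroup V] [InnerProductSpace ℝ V]
    {a : V →L[ℝ] V →L[ℝ] ℝ} {c : ℝ} (ha : Coercive a c) (H : V →L[ℝ] V →L[ℝ] ℝ) :
    ∃ C : ℝ, ∀ (X : Submodule ℝ V) (w w' z z' : V), IsGalerkin a (H w) X z →
      IsGalerkin a (H w') X z' → ‖z - z'‖ ≤ C * ‖w - w'‖ := by
  refine ⟨c⁻¹ * ‖H‖, fun X w w' z z' hz hz' => ?_⟩
  have h := (hz.sub hz').norm_le ha
  rw [← map_sub] at h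
  have hc := ha.1
  refine h.trans ?_
  rw [mul_assoc]
  gcongr
  exact H.le_opNorm _

theorem galerkin_isGalerkin {V : Type} [NormedAddCommGroup V] [InnerProductSpace ℝ V]
    [CompleteSpace V] {a : V →L[ℝ] V →L[ℝ] ℝ} {c : ℝ} (ha : Coercive a c) {F : V →L[ℝ] ℝ}
    {a' : V → V → ℝ} {F' : V → ℝ} (haa' : ∀ u v, a u v = a' u v) (hFF' : ∀ v, F v = F' v)
    (X : Submodule ℝ V) (hX : IsClosed (X : Set V)) : IsGalerkin a F X (galerkin a' F' X) := by
  obtain ⟨u, hu⟩ := exists_isGalerkin ha F X hX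
  have h := Classical.epsilon_spec (p := fun u => u ∈ X ∧ ∀ v ∈ X, a' u v = F' v)
    ⟨u, hu.1, fun v hv => by rw [← haa', ← hFF']; exact hu.2 v hv⟩
  exact ⟨h.1, fun v hv => by rw [haa', hFF']; exact h.2 v hv⟩

/-- Galerkin solutions of a coercive problem and of the dual problem linearized at `w`. -/
theorem exists_galerkin_bounds {V : Type} [NormedAddCommGroup V] [InnerProductSpace ℝ V]
    [CompleteSpace V] {a' : V → V → ℝ}
    (ha' : ∃ (a : V →L[ℝ] V →L[ℝ] ℝ) (γ : ℝ), Coercive a γ ∧ ∀ u v, a u v = a' u v)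
    (K : V →L[ℝ] V →L[ℝ] ℝ) (U : (V → ℝ) → Submodule ℝ V → V) (Z : V → Submodule ℝ V → V)
    (hU : ∀ F X, U F X = galerkin a' F X)
    (hZ : ∀ w X, Z w X = galerkin (fun z v => a' v z) (fun v => K v w + K w v) X) :
    ∃ C : ℝ, 1 ≤ C ∧
      (∀ F : V → ℝ, (∃ F' : V →L[ℝ] ℝ, ∀ v, F' v = F v) → ∀ X : Submodule ℝ V,
        IsClosed (X : Set V) → U F X ∈ X) ∧
      (∀ (w : V) (X : Submodule ℝ V), IsClosed (X : Set V) → Z w X ∈ X) ∧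
      (∀ F : V → ℝ, (∃ F' : V →L[ℝ] ℝ, ∀ v, F' v = F v) → ∀ X Y : Submodule ℝ V,
        IsClosed (X : Set V) → IsClosed (Y : Set V) → X ≤ Y →
        ‖U F Y - U F X‖ ≤ C * ‖U F ⊤ - U F X‖) ∧
      (∀ (w : V) (X Y : Submodule ℝ V),
        IsClosed (X : Set V) → IsClosed (Y : Set V) → X ≤ Y →
        ‖Z w Y - Z w X‖ ≤ C * ‖Z w ⊤ - Z w X‖) ∧
      (∀ (w w' : V) (X : Submodule ℝ V), IsClosed (X : Set V) →
        ‖Z w X - Z w' X‖ ≤ C * ‖w - w'‖) ∧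
      (∀ ε : ℝ, 0 < ε → ∃ M : ℕ, ∀ F : V → ℝ, (∃ F' : V →L[ℝ] ℝ, ∀ v, F' v = F v) →
        ∀ X : ℕ → Submodule ℝ V, (∀ k, IsClosed (X k : Set V)) → Monotone X →
        OscLE (fun k => U F (X k)) (ε * ‖U F ⊤ - U F (X 0)‖) M ∧
        OscLE (fun k => (U F (X k), Z (U F (X k)) (X k)))
          (ε * (‖U F ⊤ - U F (X 0)‖ + ‖Z (U F (X 0)) ⊤ - Z (U F (X 0)) (X 0)‖)) M) := by
  obtain ⟨a, γ, ha, hab⟩ := ha'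
  set H : V →L[ℝ] V →L[ℝ] ℝ := K.flip + K with hHdef
  have hH : ∀ w v, H w v = K v w + K w v := fun _ _ => rfl
  obtain ⟨C₃, h₃⟩ := exists_cea_constant ha
  obtain ⟨C₄, h₄⟩ := exists_cea_constant ha.flip
  obtain ⟨C₅, h₅⟩ := exists_lipschitz_constant ha.flip H
  have hprimal : ∀ (F : V → ℝ) (F' : V →L[ℝ] ℝ), (∀ v, F' v = F v) → ∀ X : Submodule ℝ V,
      IsClosed (X : Set V) → IsGalerkin a F' X (U F X) := fun F F' hF X hX =>
    hU F X ▸ galerkin_isGalerkin ha hab hF X hX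
  have hdual : ∀ (w : V) (X : Submodule ℝ V), IsClosed (X : Set V) →
      IsGalerkin a.flip (H w) X (Z w X) := fun w X hX =>
    hZ w X ▸ galerkin_isGalerkin ha.flip (fun u v => hab v u) (hH w) X hX
  have hT : IsClosed ((⊤ : Submodule ℝ V) : Set V) := isClosed_univ
  have p₃ := abs_nonneg C₃
  have p₄ := abs_nonneg C₄
  have p₅ := abs_nonneg C₅
  have l₃ := le_abs_self C₃
  have l₄ := le_abs_self C₄
  have l₅ := le_abs_self C₅
  refine ⟨1 + |C₃| + |C₄| + |C₅|, by linarith, ?_, ?_, ?_, ?_, ?_, ?_⟩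
  · rintro F ⟨F', hF⟩ X hX
    exact (hprimal F F' hF X hX).1
  · exact fun w X hX => (hdual w X hX).1
  · rintro F ⟨F', hF⟩ X Y hX hY hXY
    exact (h₃ F' _ _ _ _ (hprimal F F' hF ⊤ hT) (hprimal F F' hF Y hY)
      (hXY (hprimal F F' hF X hX).1)).trans
      (mul_le_mul_of_nonneg_right (by linarith) (norm_nonneg _))
  · intro w X Y hX hY hXY
    exact (h₄ _ _ _ _ _ (hdual w ⊤ hT) (hdual w Y hY) (hXY (hdual w X hX).1)).trans
      (mul_le_mul_of_nonneg_right (by linarith) (norm_nonneg _))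
  · intro w w' X hX
    exact (h₅ _ _ _ _ _ (hdual w X hX) (hdual w' X hX)).trans
      (mul_le_mul_of_nonneg_right (by linarith) (norm_nonneg _))
  · intro ε hε
    obtain ⟨M, hM⟩ := exists_oscLE_primal ha hε
    obtain ⟨M', hM'⟩ := exists_oscLE_primal_dual ha H hε
    refine ⟨max M M', ?_⟩
    rintro F ⟨F', hF⟩ X hX hmono
    constructor
    · have h := hM X hX hmono F' (fun k => U F (X k)) _ (fun k => hprimal F F' hF _ (hX k))
        (hprimal F F' hF ⊤ hT)
      have h' := h.comp_lipschitz (y := fun k => U F (X k)) zero_le_one (fun k l => by simp)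
      rw [one_mul] at h'
      exact h'.mono_count (le_max_left _ _)
    · exact (hM' X hX hmono F' (fun k => U F (X k)) (fun k => Z (U F (X k)) (X k)) _ _
        (fun k => hprimal F F' hF _ (hX k)) (hprimal F F' hF ⊤ hT) (fun k => hdual _ _ (hX k))
        (hdual _ ⊤ hT)).mono_count (le_max_right _ _)

/-! ### Uniform bounds for the discrete primal and dual solutions. -/

section Package

variable {d : ℕ} {Ω : Set (E d)}

/-- The properties of the discrete solutions that the analysis of the adaptive algorithm uses,
with a constant `C` that depends only on the bilinear form and on `K`. -/
structure SolutionBounds (A : E d → Matrix (Fin d) (Fin d) ℝ) (b : E d → E d) (c : E d → ℝ)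
    (K : H10 Ω →L[ℝ] Hneg1 Ω) (C : ℝ) : Prop where
  one_le : 1 ≤ C
  energy_le : ∀ v : H10 Ω, energyNorm A v ≤ C * ‖v‖
  le_energy : ∀ v : H10 Ω, ‖v‖ ≤ C * energyNorm A v
  primal_mem : ∀ D : Discretization Ω, MemLp D.f 2 (volume.restrict Ω) →
    MemLp D.ff 2 (volume.restrict Ω) → ∀ TH, D.uH A b c TH ∈ D.X TH
  dual_mem : ∀ (D : Discretization Ω) (w : H10 Ω) TH, D.zH A b c K w TH ∈ D.X TH
  primal_cea : ∀ D : Discretization Ω, MemLp D.f 2 (volume.restrict Ω) →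
    MemLp D.ff 2 (volume.restrict Ω) → ∀ TH Th, D.X TH ≤ D.X Th →
    ‖D.uH A b c Th - D.uH A b c TH‖ ≤ C * ‖D.u A b c - D.uH A b c TH‖
  dual_cea : ∀ (D : Discretization Ω) (w : H10 Ω) TH Th, D.X TH ≤ D.X Th →
    ‖D.zH A b c K w Th - D.zH A b c K w TH‖ ≤ C * ‖dual A b c K w ⊤ - D.zH A b c K w TH‖
  dual_lipschitz : ∀ (D : Discretization Ω) (w w' : H10 Ω) TH,
    ‖D.zH A b c K w TH - D.zH A b c K w' TH‖ ≤ C * ‖w - w'‖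
  oscLE : ∀ ε : ℝ, 0 < ε → ∃ M : ℕ, ∀ D : Discretization Ω, MemLp D.f 2 (volume.restrict Ω) →
    MemLp D.ff 2 (volume.restrict Ω) → ∀ 𝒯 : ℕ → Mesh d, Monotone (fun k => D.X (𝒯 k)) →
    OscLE (fun k => D.uH A b c (𝒯 k)) (ε * ‖D.u A b c - D.uH A b c (𝒯 0)‖) M ∧
    OscLE (fun k => (D.uH A b c (𝒯 k), D.zH A b c K (D.uH A b c (𝒯 k)) (𝒯 k)))
      (ε * (‖D.u A b c - D.uH A b c (𝒯 0)‖ +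
        ‖dual A b c K (D.uH A b c (𝒯 0)) ⊤ - D.zH A b c K (D.uH A b c (𝒯 0)) (𝒯 0)‖)) M

theorem exists_solutionBounds (hd : 0 < d) (hΩo : IsOpen Ω) (hΩb : Bornology.IsBounded Ω)
    {A : E d → Matrix (Fin d) (Fin d) ℝ} {b : E d → E d} {c : E d → ℝ}
    (h : AdmissibleCoefficients Ω A b c) (K : H10 Ω →L[ℝ] Hneg1 Ω) :
    ∃ C : ℝ, SolutionBounds A b c K C := by
  obtain ⟨C₁, hC₁, h₁⟩ := exists_energyNorm_le (Ω := Ω) h.memLp_A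
  obtain ⟨C₂, hC₂, h₂⟩ := exists_norm_le_energyNorm hd hΩo hΩb h.memLp_A h.posDef
  obtain ⟨C₃, hC₃, k₁, k₂, k₃, k₄, k₅, k₆⟩ := exists_galerkin_bounds (exists_bilin_clm h) K
    (fun F X => galerkin (bilin A b c) F X) (fun w X => dual A b c K w X)
    (fun _ _ => rfl) (fun _ _ => rfl)
  have hle : ∀ x : ℝ, 0 ≤ x → C₃ * x ≤ (C₁ + C₂ + C₃) * x := fun x hx =>
    mul_le_mul_of_nonneg_right (by linarith) hx
  have hX : ∀ (D : Discretization Ω) TH, IsClosed (D.X TH : Set (H10 Ω)) := fun D TH =>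
    isClosed_feSpace D.p TH
  refine ⟨C₁ + C₂ + C₃, ⟨by linarith, fun v => (h₁ v).trans ?_, fun v => (h₂ v).trans ?_,
    fun D hf hff TH => k₁ _ (exists_load_clm hf hff) _ (hX D TH),
    fun D w TH => k₂ w _ (hX D TH),
    fun D hf hff TH Th hTT => (k₃ _ (exists_load_clm hf hff) _ _ (hX D TH) (hX D Th) hTT).trans
      (hle _ (norm_nonneg _)),
    fun D w TH Th hTT => (k₄ w _ _ (hX D TH) (hX D Th) hTT).trans (hle _ (norm_nonneg _)),
    fun D w w' TH => (k₅ w w' _ (hX D TH)).trans (hle _ (norm_nonneg _)), fun ε hε => ?_⟩⟩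
  · exact mul_le_mul_of_nonneg_right (by linarith) (norm_nonneg _)
  · exact mul_le_mul_of_nonneg_right (by linarith) (Real.sqrt_nonneg _)
  · obtain ⟨M, hM⟩ := k₆ ε hε
    exact ⟨M, fun D hf hff 𝒯 hmono => hM _ (exists_load_clm hf hff) (fun k => D.X (𝒯 k))
      (fun k => hX D _) hmono⟩

end Package

/-- Here `s`, `r` and `r'` stand for the unrefined, refined and marked parts of `e`. The left-hand
side squared is `e² - (1 - q²) * r²`, and the Dörfler property gives `θ * e² ≤ r²`. -/
theorem sqrt_reduction_le {s r e r' q θ : ℝ} (hq0 : 0 ≤ q) (hq1 : q ≤ 1) (he : 0 ≤ e)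
    (hr' : 0 ≤ r') (hrr' : r' ≤ r) (hsum : e ^ 2 = s ^ 2 + r ^ 2) (hθ : θ * e ^ 2 ≤ r' ^ 2) :
    √(s ^ 2 + (q * r) ^ 2) ≤ √(1 - (1 - q ^ 2) * θ) * e := by
  rcases he.eq_or_lt with h0 | hpos
  · have h1 : s ^ 2 = 0 ∧ r ^ 2 = 0 := by
      rw [← h0] at hsum
      constructor <;> nlinarith [sq_nonneg s, sq_nonneg r]
    rw [mul_pow, h1.1, h1.2]
    simp [← h0]
  · have h1 : θ * e ^ 2 ≤ r ^ 2 := hθ.trans (pow_le_pow_left₀ hr' hrr' 2)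
    have hq2 : 0 ≤ 1 - q ^ 2 := by nlinarith
    have h2 : s ^ 2 + (q * r) ^ 2 ≤ (1 - (1 - q ^ 2) * θ) * e ^ 2 := by
      nlinarith [mul_le_mul_of_nonneg_left h1 hq2]
    have h3 : 0 ≤ 1 - (1 - q ^ 2) * θ := by
      by_contra hneg
      have : (1 - (1 - q ^ 2) * θ) * e ^ 2 < 0 := mul_neg_of_neg_of_pos (by linarith) (by positivity)
      nlinarith [sq_nonneg s, sq_nonneg (q * r)]
    calc √(s ^ 2 + (q * r) ^ 2) ≤ √((1 - (1 - q ^ 2) * θ) * e ^ 2) := Real.sqrt_le_sqrt h2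
      _ = _ := by rw [Real.sqrt_mul h3, Real.sqrt_sq he]

namespace Discretization

/-! ### Splitting and monotonicity of the estimators. -/

section Basic

variable {d : ℕ} {Ω : Set (E d)} (D : Discretization Ω)

theorem etaOn_nonneg (TH : Mesh d) (U : Finset (Elem d)) (v : H10 Ω) : 0 ≤ D.etaOn TH U v :=
  Real.sqrt_nonneg _

theorem zetaOn_nonneg (w : H10 Ω) (TH : Mesh d) (U : Finset (Elem d)) (v : H10 Ω) :
    0 ≤ D.zetaOn w TH U v := Real.sqrt_nonneg _

theorem etaOn_sq (TH : Mesh d) (U : Finset (Elem d)) (v : H10 Ω) :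
    D.etaOn TH U v ^ 2 = ∑ T ∈ U, D.eta TH T v ^ 2 :=
  Real.sq_sqrt (Finset.sum_nonneg fun _ _ => sq_nonneg _)

theorem zetaOn_sq (w : H10 Ω) (TH : Mesh d) (U : Finset (Elem d)) (v : H10 Ω) :
    D.zetaOn w TH U v ^ 2 = ∑ T ∈ U, D.zeta w TH T v ^ 2 :=
  Real.sq_sqrt (Finset.sum_nonneg fun _ _ => sq_nonneg _)

theorem etaOn_mono (TH : Mesh d) {U U' : Finset (Elem d)} (h : U ⊆ U') (v : H10 Ω) :
    D.etaOn TH U v ≤ D.etaOn TH U' v :=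
  Real.sqrt_le_sqrt (Finset.sum_le_sum_of_subset_of_nonneg h fun _ _ _ => sq_nonneg _)

theorem zetaOn_mono (w : H10 Ω) (TH : Mesh d) {U U' : Finset (Elem d)} (h : U ⊆ U') (v : H10 Ω) :
    D.zetaOn w TH U v ≤ D.zetaOn w TH U' v :=
  Real.sqrt_le_sqrt (Finset.sum_le_sum_of_subset_of_nonneg h fun _ _ _ => sq_nonneg _)

open Classical in
theorem etaOn_sq_split (TH U V : Finset (Elem d)) (v : H10 Ω) :
    D.etaOn TH U v ^ 2 = D.etaOn TH (U ∩ V) v ^ 2 + D.etaOn TH (U \ V) v ^ 2 := by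
  rw [etaOn_sq, etaOn_sq, etaOn_sq, Finset.sum_inter_add_sum_sdiff]

open Classical in
theorem zetaOn_sq_split (w : H10 Ω) (TH U V : Finset (Elem d)) (v : H10 Ω) :
    D.zetaOn w TH U v ^ 2 = D.zetaOn w TH (U ∩ V) v ^ 2 + D.zetaOn w TH (U \ V) v ^ 2 := by
  rw [zetaOn_sq, zetaOn_sq, zetaOn_sq, Finset.sum_inter_add_sum_sdiff]

variable (A : E d → Matrix (Fin d) (Fin d) ℝ) (b : E d → E d) (c : E d → ℝ)
  (K : H10 Ω →L[ℝ] Hneg1 Ω)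

/-- The combined estimator `(η_H(U, u_H)² + ζ_H(U, z_H[u_H])²)^{1/2}`. -/
noncomputable def combined (TH : Mesh d) (U : Finset (Elem d)) : ℝ :=
  √(D.etaU A b c TH U ^ 2 + D.zetaZ A b c K TH U ^ 2)

theorem etaU_nonneg (TH U) : 0 ≤ D.etaU A b c TH U := D.etaOn_nonneg _ _ _

theorem zetaZ_nonneg (TH U) : 0 ≤ D.zetaZ A b c K TH U := D.zetaOn_nonneg _ _ _ _

theorem combined_nonneg (TH U) : 0 ≤ D.combined A b c K TH U := Real.sqrt_nonneg _

theorem combined_sq (TH U) :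
    D.combined A b c K TH U ^ 2 = D.etaU A b c TH U ^ 2 + D.zetaZ A b c K TH U ^ 2 :=
  Real.sq_sqrt (by positivity)

theorem etaU_le_combined (TH U) : D.etaU A b c TH U ≤ D.combined A b c K TH U :=
  Real.le_sqrt_of_sq_le (by nlinarith [sq_nonneg (D.zetaZ A b c K TH U)])

theorem zetaZ_le_combined (TH U) : D.zetaZ A b c K TH U ≤ D.combined A b c K TH U :=
  Real.le_sqrt_of_sq_le (by nlinarith [sq_nonneg (D.etaU A b c TH U)])

theorem combined_mono (TH : Mesh d) {U U' : Finset (Elem d)} (h : U ⊆ U') :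
    D.combined A b c K TH U ≤ D.combined A b c K TH U' := by
  apply Real.sqrt_le_sqrt
  exact add_le_add (pow_le_pow_left₀ (D.etaU_nonneg A b c _ _) (D.etaOn_mono _ h _) 2)
    (pow_le_pow_left₀ (D.zetaZ_nonneg A b c K _ _) (D.zetaOn_mono _ _ h _) 2)

open Classical in
theorem combined_sq_split (TH U V) :
    D.combined A b c K TH U ^ 2 =
      D.combined A b c K TH (U ∩ V) ^ 2 + D.combined A b c K TH (U \ V) ^ 2 := by
  simp only [combined_sq, etaU, zetaZ]
  rw [D.etaOn_sq_split TH U V, D.zetaOn_sq_split _ TH U V]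
  ring

theorem estProduct_eq (TH) :
    D.estProduct A b c K TH = D.etaU A b c TH TH * D.combined A b c K TH TH := rfl

open Classical in
theorem sqrt_inter_sdiff_le_etaU {qred : ℝ} (TH Th : Mesh d) (hq0 : 0 < qred) (hq1 : qred < 1) :
    √(D.etaU A b c TH (TH ∩ Th) ^ 2 + (qred * D.etaU A b c TH (TH \ Th)) ^ 2) ≤
      D.etaU A b c TH TH := by
  rw [Real.sqrt_le_left (D.etaU_nonneg A b c TH TH), mul_pow]
  have := D.etaOn_sq_split TH TH Th (D.uH A b c TH)
  have hq2 : qred ^ 2 ≤ 1 := by nlinarith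
  simp only [etaU]
  nlinarith [sq_nonneg (D.etaOn TH (TH \ Th) (D.uH A b c TH))]

open Classical in
theorem sqrt_inter_sdiff_le_combined {qred : ℝ} (TH Th : Mesh d) (hq0 : 0 < qred) (hq1 : qred < 1) :
    √(D.combined A b c K TH (TH ∩ Th) ^ 2 + (qred * D.combined A b c K TH (TH \ Th)) ^ 2) ≤
      D.combined A b c K TH TH := by
  rw [Real.sqrt_le_left (D.combined_nonneg A b c K TH TH), mul_pow]
  have := D.combined_sq_split A b c K TH TH Th
  have hq2 : qred ^ 2 ≤ 1 := by nlinarith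
  nlinarith [sq_nonneg (D.combined A b c K TH (TH \ Th))]

end Basic

/-! ### Perturbation bounds and quasi-monotonicity of the estimators. -/

section Estimates

variable {d : ℕ} {Ω : Set (E d)} {D : Discretization Ω}
  {A : E d → Matrix (Fin d) (Fin d) ℝ} {b : E d → E d} {c : E d → ℝ} {K : H10 Ω →L[ℝ] Hneg1 Ω}
  {Cmesh Cstab qred Crel Cdrel C θ : ℝ} {TH Th : Mesh d}

theorem mem_meshes_of_refines (hTH : TH ∈ D.meshes) (h : Refines D.refine TH Th) :
    Th ∈ D.meshes :=
  Relation.ReflTransGen.trans hTH h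

theorem energyNorm_zero_eq (hS : SolutionBounds A b c K C) : energyNorm A (0 : H10 Ω) = 0 := by
  refine le_antisymm ?_ (Real.sqrt_nonneg _)
  simpa using hS.energy_le (0 : H10 Ω)

theorem X_mono
    (hD : D.Admissible A b c K Cmesh Cstab qred Crel Cdrel)
    (hTH : TH ∈ D.meshes) (h : Refines D.refine TH Th) : D.X TH ≤ D.X Th := by
  induction h with
  | refl => exact le_rfl
  | @tail T T' hT hstep ih =>
    obtain ⟨M, hM, rfl⟩ := hstep
    exact ih.trans (feSpace_le_of_subdivision
      (hD.refinement.subdivision T (mem_meshes_of_refines hTH hT) M hM))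

open Classical in
theorem zetaOn_sub_le
    (hD : D.Admissible A b c K Cmesh Cstab qred Crel Cdrel)
    (hTH : TH ∈ D.meshes) (h : Refines D.refine TH Th) {vh vH wh wH : H10 Ω}
    (hvh : vh ∈ D.X Th) (hvH : vH ∈ D.X TH) {U : Finset (Elem d)} (hU : U ⊆ Th ∩ TH) :
    |D.zetaOn wh Th U vh - D.zetaOn wH TH U vH| ≤
      Cstab * (energyNorm A (vh - vH) + energyNorm A (wh - wH)) :=
  (le_add_of_nonneg_left (abs_nonneg _)).trans
    (hD.adaptivity.stability TH hTH Th h vh hvh vH hvH wh wH U hU)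

-- The primal indicators do not see the linearization point, so both points in the stability axiom
-- may be set to zero.
open Classical in
theorem etaOn_sub_le (hS : SolutionBounds A b c K C)
    (hD : D.Admissible A b c K Cmesh Cstab qred Crel Cdrel)
    (hTH : TH ∈ D.meshes) (h : Refines D.refine TH Th) {vh vH : H10 Ω}
    (hvh : vh ∈ D.X Th) (hvH : vH ∈ D.X TH) {U : Finset (Elem d)} (hU : U ⊆ Th ∩ TH) :
    |D.etaOn Th U vh - D.etaOn TH U vH| ≤ Cstab * energyNorm A (vh - vH) := by
  have h1 := hD.adaptivity.stability TH hTH Th h vh hvh vH hvH 0 0 U hU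
  rw [sub_self, energyNorm_zero_eq hS, add_zero] at h1
  exact (le_add_of_nonneg_right (abs_nonneg _)).trans h1

theorem uH_mem (hS : SolutionBounds A b c K C)
    (hD : D.Admissible A b c K Cmesh Cstab qred Crel Cdrel)
    : D.uH A b c TH ∈ D.X TH := hS.primal_mem D hD.memLp_f hD.memLp_ff TH

-- Common elements are compared by stability. On new elements stability is used on the fine mesh
-- alone, where `u_H` also is a discrete function, and the reduction axiom is then applied to the
-- fixed `u_H`.
open Classical in
theorem etaU_inter_sdiff_le (hS : SolutionBounds A b c K C)
    (hD : D.Admissible A b c K Cmesh Cstab qred Crel Cdrel)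
    (hCstab : 0 < Cstab) (hTH : TH ∈ D.meshes)
    (h : Refines D.refine TH Th) :
    D.etaU A b c Th (Th ∩ TH) ≤ D.etaU A b c TH (TH ∩ Th) +
      Cstab * C * ‖D.uH A b c Th - D.uH A b c TH‖ ∧
    D.etaU A b c Th (Th \ TH) ≤ qred * D.etaU A b c TH (TH \ Th) +
      Cstab * C * ‖D.uH A b c Th - D.uH A b c TH‖ := by
  have hE := mul_le_mul_of_nonneg_left (hS.energy_le (D.uH A b c Th - D.uH A b c TH)) hCstab.le
  have hmem := X_mono hD hTH h (uH_mem hS hD)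
  have h1 := (abs_le.1 (etaOn_sub_le hS hD hTH h (uH_mem hS hD) (uH_mem hS hD)
    (Finset.Subset.refl (Th ∩ TH)))).2
  have h2 := (abs_le.1 (etaOn_sub_le hS hD (mem_meshes_of_refines hTH h) .refl
    (uH_mem hS hD) hmem (U := Th \ TH) (by simp))).2
  have h3 := hD.adaptivity.reduction_eta TH hTH Th h _ (uH_mem hS hD)
  rw [Finset.inter_comm TH Th]
  simp only [etaU]
  constructor <;> linarith

open Classical in
theorem zetaZ_inter_sdiff_le (hS : SolutionBounds A b c K C)
    (hD : D.Admissible A b c K Cmesh Cstab qred Crel Cdrel)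
    (hCstab : 0 < Cstab) (hTH : TH ∈ D.meshes)
    (h : Refines D.refine TH Th) :
    D.zetaZ A b c K Th (Th ∩ TH) ≤ D.zetaZ A b c K TH (TH ∩ Th) +
      Cstab * C * (‖D.uH A b c Th - D.uH A b c TH‖ +
      ‖D.zH A b c K (D.uH A b c Th) Th - D.zH A b c K (D.uH A b c TH) TH‖) ∧
    D.zetaZ A b c K Th (Th \ TH) ≤ qred * D.zetaZ A b c K TH (TH \ Th) +
      Cstab * C * (‖D.uH A b c Th - D.uH A b c TH‖ +
      ‖D.zH A b c K (D.uH A b c Th) Th - D.zH A b c K (D.uH A b c TH) TH‖) := by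
  have hE := mul_le_mul_of_nonneg_left (hS.energy_le (D.uH A b c Th - D.uH A b c TH)) hCstab.le
  have hE' := mul_le_mul_of_nonneg_left (hS.energy_le
    (D.zH A b c K (D.uH A b c Th) Th - D.zH A b c K (D.uH A b c TH) TH)) hCstab.le
  have hmem := X_mono hD hTH h (hS.dual_mem D (D.uH A b c TH) TH)
  have h1 := (abs_le.1 (zetaOn_sub_le hD hTH h (wh := D.uH A b c Th) (wH := D.uH A b c TH)
    (hS.dual_mem D (D.uH A b c Th) Th) (hS.dual_mem D (D.uH A b c TH) TH)
    (Finset.Subset.refl (Th ∩ TH)))).2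
  have h2 := (abs_le.1 (zetaOn_sub_le hD (mem_meshes_of_refines hTH h) .refl
    (wh := D.uH A b c Th) (wH := D.uH A b c TH)
    (hS.dual_mem D (D.uH A b c Th) Th) hmem (U := Th \ TH) (by simp))).2
  have h3 := hD.adaptivity.reduction_zeta TH hTH Th h _ (hS.dual_mem D (D.uH A b c TH) TH)
    (D.uH A b c TH)
  rw [Finset.inter_comm TH Th]
  simp only [zetaZ]
  constructor <;> linarith

open Classical in
theorem etaU_refined_le (hS : SolutionBounds A b c K C)
    (hD : D.Admissible A b c K Cmesh Cstab qred Crel Cdrel)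
    (hCstab : 0 < Cstab) (hTH : TH ∈ D.meshes) (h : Refines D.refine TH Th) :
    D.etaU A b c Th Th ≤
      √(D.etaU A b c TH (TH ∩ Th) ^ 2 + (qred * D.etaU A b c TH (TH \ Th)) ^ 2) +
      2 * (Cstab * C) * ‖D.uH A b c Th - D.uH A b c TH‖ := by
  have hC := hS.one_le
  obtain ⟨h1, h2⟩ := etaU_inter_sdiff_le hS hD hCstab hTH h
  have h3 := sqrt_sum_sq_le_add (D.etaU_nonneg A b c Th (Th ∩ TH))
    (D.etaU_nonneg A b c Th (Th \ TH)) le_rfl le_rfl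
    (by positivity : 0 ≤ Cstab * C * ‖D.uH A b c Th - D.uH A b c TH‖) h1 h2
    (y₃ := 0) (y₄ := 0) (by positivity) (by positivity)
  have h4 : D.etaU A b c Th Th = √(D.etaU A b c Th (Th ∩ TH) ^ 2 +
      D.etaU A b c Th (Th \ TH) ^ 2 + 0 ^ 2 + 0 ^ 2) := by
    rw [etaU, etaU, etaU, zero_pow two_ne_zero, add_zero, add_zero, ← etaOn_sq_split,
      Real.sqrt_sq (D.etaOn_nonneg _ _ _)]
  rw [h4]
  simpa [mul_assoc] using h3

open Classical in
theorem combined_refined_le (hS : SolutionBounds A b c K C)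
    (hD : D.Admissible A b c K Cmesh Cstab qred Crel Cdrel)
    (hCstab : 0 < Cstab) (hTH : TH ∈ D.meshes)
    (h : Refines D.refine TH Th) :
    D.combined A b c K Th Th ≤
      √(D.combined A b c K TH (TH ∩ Th) ^ 2 + (qred * D.combined A b c K TH (TH \ Th)) ^ 2) +
      2 * (Cstab * C) * (‖D.uH A b c Th - D.uH A b c TH‖ +
      ‖D.zH A b c K (D.uH A b c Th) Th - D.zH A b c K (D.uH A b c TH) TH‖) := by
  have hC := hS.one_le
  set δ := ‖D.uH A b c Th - D.uH A b c TH‖ +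
      ‖D.zH A b c K (D.uH A b c Th) Th - D.zH A b c K (D.uH A b c TH) TH‖ with hδ
  have hle : Cstab * C * ‖D.uH A b c Th - D.uH A b c TH‖ ≤ Cstab * C * δ := by
    rw [hδ]; gcongr; simp
  obtain ⟨h1, h2⟩ := etaU_inter_sdiff_le hS hD hCstab hTH h
  obtain ⟨h3, h4⟩ := zetaZ_inter_sdiff_le hS hD hCstab hTH h
  have h5 := sqrt_sum_sq_le_add (D.etaU_nonneg A b c Th (Th ∩ TH))
    (D.etaU_nonneg A b c Th (Th \ TH)) (D.zetaZ_nonneg A b c K Th (Th ∩ TH))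
    (D.zetaZ_nonneg A b c K Th (Th \ TH))
    (by positivity : 0 ≤ Cstab * C * δ) (h1.trans (add_le_add_right hle _))
    (h2.trans (add_le_add_right hle _)) h3 h4
  have e1 : D.combined A b c K Th Th = √(D.etaU A b c Th (Th ∩ TH) ^ 2 +
      D.etaU A b c Th (Th \ TH) ^ 2 + D.zetaZ A b c K Th (Th ∩ TH) ^ 2 +
      D.zetaZ A b c K Th (Th \ TH) ^ 2) := by
    rw [← Real.sqrt_sq (D.combined_nonneg A b c K Th Th), D.combined_sq_split A b c K Th Th TH,
      combined_sq, combined_sq]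
    congr 1; ring
  have e2 : D.combined A b c K TH (TH ∩ Th) ^ 2 + (qred * D.combined A b c K TH (TH \ Th)) ^ 2 =
      D.etaU A b c TH (TH ∩ Th) ^ 2 + (qred * D.etaU A b c TH (TH \ Th)) ^ 2 +
      D.zetaZ A b c K TH (TH ∩ Th) ^ 2 + (qred * D.zetaZ A b c K TH (TH \ Th)) ^ 2 := by
    rw [mul_pow, combined_sq, combined_sq]; ring
  rw [e1, e2, mul_assoc]
  exact h5

/-- Error bounds in the `H^1`-norm. -/
theorem norm_u_sub_le (hS : SolutionBounds A b c K C)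
    (hD : D.Admissible A b c K Cmesh Cstab qred Crel Cdrel)
    (hTH : TH ∈ D.meshes) :
    ‖D.u A b c - D.uH A b c TH‖ ≤ C * Crel * D.etaU A b c TH TH := by
  have hC := hS.one_le
  refine (hS.le_energy _).trans ?_
  rw [mul_assoc]
  exact mul_le_mul_of_nonneg_left (hD.adaptivity.reliability_eta TH hTH) (by linarith)

theorem norm_z_sub_le (hS : SolutionBounds A b c K C)
    (hD : D.Admissible A b c K Cmesh Cstab qred Crel Cdrel)
    (hTH : TH ∈ D.meshes) (w : H10 Ω) :
    ‖dual A b c K w ⊤ - D.zH A b c K w TH‖ ≤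
      C * Crel * D.zetaOn w TH TH (D.zH A b c K w TH) := by
  have hC := hS.one_le
  refine (hS.le_energy _).trans ?_
  rw [mul_assoc]
  exact mul_le_mul_of_nonneg_left (hD.adaptivity.reliability_zeta TH hTH w) (by linarith)

theorem norm_uH_sub_le (hS : SolutionBounds A b c K C)
    (hD : D.Admissible A b c K Cmesh Cstab qred Crel Cdrel)
    (hTH : TH ∈ D.meshes) (h : Refines D.refine TH Th) :
    ‖D.uH A b c Th - D.uH A b c TH‖ ≤ C ^ 2 * Crel * D.etaU A b c TH TH := by
  have hC := hS.one_le
  refine (hS.primal_cea D hD.memLp_f hD.memLp_ff TH Th (X_mono hD hTH h)).trans ?_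
  have := mul_le_mul_of_nonneg_left (norm_u_sub_le hS hD hTH) (by linarith : 0 ≤ C)
  linarith

theorem norm_zH_sub_le (hS : SolutionBounds A b c K C)
    (hD : D.Admissible A b c K Cmesh Cstab qred Crel Cdrel)
    (hTH : TH ∈ D.meshes) (h : Refines D.refine TH Th) (w : H10 Ω) :
    ‖D.zH A b c K w Th - D.zH A b c K w TH‖ ≤
      C ^ 2 * Crel * D.zetaOn w TH TH (D.zH A b c K w TH) := by
  have hC := hS.one_le
  refine (hS.dual_cea D w TH Th (X_mono hD hTH h)).trans ?_
  have := mul_le_mul_of_nonneg_left (norm_z_sub_le hS hD hTH w) (by linarith : 0 ≤ C)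
  linarith

/-- Inserting `z_h[u_H]` separates two effects: the change of the linearization point, which is
Lipschitz in `u_h - u_H`, and the change of the space at fixed linearization point, which is a Céa
estimate. Each of the three resulting terms is at most `C ^ 3 * Crel` times the combined estimator.
-/
theorem norm_pair_sub_le (hS : SolutionBounds A b c K C)
    (hD : D.Admissible A b c K Cmesh Cstab qred Crel Cdrel)
    (hCrel : 0 < Crel) (hTH : TH ∈ D.meshes) (h : Refines D.refine TH Th) :
    ‖D.uH A b c Th - D.uH A b c TH‖ +
      ‖D.zH A b c K (D.uH A b c Th) Th - D.zH A b c K (D.uH A b c TH) TH‖ ≤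
      3 * C ^ 3 * Crel * D.combined A b c K TH TH := by
  have hC := hS.one_le
  have hρ := D.combined_nonneg A b c K TH TH
  have h1 := norm_uH_sub_le hS hD hTH h
  have h2 := norm_zH_sub_le hS hD hTH h (D.uH A b c TH)
  have h3 := hS.dual_lipschitz D (D.uH A b c Th) (D.uH A b c TH) Th
  have h4 := norm_sub_le_norm_sub_add_norm_sub (D.zH A b c K (D.uH A b c Th) Th)
    (D.zH A b c K (D.uH A b c TH) Th) (D.zH A b c K (D.uH A b c TH) TH)
  have hη := D.etaU_le_combined A b c K TH TH
  have hζ := D.zetaZ_le_combined A b c K TH TH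
  have a1 : C ^ 2 * Crel * D.etaU A b c TH TH ≤ C ^ 2 * Crel * D.combined A b c K TH TH := by
    gcongr
  have a2 : C ^ 2 * Crel * D.zetaZ A b c K TH TH ≤ C ^ 2 * Crel * D.combined A b c K TH TH := by
    gcongr
  have a3 : C ^ 2 * Crel * D.combined A b c K TH TH ≤ C ^ 3 * Crel * D.combined A b c K TH TH := by
    gcongr
    norm_num
  have a4 := mul_le_mul_of_nonneg_left (h1.trans a1) (by linarith : 0 ≤ C)
  have a5 : C * (C ^ 2 * Crel * D.combined A b c K TH TH) =
    C ^ 3 * Crel * D.combined A b c K TH TH := by ring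
  change _ ≤ C ^ 2 * Crel * D.zetaZ A b c K TH TH at h2
  linarith

theorem etaU_quasiMono (hS : SolutionBounds A b c K C)
    (hD : D.Admissible A b c K Cmesh Cstab qred Crel Cdrel)
    (hCstab : 0 < Cstab) (hq0 : 0 < qred) (hq1 : qred < 1) (hCrel : 0 < Crel)
    (hTH : TH ∈ D.meshes) (h : Refines D.refine TH Th) :
    D.etaU A b c Th Th ≤ (1 + 6 * Cstab * C ^ 4 * Crel) * D.etaU A b c TH TH := by
  have hC := hS.one_le
  have hη := D.etaU_nonneg A b c TH TH
  have h1 := etaU_refined_le hS hD hCstab hTH h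
  have h2 := D.sqrt_inter_sdiff_le_etaU A b c TH Th hq0 hq1
  have h3 : 2 * (Cstab * C) * ‖D.uH A b c Th - D.uH A b c TH‖ ≤
      2 * (Cstab * C) * (C ^ 2 * Crel * D.etaU A b c TH TH) := by
    gcongr
    exact norm_uH_sub_le hS hD hTH h
  -- The constant is enlarged on purpose, so that both estimators share one quasi-monotonicity
  -- factor.
  have h4 : 2 * (Cstab * C) * (C ^ 2 * Crel * D.etaU A b c TH TH) ≤
      6 * Cstab * C ^ 4 * Crel * D.etaU A b c TH TH := by
    calc 2 * (Cstab * C) * (C ^ 2 * Crel * D.etaU A b c TH TH)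
        = 2 * (Cstab * C ^ 3 * Crel * D.etaU A b c TH TH) := by ring
      _ ≤ 6 * (Cstab * C ^ 4 * Crel * D.etaU A b c TH TH) := by
        gcongr
        all_goals norm_num
      _ = _ := by ring
  linarith

theorem combined_quasiMono (hS : SolutionBounds A b c K C)
    (hD : D.Admissible A b c K Cmesh Cstab qred Crel Cdrel)
    (hCstab : 0 < Cstab) (hq0 : 0 < qred) (hq1 : qred < 1)
    (hCrel : 0 < Crel) (hTH : TH ∈ D.meshes) (h : Refines D.refine TH Th) :
    D.combined A b c K Th Th ≤ (1 + 6 * Cstab * C ^ 4 * Crel) * D.combined A b c K TH TH := by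
  have hC := hS.one_le
  have h1 := combined_refined_le hS hD hCstab hTH h
  have h2 := D.sqrt_inter_sdiff_le_combined A b c K TH Th hq0 hq1
  have h3 := mul_le_mul_of_nonneg_left (norm_pair_sub_le hS hD hCrel hTH h)
    (by positivity : 0 ≤ 2 * (Cstab * C))
  linarith

end Estimates

end Discretization

namespace Discretization

/-! ### Linear convergence of the estimator product. -/

section Linear

variable {d : ℕ} {Ω : Set (E d)} {D : Discretization Ω}
  {A : E d → Matrix (Fin d) (Fin d) ℝ} {b : E d → E d} {c : E d → ℝ} {K : H10 Ω →L[ℝ] Hneg1 Ω}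
  {Cmesh Cstab qred Crel Cdrel C θ Cmark : ℝ} {TH Th : Mesh d} {𝒯 : ℕ → Mesh d}

open Classical in
/-- A step of the algorithm refines a set of elements whose cardinality is minimal up to a factor
for at least one of the two Dörfler criteria, and that satisfies one of them. -/
theorem Step.exists_marked (h : D.Step A b c K θ Cmark TH Th) :
    ∃ M ⊆ TH, Th = D.refine TH M ∧
      (D.DoerflerU A b c θ TH M ∨ D.DoerflerUZ A b c K θ TH M) ∧
      ∀ M' ⊆ TH, D.DoerflerU A b c θ TH M' ∨ D.DoerflerUZ A b c K θ TH M' →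
        (M.card : ℝ) ≤ 2 * Cmark * M'.card := by
  obtain ⟨Mu', Muz', Mu, Muz, ⟨hu1, hu2, hu3⟩, ⟨hz1, hz2, hz3⟩, hMu, hMuz, hcu, hcz, rfl⟩ := h
  refine ⟨Mu ∪ Muz, Finset.union_subset (hMu.trans hu1) (hMuz.trans hz1), rfl, ?_, ?_⟩
  -- The smaller of the two Dörfler sets is not truncated, so its criterion survives in the union.
  · rcases le_total Mu'.card Muz'.card with hle | hle
    · left
      have e : Mu = Mu' := Finset.eq_of_subset_of_card_le hMu (by rw [hcu, min_eq_left hle])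
      refine hu2.trans ?_
      exact pow_le_pow_left₀ (D.etaU_nonneg A b c _ _)
        (D.etaOn_mono _ (e ▸ Finset.subset_union_left) _) 2
    · right
      have e : Muz = Muz' := Finset.eq_of_subset_of_card_le hMuz (by rw [hcz, min_eq_right hle])
      have hsub : Muz' ⊆ Mu ∪ Muz := e ▸ Finset.subset_union_right
      refine hz2.trans (add_le_add ?_ ?_)
      · exact pow_le_pow_left₀ (D.etaU_nonneg A b c _ _) (D.etaOn_mono _ hsub _) 2
      · exact pow_le_pow_left₀ (D.zetaZ_nonneg A b c K _ _) (D.zetaOn_mono _ _ hsub _) 2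
  · intro M' hM' hdoe
    have hcard : ((Mu ∪ Muz).card : ℝ) ≤ 2 * (min Mu'.card Muz'.card : ℕ) := by
      have := Finset.card_union_le Mu Muz
      rw [hcu, hcz] at this
      exact_mod_cast this.trans (by omega)
    have hmin : ((min Mu'.card Muz'.card : ℕ) : ℝ) ≤ Cmark * M'.card := by
      rcases hdoe with h | h
      · exact (Nat.cast_le.2 (min_le_left _ _)).trans (hu3 M' hM' h)
      · exact (Nat.cast_le.2 (min_le_right _ _)).trans (hz3 M' hM' h)
    linarith

theorem IsRun.refines (h : D.IsRun A b c K θ Cmark 𝒯) {k l : ℕ} (hkl : k ≤ l) :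
    Refines D.refine (𝒯 k) (𝒯 l) := by
  induction l, hkl using Nat.le_induction with
  | base => exact .refl
  | succ n _ ih =>
    obtain ⟨M, hM, hT, -⟩ := (h.2 n).exists_marked
    exact ih.tail ⟨M, hM, hT⟩

theorem IsRun.mem_meshes (h : D.IsRun A b c K θ Cmark 𝒯) (k : ℕ) : 𝒯 k ∈ D.meshes := by
  have := h.refines (Nat.zero_le k)
  rw [h.1] at this
  exact this

open Classical in
theorem DoerflerU.reduction (hq0 : 0 < qred) (hq1 : qred < 1) {M : Finset (Elem d)}
    (hM : D.DoerflerU A b c θ TH M) (hsub : M ⊆ TH \ Th) :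
    √(D.etaU A b c TH (TH ∩ Th) ^ 2 + (qred * D.etaU A b c TH (TH \ Th)) ^ 2) ≤
      √(1 - (1 - qred ^ 2) * θ) * D.etaU A b c TH TH :=
  sqrt_reduction_le hq0.le hq1.le (D.etaU_nonneg A b c _ _) (D.etaU_nonneg A b c TH M)
    (D.etaOn_mono _ hsub _) (D.etaOn_sq_split _ _ _ _) hM

open Classical in
theorem DoerflerUZ.reduction (hq0 : 0 < qred) (hq1 : qred < 1) {M : Finset (Elem d)}
    (hM : D.DoerflerUZ A b c K θ TH M) (hsub : M ⊆ TH \ Th) :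
    √(D.combined A b c K TH (TH ∩ Th) ^ 2 + (qred * D.combined A b c K TH (TH \ Th)) ^ 2) ≤
      √(1 - (1 - qred ^ 2) * θ) * D.combined A b c K TH TH :=
  sqrt_reduction_le hq0.le hq1.le (D.combined_nonneg A b c K _ _) (D.combined_nonneg A b c K TH M)
    (D.combined_mono A b c K _ hsub) (D.combined_sq_split A b c K _ _ _)
    (by rw [combined_sq, combined_sq]; exact hM)

/-- Linear convergence of the estimator product from the first step on, with constants that do not
depend on the discretization. It rests on the uniform oscillation bound in `SolutionBounds`, which
holds for every bounded `K`. -/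
theorem exists_linear_convergence (hS : SolutionBounds A b c K C) (hθ0 : 0 < θ)
    (hCstab : 0 < Cstab) (hq0 : 0 < qred) (hq1 : qred < 1) (hCrel : 0 < Crel) :
    ∃ Clin qlin : ℝ, 0 < Clin ∧ 0 < qlin ∧ qlin < 1 ∧ ∀ (Cmark Cmesh Cdrel : ℝ)
      (D : Discretization Ω), D.Admissible A b c K Cmesh Cstab qred Crel Cdrel →
      ∀ 𝒯 : ℕ → Mesh d, D.IsRun A b c K θ Cmark 𝒯 → ∀ l n : ℕ, l ≤ n →
      D.estProduct A b c K (𝒯 n) ≤ Clin * qlin ^ (n - l) * D.estProduct A b c K (𝒯 l) := by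
  classical
  have hC := hS.one_le
  have hC0 : 0 < C := by linarith
  set Q := 1 + 6 * Cstab * C ^ 4 * Crel with hQdef
  have hQ : 0 < Q := by positivity
  set q := √(1 - (1 - qred ^ 2) * θ) with hqdef
  have hq1' : q < 1 := by
    rw [hqdef, Real.sqrt_lt' one_pos]
    have : 0 < (1 - qred ^ 2) * θ := mul_pos (by nlinarith) hθ0
    linarith
  -- One factor of the product drops by `1 / (2 * Q)` while the other grows at most by `Q`, so the
  -- product is halved.
  obtain ⟨ε, hε, hmarks⟩ := exists_marks_suffice (Real.sqrt_nonneg _) hq1' hQ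
    (show 0 < 1 / (2 * Q) by positivity)
  -- This absorbs the stability factor `2 * Cstab * C`, the factor `2 * C * Crel` from bounding both
  -- initial errors by the combined estimator, and a factor two for the two components of the pair.
  set ε' := ε / (8 * Cstab * C ^ 2 * Crel) with hε'
  have hε'0 : 0 < ε' := by positivity
  obtain ⟨M, hM⟩ := hS.oscLE ε' hε'0
  obtain ⟨m, hm⟩ := hmarks M
  -- Among `2 * m + 1` consecutive steps at least `m` satisfy the same one of the two criteria.
  have hN : 0 < 2 * m + 1 := by omega
  have hNR : (0 : ℝ) < ((2 * m + 1 : ℕ) : ℝ) := by exact_mod_cast hN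
  refine ⟨2 * Q ^ 2, (1 / 2 : ℝ) ^ (1 / (2 * m + 1 : ℕ) : ℝ), by positivity, by positivity,
    Real.rpow_lt_one (by norm_num) (by norm_num) (by positivity), ?_⟩
  intro Cmark Cmesh Cdrel D hD 𝒯 hrun
  have hηmono : ∀ k l, k ≤ l → D.etaU A b c (𝒯 l) (𝒯 l) ≤ Q * D.etaU A b c (𝒯 k) (𝒯 k) :=
    fun k l hkl => etaU_quasiMono hS hD hCstab hq0 hq1 hCrel (hrun.mem_meshes k) (hrun.refines hkl)
  have hρmono : ∀ k l, k ≤ l →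
      D.combined A b c K (𝒯 l) (𝒯 l) ≤ Q * D.combined A b c K (𝒯 k) (𝒯 k) :=
    fun k l hkl => combined_quasiMono hS hD hCstab hq0 hq1 hCrel (hrun.mem_meshes k)
      (hrun.refines hkl)
  refine linear_convergence_of_halving (P := fun k => D.estProduct A b c K (𝒯 k)) hN
    (by positivity) ?_ ?_ ?_
  · exact fun k => mul_nonneg (D.etaU_nonneg A b c _ _) (D.combined_nonneg A b c K _ _)
  · intro l n hln
    simp only [estProduct_eq]
    have h1 := mul_le_mul (hηmono l n hln) (hρmono l n hln) (D.combined_nonneg A b c K _ _)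
      (mul_nonneg hQ.le (D.etaU_nonneg A b c _ _))
    calc _ ≤ _ := h1
      _ = _ := by ring
  · intro k
    simp only [estProduct_eq]
    -- The oscillation bound is applied to the run restarted at `k`, so the errors on its right-hand
    -- side are those on `𝒯 k`, which reliability bounds by the estimators there. The count `M` does
    -- not depend on `k`.
    obtain ⟨hoscU, hoscUZ⟩ := hM D hD.memLp_f hD.memLp_ff (fun j => 𝒯 (k + j)) (fun i j hij =>
      X_mono hD (hrun.mem_meshes _) (hrun.refines (by omega)))
    have hmesh := fun j => hrun.mem_meshes (k + j)
    have hη0 := D.etaU_nonneg A b c (𝒯 k) (𝒯 k)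
    have hρ0 := D.combined_nonneg A b c K (𝒯 k) (𝒯 k)
    have hmarked : ∀ j, ∃ M ⊆ 𝒯 j \ 𝒯 (j + 1),
        D.DoerflerU A b c θ (𝒯 j) M ∨ D.DoerflerUZ A b c K θ (𝒯 j) M := by
      intro j
      obtain ⟨M, hM, hT, hdoe, -⟩ := (hrun.2 j).exists_marked
      refine ⟨M, ?_, hdoe⟩
      have := hD.refinement.marked (𝒯 j) (hrun.mem_meshes j) M hM
      intro T hTM
      have := this hTM
      rw [hT]
      simpa using this
    set SU := (Finset.range (2 * m + 1)).filter fun j => ∃ M ⊆ 𝒯 (k + j) \ 𝒯 (k + j + 1),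
      D.DoerflerU A b c θ (𝒯 (k + j)) M with hSU
    set SZ := (Finset.range (2 * m + 1)).filter fun j => ∃ M ⊆ 𝒯 (k + j) \ 𝒯 (k + j + 1),
      D.DoerflerUZ A b c K θ (𝒯 (k + j)) M with hSZ
    have hcover : Finset.range (2 * m + 1) ⊆ SU ∪ SZ := by
      intro j hj
      obtain ⟨M, hM, h | h⟩ := hmarked (k + j)
      · exact Finset.mem_union_left _ (Finset.mem_filter.2 ⟨hj, M, hM, h⟩)
      · exact Finset.mem_union_right _ (Finset.mem_filter.2 ⟨hj, M, hM, h⟩)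
    have hcard : 2 * m + 1 ≤ SU.card + SZ.card := by
      have := (Finset.card_le_card hcover).trans (Finset.card_union_le _ _)
      rwa [Finset.card_range] at this
    have hcase : m ≤ SU.card ∨ m ≤ SZ.card := by omega
    rcases hcase with hcase | hcase
    · obtain ⟨φ, hφ1, hφ2, hφ3⟩ := hoscU
      have hsmall := hm (fun j => D.etaU A b c (𝒯 (k + j)) (𝒯 (k + j)))
        (fun i j => 2 * (Cstab * C) * ‖D.uH A b c (𝒯 (k + j)) - D.uH A b c (𝒯 (k + i))‖) φ SU
        (2 * m + 1) (D.etaU A b c (𝒯 k) (𝒯 k)) hη0 (fun j => hηmono k _ (by omega))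
        (fun i j hij => hηmono _ _ (by omega)) ?_ ?_ hφ1 hφ2 ?_ (Finset.filter_subset _ _) hcase
      · have h1 := mul_le_mul hsmall (hρmono k (k + (2 * m + 1)) (by omega))
          (D.combined_nonneg A b c K _ _) (by positivity)
        calc _ ≤ _ := h1
          _ = _ := by field_simp
      · intro i j hij
        have h1 := etaU_refined_le hS hD hCstab (hmesh i) (hrun.refines (by omega : k + i ≤ k + j))
        have h2 := D.sqrt_inter_sdiff_le_etaU A b c (𝒯 (k + i)) (𝒯 (k + j)) hq0 hq1
        linarith
      · intro j hj
        obtain ⟨-, M, hMs, hM⟩ := Finset.mem_filter.1 hj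
        have h1 := etaU_refined_le hS hD hCstab (hmesh j) (hrun.refines (Nat.le_succ (k + j)))
        have h2 := hM.reduction hq0 hq1 hMs
        exact h1.trans (add_le_add_left h2 _)
      · intro i j _ hij
        have h1 := (hφ3 j i hij.symm).trans
          (mul_le_mul_of_nonneg_left (norm_u_sub_le hS hD (hmesh 0)) hε'0.le)
        calc 2 * (Cstab * C) * ‖D.uH A b c (𝒯 (k + j)) - D.uH A b c (𝒯 (k + i))‖
            ≤ 2 * (Cstab * C) * (ε' * (C * Crel * D.etaU A b c (𝒯 k) (𝒯 k))) := by
              gcongr; exact h1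
          _ = ε / 4 * D.etaU A b c (𝒯 k) (𝒯 k) := by rw [hε']; field_simp; ring
          _ ≤ ε * D.etaU A b c (𝒯 k) (𝒯 k) := by gcongr; linarith
    · obtain ⟨φ, hφ1, hφ2, hφ3⟩ := hoscUZ
      have hsmall := hm (fun j => D.combined A b c K (𝒯 (k + j)) (𝒯 (k + j)))
        (fun i j => 2 * (Cstab * C) * (‖D.uH A b c (𝒯 (k + j)) - D.uH A b c (𝒯 (k + i))‖ +
          ‖D.zH A b c K (D.uH A b c (𝒯 (k + j))) (𝒯 (k + j)) -
            D.zH A b c K (D.uH A b c (𝒯 (k + i))) (𝒯 (k + i))‖)) φ SZ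
        (2 * m + 1) (D.combined A b c K (𝒯 k) (𝒯 k)) hρ0 (fun j => hρmono k _ (by omega))
        (fun i j hij => hρmono _ _ (by omega)) ?_ ?_ hφ1 hφ2 ?_ (Finset.filter_subset _ _) hcase
      · have h1 := mul_le_mul (hηmono k (k + (2 * m + 1)) (by omega)) hsmall
          (D.combined_nonneg A b c K _ _) (by positivity)
        calc _ ≤ _ := h1
          _ = _ := by field_simp
      · intro i j hij
        have h1 := combined_refined_le hS hD hCstab (hmesh i)
          (hrun.refines (by omega : k + i ≤ k + j))
        have h2 := D.sqrt_inter_sdiff_le_combined A b c K (𝒯 (k + i)) (𝒯 (k + j)) hq0 hq1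
        linarith
      · intro j hj
        obtain ⟨-, M, hMs, hM⟩ := Finset.mem_filter.1 hj
        have h1 := combined_refined_le hS hD hCstab (hmesh j) (hrun.refines (Nat.le_succ (k + j)))
        have h2 := hM.reduction hq0 hq1 hMs
        exact h1.trans (add_le_add_left h2 _)
      · intro i j _ hij
        have h0 := hφ3 j i hij.symm
        have hu := norm_u_sub_le hS hD (hmesh 0)
        have hz := norm_z_sub_le hS hD (hmesh 0) (D.uH A b c (𝒯 (k + 0)))
        have hsum : ‖D.u A b c - D.uH A b c (𝒯 (k + 0))‖ +
            ‖dual A b c K (D.uH A b c (𝒯 (k + 0))) ⊤ -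
              D.zH A b c K (D.uH A b c (𝒯 (k + 0))) (𝒯 (k + 0))‖ ≤
            2 * (C * Crel * D.combined A b c K (𝒯 k) (𝒯 k)) := by
          have e1 := mul_le_mul_of_nonneg_left (D.etaU_le_combined A b c K (𝒯 k) (𝒯 k))
            (by positivity : 0 ≤ C * Crel)
          have e2 := mul_le_mul_of_nonneg_left (D.zetaZ_le_combined A b c K (𝒯 k) (𝒯 k))
            (by positivity : 0 ≤ C * Crel)
          have hu' := hu.trans e1
          have hz' := hz.trans e2
          linarith
        have h1 := h0.trans (mul_le_mul_of_nonneg_left hsum hε'0.le)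
        rw [Prod.mk_sub_mk, Prod.norm_mk] at h1
        have h2 := (le_max_left _ _).trans h1
        have h3 := (le_max_right _ _).trans h1
        calc 2 * (Cstab * C) * (‖D.uH A b c (𝒯 (k + j)) - D.uH A b c (𝒯 (k + i))‖ +
          ‖D.zH A b c K (D.uH A b c (𝒯 (k + j))) (𝒯 (k + j)) -
            D.zH A b c K (D.uH A b c (𝒯 (k + i))) (𝒯 (k + i))‖)
            ≤ 2 * (Cstab * C) * (ε' * (2 * (C * Crel * D.combined A b c K (𝒯 k) (𝒯 k))) +
              ε' * (2 * (C * Crel * D.combined A b c K (𝒯 k) (𝒯 k)))) := by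
              gcongr
          _ = ε * D.combined A b c K (𝒯 k) (𝒯 k) := by rw [hε']; field_simp; ring

end Linear

end Discretization

/-! ### Optimality of the marking. -/

/-- If the estimator on the unrefined elements is controlled by the refined ones up to a small
part of the total, then the refined elements satisfy the Dörfler criterion. -/
theorem exists_doerfler_threshold {θ G : ℝ} (hθ0 : 0 < θ) (hθ : θ < (1 + G ^ 2)⁻¹) :
    ∃ κ : ℝ, 0 < κ ∧ ∀ e x r : ℝ, 0 ≤ x → e ^ 2 = x ^ 2 + r ^ 2 → x ≤ κ * e + G * r →
      θ * e ^ 2 ≤ r ^ 2 := by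
  have hG : 0 < 1 + G ^ 2 := by positivity
  have hg : 0 < 1 - θ * (1 + G ^ 2) := by
    rw [lt_inv_comm₀ hθ0 hG, inv_eq_one_div, lt_div_iff₀ hθ0] at hθ
    linarith
  -- The gap `g` left by the strict inequality for `θ` is spent in halves. Young's inequality with
  -- weight `δ` splits the square of `κ * e + G * r`; the choice of `δ` keeps `θ * δ * G ^ 2` below
  -- `g / 2`, and `κ` makes `(1 + δ⁻¹) * κ ^ 2` equal to `g / 2`.
  set g := 1 - θ * (1 + G ^ 2) with hgdef
  set δ := g / (2 * (θ * G ^ 2 + 1)) with hδ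
  have hδ0 : 0 < δ := by positivity
  have h1 : θ * δ * G ^ 2 ≤ g / 2 := by
    have : δ * (2 * (θ * G ^ 2 + 1)) = g := by rw [hδ]; field_simp
    nlinarith
  refine ⟨√(g / 2 / (1 + δ⁻¹)), by positivity, fun e x r hx hsum hle => ?_⟩
  set κ := √(g / 2 / (1 + δ⁻¹)) with hκ
  have hκ2 : (1 + δ⁻¹) * κ ^ 2 = g / 2 := by
    rw [hκ, Real.sq_sqrt (by positivity)]; field_simp
  have h2 : x ^ 2 ≤ (κ * e + G * r) ^ 2 := pow_le_pow_left₀ hx hle 2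
  have h3 : 2 * (κ * e) * (G * r) ≤ δ⁻¹ * (κ * e) ^ 2 + δ * (G * r) ^ 2 := by
    have h4 : 0 ≤ δ⁻¹ * (κ * e - δ * (G * r)) ^ 2 := by positivity
    have h5 : δ⁻¹ * (κ * e - δ * (G * r)) ^ 2 =
        δ⁻¹ * (κ * e) ^ 2 + δ * (G * r) ^ 2 - 2 * (κ * e) * (G * r) := by
      field_simp; ring
    linarith
  have h6 : e ^ 2 ≤ g / 2 * e ^ 2 + (1 + (1 + δ) * G ^ 2) * r ^ 2 := by
    rw [← hκ2]; nlinarith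
  have h7 : θ * (1 + (1 + δ) * G ^ 2) ≤ 1 - g / 2 := by
    have : θ * (1 + (1 + δ) * G ^ 2) = θ * (1 + G ^ 2) + θ * δ * G ^ 2 := by ring
    linarith
  have hg1 : 0 < 1 - g / 2 := by
    have : 0 < θ * (1 + G ^ 2) := by positivity
    linarith
  have h8 : θ * ((1 - g / 2) * e ^ 2) ≤ θ * ((1 + (1 + δ) * G ^ 2) * r ^ 2) :=
    mul_le_mul_of_nonneg_left (by linarith) hθ0.le
  have h9 : θ * (1 + (1 + δ) * G ^ 2) * r ^ 2 ≤ (1 - g / 2) * r ^ 2 := by gcongr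
  have h10 : (1 - g / 2) * (θ * e ^ 2) ≤ (1 - g / 2) * r ^ 2 := by linarith
  exact le_of_mul_le_mul_left h10 hg1

/-- Near-best meshes for a finite approximation constant. -/
theorem exists_lt_of_iSup_lt {ι : Type*} (S : ℕ → Set ι) (f : ι → ℝ) {s U : ℝ} (hU : 0 < U)
    (h : (⨆ N : ℕ, ENNReal.ofReal (((N : ℝ) + 1) ^ s) *
      ⨅ i ∈ S N, ENNReal.ofReal (f i)) < ENNReal.ofReal U) (N : ℕ) :
    ∃ i ∈ S N, f i < U * ((N : ℝ) + 1) ^ (-s) := by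
  have hn : (0 : ℝ) < (N : ℝ) + 1 := by positivity
  have h1 := (le_iSup (fun N : ℕ => ENNReal.ofReal (((N : ℝ) + 1) ^ s) *
      ⨅ i ∈ S N, ENNReal.ofReal (f i)) N).trans_lt h
  have h2 : (⨅ i ∈ S N, ENNReal.ofReal (f i)) < ENNReal.ofReal (U * ((N : ℝ) + 1) ^ (-s)) := by
    by_contra hcon
    rw [not_lt] at hcon
    have h3 := mul_le_mul_right hcon (ENNReal.ofReal (((N : ℝ) + 1) ^ s))
    rw [← ENNReal.ofReal_mul (by positivity)] at h3
    have h4 : ((N : ℝ) + 1) ^ s * (U * ((N : ℝ) + 1) ^ (-s)) = U := by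
      rw [Real.rpow_neg hn.le]
      have : ((N : ℝ) + 1) ^ s ≠ 0 := by positivity
      field_simp
    rw [h4] at h3
    exact absurd (h3.trans_lt h1) (lt_irrefl _)
  simp only [iInf_lt_iff] at h2
  obtain ⟨i, hi, hlt⟩ := h2
  exact ⟨i, hi, (ENNReal.ofReal_lt_ofReal_iff (by positivity)).1 hlt⟩

namespace Discretization

section Optimality

variable {d : ℕ} {Ω : Set (E d)} {D : Discretization Ω}
  {A : E d → Matrix (Fin d) (Fin d) ℝ} {b : E d → E d} {c : E d → ℝ} {K : H10 Ω →L[ℝ] Hneg1 Ω}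
  {Cmesh Cstab qred Crel Cdrel C θ Cmark : ℝ} {TH Th : Mesh d} {𝒯 : ℕ → Mesh d}

-- Stability on the common elements, followed by discrete reliability, which sees only the refined
-- elements. The factor `Cstab * Cdrel` is the `G` of `exists_doerfler_threshold`.
open Classical in
theorem etaU_inter_le (hS : SolutionBounds A b c K C)
    (hD : D.Admissible A b c K Cmesh Cstab qred Crel Cdrel) (hCstab : 0 < Cstab)
    (hTH : TH ∈ D.meshes) (h : Refines D.refine TH Th) :
    D.etaU A b c TH (TH ∩ Th) ≤ D.etaU A b c Th Th +
      Cstab * Cdrel * D.etaU A b c TH (TH \ Th) := by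
  have h1 := (abs_le.1 (etaOn_sub_le hS hD hTH h (uH_mem hS hD) (uH_mem hS hD)
    (Finset.Subset.refl (Th ∩ TH)))).1
  have h2 := mul_le_mul_of_nonneg_left (hD.adaptivity.discreteReliability_eta TH hTH Th h)
    hCstab.le
  have h3 := D.etaOn_mono Th (Finset.inter_subset_left : Th ∩ TH ⊆ Th) (D.uH A b c Th)
  rw [Finset.inter_comm TH Th]
  simp only [etaU]
  linarith

/-- Changing the linearization point of the dual problem on a fixed mesh. -/
theorem zetaOn_linearization_le (hS : SolutionBounds A b c K C)
    (hD : D.Admissible A b c K Cmesh Cstab qred Crel Cdrel) (hCstab : 0 < Cstab)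
    (hTH : TH ∈ D.meshes) {U : Finset (Elem d)} (hU : U ⊆ TH) (w w' : H10 Ω) :
    D.zetaOn w TH U (D.zH A b c K w TH) ≤ D.zetaOn w' TH U (D.zH A b c K w' TH) +
      2 * Cstab * C ^ 2 * ‖w - w'‖ := by
  classical
  have hC := hS.one_le
  have h1 := (abs_le.1 (zetaOn_sub_le hD hTH .refl (wh := w) (wH := w') (hS.dual_mem D w TH)
    (hS.dual_mem D w' TH) (U := U) (by simpa using hU))).2
  have h2 := (hS.energy_le (D.zH A b c K w TH - D.zH A b c K w' TH)).trans
    (mul_le_mul_of_nonneg_left (hS.dual_lipschitz D w w' TH) (by linarith))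
  have h3 := hS.energy_le (w - w')
  have h4 : C * ‖w - w'‖ ≤ C * (C * ‖w - w'‖) := by
    gcongr
    nlinarith [norm_nonneg (w - w')]
  have h5 := mul_le_mul_of_nonneg_left (add_le_add h2 (h3.trans h4)) hCstab.le
  nlinarith

-- Discrete reliability compares dual solutions linearized at the same `u_H`, whereas the fine
-- estimator is linearized at `u_h`. Exchanging the linearization point costs a multiple of `‖u_h -
-- u_H‖` and thus of the primal estimator on the coarse mesh. This term does not shrink with the
-- estimator on the fine mesh.
open Classical in
theorem combined_inter_le (hS : SolutionBounds A b c K C)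
    (hD : D.Admissible A b c K Cmesh Cstab qred Crel Cdrel) (hCstab : 0 < Cstab)
    (hCrel : 0 < Crel) (hCdrel : 0 < Cdrel) (hTH : TH ∈ D.meshes) (h : Refines D.refine TH Th) :
    D.combined A b c K TH (TH ∩ Th) ≤ Cstab * Cdrel * D.combined A b c K TH (TH \ Th) +
      2 * (D.combined A b c K Th Th + 2 * Cstab * C ^ 4 * Crel * D.etaU A b c TH TH) := by
  have hC := hS.one_le
  have hη := D.etaU_nonneg A b c TH TH
  have hρ := D.combined_nonneg A b c K Th Th
  have hTh := mem_meshes_of_refines hTH h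
  have hpert : 0 ≤ 2 * Cstab * C ^ 4 * Crel * D.etaU A b c TH TH := by positivity
  have h1 : D.etaU A b c TH (TH ∩ Th) ≤ Cstab * Cdrel * D.etaU A b c TH (TH \ Th) +
      (D.combined A b c K Th Th + 2 * Cstab * C ^ 4 * Crel * D.etaU A b c TH TH) := by
    linarith [etaU_inter_le hS hD hCstab hTH h, D.etaU_le_combined A b c K Th Th]
  have h2 : D.zetaZ A b c K TH (TH ∩ Th) ≤ Cstab * Cdrel * D.zetaZ A b c K TH (TH \ Th) +
      (D.combined A b c K Th Th + 2 * Cstab * C ^ 4 * Crel * D.etaU A b c TH TH) := by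
    have e1 := (abs_le.1 (zetaOn_sub_le hD hTH h (wh := D.uH A b c TH) (wH := D.uH A b c TH)
      (hS.dual_mem D (D.uH A b c TH) Th) (hS.dual_mem D (D.uH A b c TH) TH)
      (Finset.Subset.refl (Th ∩ TH)))).1
    rw [sub_self, energyNorm_zero_eq hS, add_zero] at e1
    have e2 := mul_le_mul_of_nonneg_left
      (hD.adaptivity.discreteReliability_zeta TH hTH Th h (D.uH A b c TH)) hCstab.le
    have e3 := zetaOn_linearization_le hS hD hCstab hTh
      (Finset.inter_subset_left : Th ∩ TH ⊆ Th) (D.uH A b c TH) (D.uH A b c Th)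
    rw [norm_sub_rev] at e3
    have e4 := mul_le_mul_of_nonneg_left (norm_uH_sub_le hS hD hTH h)
      (by positivity : 0 ≤ 2 * Cstab * C ^ 2)
    have e5 := D.zetaOn_mono (D.uH A b c Th) Th (Finset.inter_subset_left : Th ∩ TH ⊆ Th)
      (D.zH A b c K (D.uH A b c Th) Th)
    have e6 := D.zetaZ_le_combined A b c K Th Th
    rw [Finset.inter_comm TH Th]
    simp only [zetaZ] at e6 ⊢
    linarith
  have h3 := sqrt_sum_sq_le_add (D.etaU_nonneg A b c TH (TH ∩ Th))
    (D.zetaZ_nonneg A b c K TH (TH ∩ Th)) le_rfl le_rfl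
    (by positivity :
      0 ≤ D.combined A b c K Th Th + 2 * Cstab * C ^ 4 * Crel * D.etaU A b c TH TH)
    h1 h2 (y₃ := 0) (y₄ := 0) (by positivity) (by positivity)
  have h4 : (Cstab * Cdrel * D.etaU A b c TH (TH \ Th)) ^ 2 +
      (Cstab * Cdrel * D.zetaZ A b c K TH (TH \ Th)) ^ 2 =
      (Cstab * Cdrel * D.combined A b c K TH (TH \ Th)) ^ 2 := by
    rw [mul_pow _ (D.combined A b c K TH (TH \ Th)), combined_sq]; ring
  rw [zero_pow two_ne_zero, add_zero, add_zero, add_zero, add_zero, h4, Real.sqrt_sq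
    (mul_nonneg (by positivity) (D.combined_nonneg A b c K _ _))] at h3
  exact h3

open Classical in
/-- If the estimator product is sufficiently reduced, then the refined elements satisfy one of the
two Dörfler criteria. -/
theorem exists_doerfler_of_reduction (hS : SolutionBounds A b c K C) (hθ0 : 0 < θ)
    (hCstab : 0 < Cstab) (hCrel : 0 < Crel) (hCdrel : 0 < Cdrel)
    (hθ : θ < (1 + Cstab ^ 2 * Cdrel ^ 2)⁻¹) :
    ∃ κ : ℝ, 0 < κ ∧ ∀ (Cmesh qred : ℝ) (D : Discretization Ω),
      D.Admissible A b c K Cmesh Cstab qred Crel Cdrel → ∀ TH ∈ D.meshes, ∀ Th,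
      Refines D.refine TH Th → D.estProduct A b c K Th ≤ κ * D.estProduct A b c K TH →
      D.DoerflerU A b c θ TH (TH \ Th) ∨ D.DoerflerUZ A b c K θ TH (TH \ Th) := by
  have hC := hS.one_le
  rw [← mul_pow] at hθ
  obtain ⟨κ₀, hκ₀, hdoe⟩ := exists_doerfler_threshold hθ0 hθ
  -- `μ` is the threshold for the ratio of the primal to the combined estimator below which the
  -- linearization term in `combined_inter_le` is at most `κ₀ / 4` of the combined estimator.
  set μ := κ₀ / (8 * Cstab * C ^ 4 * Crel) with hμ
  have hμ0 : 0 < μ := by positivity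
  set lam := min (κ₀ / 4) (κ₀ * μ) with hlam
  have hlam0 : 0 < lam := by positivity
  have hlam1 : lam ≤ κ₀ / 4 := min_le_left _ _
  have hlam2 : lam ≤ κ₀ * μ := min_le_right _ _
  refine ⟨lam ^ 2, by positivity, fun Cmesh qred D hD TH hTH Th h hP => ?_⟩
  have hη := D.etaU_nonneg A b c TH TH
  have hρ := D.combined_nonneg A b c K TH TH
  have hηh := D.etaU_nonneg A b c Th Th
  have hρh := D.combined_nonneg A b c K Th Th
  have hU : D.etaU A b c Th Th ≤ κ₀ * D.etaU A b c TH TH →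
      D.DoerflerU A b c θ TH (TH \ Th) := fun hle =>
    hdoe _ _ _ (D.etaU_nonneg A b c TH (TH ∩ Th)) (D.etaOn_sq_split TH TH Th _)
      ((etaU_inter_le hS hD hCstab hTH h).trans (by linarith))
  -- If the product drops by `lam ^ 2`, then at least one factor drops by `lam`.
  have hcase : D.etaU A b c Th Th ≤ lam * D.etaU A b c TH TH ∨
      D.combined A b c K Th Th ≤ lam * D.combined A b c K TH TH := by
    by_contra hcon
    rw [not_or, not_le, not_le] at hcon
    have := mul_lt_mul'' hcon.1 hcon.2 (by positivity) (by positivity)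
    rw [estProduct_eq, estProduct_eq] at hP
    nlinarith
  rcases hcase with hc | hc
  · exact Or.inl (hU (hc.trans (by gcongr; linarith)))
  -- If the primal estimator is a substantial part of the combined one, the small combined estimator
  -- on `Th` already makes the primal one small relative to its coarse value. Otherwise the
  -- linearization term is negligible.
  · rcases le_total (μ * D.combined A b c K TH TH) (D.etaU A b c TH TH) with hm | hm
    · left
      apply hU
      calc D.etaU A b c Th Th ≤ D.combined A b c K Th Th := D.etaU_le_combined A b c K Th Th
        _ ≤ κ₀ * μ * D.combined A b c K TH TH := hc.trans (by gcongr)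
        _ ≤ κ₀ * D.etaU A b c TH TH := by rw [mul_assoc]; gcongr
    · right
      have h1 := combined_inter_le hS hD hCstab hCrel hCdrel hTH h
      have h2 : 2 * Cstab * C ^ 4 * Crel * D.etaU A b c TH TH ≤
          κ₀ / 4 * D.combined A b c K TH TH := by
        calc 2 * Cstab * C ^ 4 * Crel * D.etaU A b c TH TH
            ≤ 2 * Cstab * C ^ 4 * Crel * (μ * D.combined A b c K TH TH) := by gcongr
          _ = κ₀ / 4 * D.combined A b c K TH TH := by rw [hμ]; field_simp; ring
      have h3 : lam * D.combined A b c K TH TH ≤ κ₀ / 4 * D.combined A b c K TH TH := by gcongr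
      have h4 := hdoe _ _ _ (D.combined_nonneg A b c K TH (TH ∩ Th))
        (D.combined_sq_split A b c K TH TH Th) (by linarith)
      rw [combined_sq, combined_sq] at h4
      exact h4

-- Here the linearization point stays fixed. For `w = u` this transfers the bound defining the
-- approximation class of `z[u]` from a near-best mesh to its refinements.
open Classical in
theorem zetaOn_quasiMono (hS : SolutionBounds A b c K C)
    (hD : D.Admissible A b c K Cmesh Cstab qred Crel Cdrel) (hCstab : 0 < Cstab)
    (hq0 : 0 < qred) (hq1 : qred < 1) (hCrel : 0 < Crel) (hTH : TH ∈ D.meshes)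
    (h : Refines D.refine TH Th) (w : H10 Ω) :
    D.zetaOn w Th Th (D.zH A b c K w Th) ≤
      (1 + 6 * Cstab * C ^ 4 * Crel) * D.zetaOn w TH TH (D.zH A b c K w TH) := by
  have hC := hS.one_le
  have hζ := D.zetaOn_nonneg w TH TH (D.zH A b c K w TH)
  set ζ := D.zetaOn w TH TH (D.zH A b c K w TH)
  have hE : Cstab * energyNorm A (D.zH A b c K w Th - D.zH A b c K w TH) ≤
      Cstab * C ^ 3 * Crel * ζ := by
    have := (hS.energy_le (D.zH A b c K w Th - D.zH A b c K w TH)).trans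
      (mul_le_mul_of_nonneg_left (norm_zH_sub_le hS hD hTH h w) (by linarith))
    calc _ ≤ Cstab * (C * (C ^ 2 * Crel * ζ)) := by gcongr
      _ = _ := by ring
  have h1 := (abs_le.1 (zetaOn_sub_le hD hTH h (wh := w) (wH := w) (hS.dual_mem D w Th)
    (hS.dual_mem D w TH) (Finset.Subset.refl (Th ∩ TH)))).2
  have h2 := (abs_le.1 (zetaOn_sub_le hD (mem_meshes_of_refines hTH h) .refl (wh := w) (wH := w)
    (hS.dual_mem D w Th) (X_mono hD hTH h (hS.dual_mem D w TH)) (U := Th \ TH) (by simp))).2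
  rw [sub_self, energyNorm_zero_eq hS, add_zero] at h1 h2
  have h3 := hD.adaptivity.reduction_zeta TH hTH Th h _ (hS.dual_mem D w TH) w
  have h4 := D.zetaOn_nonneg w TH (TH \ Th) (D.zH A b c K w TH)
  have h5 := sqrt_sum_sq_le_add (D.zetaOn_nonneg w Th (Th ∩ TH) (D.zH A b c K w Th))
    (D.zetaOn_nonneg w Th (Th \ TH) (D.zH A b c K w Th)) le_rfl le_rfl
    (by positivity : 0 ≤ Cstab * C ^ 3 * Crel * ζ)
    (y₁ := D.zetaOn w TH (Th ∩ TH) (D.zH A b c K w TH))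
    (y₂ := D.zetaOn w TH (TH \ Th) (D.zH A b c K w TH)) (y₃ := 0) (y₄ := 0)
    (by linarith) (by nlinarith) (by positivity) (by positivity)
  rw [zero_pow two_ne_zero, add_zero, add_zero, add_zero, add_zero, ← zetaOn_sq_split,
    Finset.inter_comm Th TH, ← zetaOn_sq_split, Real.sqrt_sq (D.zetaOn_nonneg _ _ _ _),
    Real.sqrt_sq (D.zetaOn_nonneg _ _ _ _)] at h5
  have h7 : Cstab * C ^ 3 * Crel * ζ ≤ Cstab * C ^ 4 * Crel * ζ := by gcongr; norm_num
  have h8 : 0 ≤ Cstab * C ^ 4 * Crel * ζ := by positivity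
  change _ ≤ ζ + _ at h5
  linarith

/-- The overlay of a mesh with near-best meshes. -/
theorem exists_comparison_mesh (hS : SolutionBounds A b c K C) (hCstab : 0 < Cstab)
    (hq0 : 0 < qred) (hq1 : qred < 1) (hCrel : 0 < Crel) :
    ∃ Ccmp : ℝ, 0 < Ccmp ∧ ∀ (Cmesh Cdrel : ℝ) (D : Discretization Ω),
      D.Admissible A b c K Cmesh Cstab qred Crel Cdrel → ∀ (s t α U Z : ℝ),
      α = min (2 * s) (s + t) → 0 < U → 0 < Z → D.approxU A b c s < ENNReal.ofReal U →
      D.approxZ A b c K t < ENNReal.ofReal Z → ∀ TH ∈ D.meshes, ∀ N : ℕ, ∃ Th,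
      Refines D.refine TH Th ∧ Th.card ≤ TH.card + 2 * N ∧
      D.estProduct A b c K Th ≤ Ccmp * (U * (U + Z)) * ((N : ℝ) + 1) ^ (-α) := by
  have hC := hS.one_le
  set Q := 1 + 6 * Cstab * C ^ 4 * Crel with hQdef
  have hQ : 0 < Q := by positivity
  set B := 1 + 2 * Cstab * C ^ 3 * Crel with hBdef
  have hB : 0 < B := by positivity
  have hB1 : 1 ≤ B := by
    have : 0 ≤ 2 * Cstab * C ^ 3 * Crel := by positivity
    linarith
  refine ⟨Q ^ 2 * B, by positivity, ?_⟩
  intro Cmesh Cdrel D hD s t α U Z hα hU hZ hAU hAZ TH hTH N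
  obtain ⟨Tu, ⟨hTu, hTuN⟩, hηu⟩ := exists_lt_of_iSup_lt _ _ hU hAU N
  obtain ⟨Tz, ⟨hTz, hTzN⟩, hζz⟩ := exists_lt_of_iSup_lt _ _ hZ hAZ N
  obtain ⟨T1, hT1, hT1u, hc1⟩ := hD.refinement.overlay TH Tu hTH hTu
  have hT1m := mem_meshes_of_refines hTH hT1
  obtain ⟨T2, hT2, hT2z, hc2⟩ := hD.refinement.overlay T1 Tz hT1m hTz
  have hT2m := mem_meshes_of_refines hT1m hT2
  refine ⟨T2, hT1.trans hT2, by omega, ?_⟩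
  set n := (N : ℝ) + 1 with hn
  have hn1 : 1 ≤ n := by simp [hn]
  have hn0 : 0 < n := by linarith
  have h1 : D.etaU A b c T2 T2 ≤ Q * (U * n ^ (-s)) :=
    (etaU_quasiMono hS hD hCstab hq0 hq1 hCrel hTu (hT1u.trans hT2)).trans (by gcongr; exact hηu.le)
  have h2 := zetaOn_quasiMono hS hD hCstab hq0 hq1 hCrel hTz hT2z (D.u A b c)
  have h3 : D.zetaOn (D.u A b c) T2 T2 (D.zH A b c K (D.u A b c) T2) ≤ Q * (Z * n ^ (-t)) :=
    h2.trans (by gcongr)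
  -- The approximation class is linearized at the exact `u`, the algorithm at the discrete solution.
  -- By reliability the switch costs a multiple of the primal estimator on the overlay, which decays
  -- with rate `s`.
  have h4 := zetaOn_linearization_le hS hD hCstab hT2m (Finset.Subset.refl T2)
    (D.uH A b c T2) (D.u A b c)
  have h5 := mul_le_mul_of_nonneg_left (norm_u_sub_le hS hD hT2m)
    (by positivity : 0 ≤ 2 * Cstab * C ^ 2)
  rw [norm_sub_rev] at h4
  have hη0 := D.etaU_nonneg A b c T2 T2
  have h6 : D.zetaZ A b c K T2 T2 ≤ Q * (Z * n ^ (-t)) +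
      2 * Cstab * C ^ 3 * Crel * D.etaU A b c T2 T2 := by
    simp only [zetaZ]
    linarith
  have h7 : D.combined A b c K T2 T2 ≤ B * (Q * (U * n ^ (-s) + Z * n ^ (-t))) := by
    have e1 : D.combined A b c K T2 T2 ≤ D.etaU A b c T2 T2 + D.zetaZ A b c K T2 T2 := by
      apply Real.sqrt_le_iff.2
      have := D.zetaZ_nonneg A b c K T2 T2
      exact ⟨by positivity, by nlinarith⟩
    have e2 : D.etaU A b c T2 T2 + 2 * Cstab * C ^ 3 * Crel * D.etaU A b c T2 T2 ≤
        B * (Q * (U * n ^ (-s))) := by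
      calc _ = B * D.etaU A b c T2 T2 := by rw [hBdef]; ring
        _ ≤ _ := by gcongr
    have e3 : Q * (Z * n ^ (-t)) ≤ B * (Q * (Z * n ^ (-t))) :=
      le_mul_of_one_le_left (by positivity) hB1
    linarith
  have p1 : n ^ (-s) * n ^ (-s) ≤ n ^ (-α) := by
    rw [← Real.rpow_add hn0]
    exact Real.rpow_le_rpow_of_exponent_le hn1 (by linarith [min_le_left (2 * s) (s + t)])
  have p2 : n ^ (-s) * n ^ (-t) ≤ n ^ (-α) := by
    rw [← Real.rpow_add hn0]
    exact Real.rpow_le_rpow_of_exponent_le hn1 (by linarith [min_le_right (2 * s) (s + t)])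
  rw [estProduct_eq]
  calc D.etaU A b c T2 T2 * D.combined A b c K T2 T2
      ≤ Q * (U * n ^ (-s)) * (B * (Q * (U * n ^ (-s) + Z * n ^ (-t)))) :=
        mul_le_mul h1 h7 (D.combined_nonneg A b c K _ _) (by positivity)
    _ = Q ^ 2 * B * (U * (U * (n ^ (-s) * n ^ (-s)) + Z * (n ^ (-s) * n ^ (-t)))) := by ring
    _ ≤ Q ^ 2 * B * (U * (U * n ^ (-α) + Z * n ^ (-α))) := by gcongr
    _ = Q ^ 2 * B * (U * (U + Z)) * n ^ (-α) := by ring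

end Optimality

end Discretization

/-! ### From linear convergence to algebraic rates. -/

theorem sum_range_pow_sub_le {r : ℝ} (hr0 : 0 ≤ r) (hr1 : r < 1) (l : ℕ) :
    ∑ j ∈ Finset.range l, r ^ (l - j) ≤ (1 - r)⁻¹ := by
  rw [← Finset.sum_range_reflect]
  have h1 : ∑ j ∈ Finset.range l, r ^ (l - (l - 1 - j)) ≤ ∑ j ∈ Finset.range l, r ^ j := by
    refine Finset.sum_le_sum fun j hj => pow_le_pow_of_le_one hr0 hr1.le ?_
    have := Finset.mem_range.1 hj
    omega
  refine h1.trans ?_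
  rw [← tsum_geometric_of_lt_one hr0 hr1]
  exact (summable_geometric_of_lt_one hr0 hr1).sum_le_tsum _ fun j _ => pow_nonneg hr0 j

/-- Complexity bound from linear convergence: if every step adds at most `a P_j^{-1/α}` marked
elements, then `P_l` decays with rate `α` in the total number of elements. -/
theorem le_rpow_neg_of_linear_convergence {P m : ℕ → ℝ} {Clin q Cmesh a α X : ℝ} {l : ℕ}
    (hClin : 0 < Clin) (hq0 : 0 < q) (hq1 : q < 1) (hCmesh : 0 < Cmesh) (ha : 0 ≤ a) (hα : 0 < α)
    (hP : ∀ j ≤ l, 0 < P j) (hlin : ∀ j ≤ l, P l ≤ Clin * q ^ (l - j) * P j)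
    (hm : ∀ j < l, m j ≤ a * P j ^ (-(1 / α)))
    (hX0 : 0 < X) (hX : X ≤ Cmesh * ∑ j ∈ Finset.range l, m j) :
    P l ≤ (Cmesh * Clin ^ (1 / α) * (1 - q ^ (1 / α))⁻¹) ^ α * a ^ α * X ^ (-α) := by
  have hβ : 0 < 1 / α := by positivity
  set r := q ^ (1 / α) with hr
  have hr0 : 0 < r := by positivity
  have hr1 : r < 1 := Real.rpow_lt_one hq0.le hq1 hβ
  have hPl := hP l le_rfl
  have h1r : 0 < 1 - r := by linarith
  have hterm : ∀ j ∈ Finset.range l,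
      m j ≤ a * Clin ^ (1 / α) * P l ^ (-(1 / α)) * r ^ (l - j) := by
    intro j hj
    have hj := Finset.mem_range.1 hj
    have hPj := hP j hj.le
    refine (hm j hj).trans ?_
    -- Raising linear convergence to the power `-1 / α` reverses it: earlier products contribute
    -- geometrically less than the current one, so the sum of all steps is comparable to its last
    -- term.
    have h1 : P j ^ (-(1 / α)) ≤ Clin ^ (1 / α) * P l ^ (-(1 / α)) * r ^ (l - j) := by
      have h2 : P l ^ (1 / α) ≤ Clin ^ (1 / α) * r ^ (l - j) * P j ^ (1 / α) := by
        have h3 := Real.rpow_le_rpow hPl.le (hlin j hj.le) hβ.le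
        rw [Real.mul_rpow (by positivity) hPj.le, Real.mul_rpow hClin.le (by positivity)] at h3
        have h4 : (q ^ (l - j)) ^ (1 / α) = r ^ (l - j) := by
          rw [hr, ← Real.rpow_natCast, ← Real.rpow_natCast, ← Real.rpow_mul hq0.le,
            ← Real.rpow_mul hq0.le, mul_comm]
        rwa [h4] at h3
      rw [Real.rpow_neg hPj.le, Real.rpow_neg hPl.le]
      have k1 : 0 < P j ^ (1 / α) := by positivity
      have k2 : 0 < P l ^ (1 / α) := by positivity
      rw [inv_le_iff_one_le_mul₀ k1]
      calc 1 = P l ^ (1 / α) * (P l ^ (1 / α))⁻¹ := by field_simp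
        _ ≤ Clin ^ (1 / α) * r ^ (l - j) * P j ^ (1 / α) * (P l ^ (1 / α))⁻¹ := by gcongr
        _ = _ := by ring
    calc a * P j ^ (-(1 / α)) ≤ a * (Clin ^ (1 / α) * P l ^ (-(1 / α)) * r ^ (l - j)) := by
          gcongr
      _ = _ := by ring
  have hX1 : X ≤ Cmesh * Clin ^ (1 / α) * (1 - r)⁻¹ * a * P l ^ (-(1 / α)) := by
    refine hX.trans ?_
    calc Cmesh * ∑ j ∈ Finset.range l, m j
        ≤ Cmesh * ∑ j ∈ Finset.range l, a * Clin ^ (1 / α) * P l ^ (-(1 / α)) * r ^ (l - j) := by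
          gcongr with j hj
          exact hterm j hj
      _ = Cmesh * (a * Clin ^ (1 / α) * P l ^ (-(1 / α)) *
          ∑ j ∈ Finset.range l, r ^ (l - j)) := by rw [← Finset.mul_sum]
      _ ≤ Cmesh * (a * Clin ^ (1 / α) * P l ^ (-(1 / α)) * (1 - r)⁻¹) := by
          gcongr
          exact sum_range_pow_sub_le hr0.le hr1 l
      _ = _ := by ring
  have hX2 := Real.rpow_le_rpow hX0.le hX1 hα.le
  rw [Real.mul_rpow (by positivity) (by positivity), Real.mul_rpow (by positivity) ha,
    ← Real.rpow_mul hPl.le] at hX2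
  have e : -(1 / α) * α = -1 := by field_simp
  rw [e, Real.rpow_neg_one] at hX2
  have hXα : 0 < X ^ α := by positivity
  rw [Real.rpow_neg hX0.le, ← div_eq_mul_inv, le_div_iff₀ hXα]
  calc P l * X ^ α ≤ P l * ((Cmesh * Clin ^ (1 / α) * (1 - r)⁻¹) ^ α * a ^ α * (P l)⁻¹) := by
        gcongr
    _ = _ := by field_simp

namespace Discretization

section Optimality

variable {d : ℕ} {Ω : Set (E d)}
  {A : E d → Matrix (Fin d) (Fin d) ℝ} {b : E d → E d} {c : E d → ℝ} {K : H10 Ω →L[ℝ] Hneg1 Ω}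
  {Cstab qred Crel C θ : ℝ}

/-- The number of marked elements in one step. -/
theorem exists_card_marked_le (hS : SolutionBounds A b c K C) (hθ0 : 0 < θ)
    (hCstab : 0 < Cstab) (hq0 : 0 < qred) (hq1 : qred < 1) (hCrel : 0 < Crel) {Cdrel : ℝ}
    (hCdrel : 0 < Cdrel) (hθ : θ < (1 + Cstab ^ 2 * Cdrel ^ 2)⁻¹) :
    ∃ Cm : ℝ, 0 < Cm ∧ ∀ (Cmesh Cmark : ℝ) (D : Discretization Ω), 0 < Cmark →
      D.Admissible A b c K Cmesh Cstab qred Crel Cdrel → ∀ (s t α U Z : ℝ), 0 < α →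
      α = min (2 * s) (s + t) → 0 < U → 0 < Z → D.approxU A b c s < ENNReal.ofReal U →
      D.approxZ A b c K t < ENNReal.ofReal Z → ∀ TH ∈ D.meshes,
      0 < D.estProduct A b c K TH → ∀ M : Finset (Elem d),
      (∀ M' ⊆ TH, D.DoerflerU A b c θ TH M' ∨ D.DoerflerUZ A b c K θ TH M' →
        (M.card : ℝ) ≤ 2 * Cmark * M'.card) →
      (M.card : ℝ) ≤ 4 * Cmark * (Cm * (U * (U + Z))) ^ (1 / α) *
        D.estProduct A b c K TH ^ (-(1 / α)) := by
  classical
  obtain ⟨κ, hκ, hdoe⟩ := exists_doerfler_of_reduction hS hθ0 hCstab hCrel hCdrel hθ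
  obtain ⟨Ccmp, hCcmp, hcmp⟩ := exists_comparison_mesh hS hCstab hq0 hq1 hCrel
  refine ⟨Ccmp / κ, by positivity, ?_⟩
  intro Cmesh Cmark D hCmark hD s t α U Z hα0 hα hU hZ hAU hAZ TH hTH hP M hM
  set P := D.estProduct A b c K TH with hPdef
  set Y := Ccmp / κ * (U * (U + Z)) / P with hY
  have hY0 : 0 < Y := by positivity
  -- `N + 1` exceeds `Y ^ (1 / α)`, which makes the product on the comparison mesh at most `κ * P`,
  -- while `N` itself stays below it. The floor loses no additive constant: for `Y < 1` it gives `N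
  -- = 0`.
  set N := ⌊Y ^ (1 / α)⌋₊ with hN
  have hN1 : (N : ℝ) ≤ Y ^ (1 / α) := Nat.floor_le (by positivity)
  have hN2 : Y ^ (1 / α) < (N : ℝ) + 1 := Nat.lt_floor_add_one _
  obtain ⟨Th, hTh, hcard, hPh⟩ := hcmp Cmesh Cdrel D hD s t α U Z hα hU hZ hAU hAZ TH hTH N
  have hred : D.estProduct A b c K Th ≤ κ * P := by
    refine hPh.trans ?_
    have h1 : ((N : ℝ) + 1) ^ (-α) ≤ Y⁻¹ := by
      rw [Real.rpow_neg (by positivity)]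
      apply inv_anti₀ hY0
      have := Real.rpow_le_rpow (by positivity) hN2.le hα0.le
      rwa [← Real.rpow_mul hY0.le, one_div_mul_cancel hα0.ne', Real.rpow_one] at this
    calc Ccmp * (U * (U + Z)) * ((N : ℝ) + 1) ^ (-α) ≤ Ccmp * (U * (U + Z)) * Y⁻¹ := by gcongr
      _ = κ * P := by rw [hY]; field_simp
  have h1 := hM (TH \ Th) Finset.sdiff_subset (hdoe Cmesh qred D hD TH hTH Th hTh hred)
  have h2 : (TH \ Th).card ≤ 2 * N := by
    have := hD.refinement.sons TH Th hTH hTh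
    have e : (TH \ Th).card + TH.card ≤ Th.card := by convert this
    omega
  have h3 : ((TH \ Th).card : ℝ) ≤ 2 * N := by exact_mod_cast h2
  calc (M.card : ℝ) ≤ 2 * Cmark * (2 * N) := h1.trans (by gcongr)
    _ ≤ 2 * Cmark * (2 * Y ^ (1 / α)) := by gcongr
    _ = 4 * Cmark * (Ccmp / κ * (U * (U + Z))) ^ (1 / α) * P ^ (-(1 / α)) := by
      rw [hY, Real.div_rpow (by positivity) hP.le, Real.rpow_neg hP.le]
      ring

/-- Optimal rates, for a given bound on linear convergence. -/
theorem exists_optimal_rates (hS : SolutionBounds A b c K C) (hθ0 : 0 < θ)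
    (hCstab : 0 < Cstab) (hq0 : 0 < qred) (hq1 : qred < 1) (hCrel : 0 < Crel) {Cdrel Clin qlin : ℝ}
    (hCdrel : 0 < Cdrel) (hθ : θ < (1 + Cstab ^ 2 * Cdrel ^ 2)⁻¹) (hClin : 0 < Clin)
    (hqlin0 : 0 < qlin) (hqlin1 : qlin < 1) {Cmark Cmesh α : ℝ} (hCmark : 0 < Cmark)
    (hCmesh : 0 < Cmesh) (hα : 0 < α) :
    ∃ Copt : ℝ, 0 < Copt ∧ ∀ D : Discretization Ω,
      D.Admissible A b c K Cmesh Cstab qred Crel Cdrel → ∀ 𝒯 : ℕ → Mesh d,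
      D.IsRun A b c K θ Cmark 𝒯 → (∀ l n : ℕ, l ≤ n →
        D.estProduct A b c K (𝒯 n) ≤ Clin * qlin ^ (n - l) * D.estProduct A b c K (𝒯 l)) →
      ∀ s t : ℝ, α = min (2 * s) (s + t) → D.approxU A b c s + D.approxZ A b c K t < ⊤ →
      ∀ l : ℕ, D.T0.card < (𝒯 l).card → D.estProduct A b c K (𝒯 l) ≤
        Copt * ((D.approxU A b c s).toReal *
          ((D.approxU A b c s).toReal + (D.approxZ A b c K t).toReal)) *
          (((𝒯 l).card : ℝ) - D.T0.card) ^ (-α) := by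
  obtain ⟨Cm, hCm, hcard⟩ := exists_card_marked_le hS hθ0 hCstab hq0 hq1 hCrel hCdrel hθ
  have hr1 : 0 < 1 - qlin ^ (1 / α) := by
    have := Real.rpow_lt_one hqlin0.le hqlin1 (by positivity : 0 < 1 / α)
    linarith
  set C₀ := (Cmesh * Clin ^ (1 / α) * (1 - qlin ^ (1 / α))⁻¹) ^ α with hC₀
  refine ⟨C₀ * ((4 * Cmark) ^ α * Cm), by positivity, ?_⟩
  intro D hD 𝒯 hrun hlin s t hst hfin l hl
  obtain ⟨hfinU, hfinZ⟩ := ENNReal.add_lt_top.1 hfin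
  set u₀ := (D.approxU A b c s).toReal with hu₀
  set z₀ := (D.approxZ A b c K t).toReal with hz₀
  have hu₀0 : 0 ≤ u₀ := ENNReal.toReal_nonneg
  have hz₀0 : 0 ≤ z₀ := ENNReal.toReal_nonneg
  set X := ((𝒯 l).card : ℝ) - D.T0.card with hX
  have hX0 : 0 < X := by
    rw [hX, sub_pos]; exact_mod_cast hl
  have hPnn : ∀ j, 0 ≤ D.estProduct A b c K (𝒯 j) := fun j =>
    mul_nonneg (D.etaU_nonneg A b c _ _) (D.combined_nonneg A b c K _ _)
  rcases (hPnn l).eq_or_lt with h0 | hpos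
  · rw [← h0]; positivity
  -- By linear convergence a vanishing product stays zero, so a positive `P_l` makes all earlier
  -- products positive and their negative powers meaningful.
  have hPpos : ∀ j ≤ l, 0 < D.estProduct A b c K (𝒯 j) := by
    intro j hj
    have h1 := hpos.trans_le (hlin j l hj)
    exact pos_of_mul_pos_right h1 (by positivity)
  choose M hM1 hM2 _ hM4 using fun j => (hrun.2 j).exists_marked
  have hclosure := hD.refinement.meshClosure 𝒯 M hrun.1 (fun j => ⟨hM1 j, hM2 j⟩) l
  -- Constants strictly above the approximation norms guarantee meshes with strict bounds and
  -- positive `U` and `Z`, even if a norm vanishes. The increment `ε` is removed by continuity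
  -- afterwards.
  have key : ∀ ε : ℝ, 0 < ε → D.estProduct A b c K (𝒯 l) ≤ C₀ * ((4 * Cmark) ^ α * Cm) *
      ((u₀ + ε) * ((u₀ + ε) + (z₀ + ε))) * X ^ (-α) := by
    intro ε hε
    have hU : 0 < u₀ + ε := by linarith
    have hZ : 0 < z₀ + ε := by linarith
    have hAU : D.approxU A b c s < ENNReal.ofReal (u₀ + ε) := by
      rw [ENNReal.lt_ofReal_iff_toReal_lt hfinU.ne]; linarith
    have hAZ : D.approxZ A b c K t < ENNReal.ofReal (z₀ + ε) := by
      rw [ENNReal.lt_ofReal_iff_toReal_lt hfinZ.ne]; linarith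
    have h1 := le_rpow_neg_of_linear_convergence (P := fun j => D.estProduct A b c K (𝒯 j))
      (m := fun j => ((M j).card : ℝ))
      (a := 4 * Cmark * (Cm * ((u₀ + ε) * ((u₀ + ε) + (z₀ + ε)))) ^ (1 / α))
      hClin hqlin0 hqlin1 hCmesh (by positivity) hα hPpos (fun j hj => hlin j l hj)
      (fun j hj => hcard Cmesh Cmark D hCmark hD s t α _ _ hα hst hU hZ hAU hAZ (𝒯 j)
        (hrun.mem_meshes j) (hPpos j hj.le) (M j) (hM4 j)) hX0 hclosure
    refine h1.trans (le_of_eq ?_)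
    rw [← hC₀, Real.mul_rpow (x := 4 * Cmark) (by positivity) (by positivity),
      ← Real.rpow_mul (by positivity), one_div_mul_cancel hα.ne', Real.rpow_one]
    ring
  have hcont : Filter.Tendsto (fun ε : ℝ => C₀ * ((4 * Cmark) ^ α * Cm) *
      ((u₀ + ε) * ((u₀ + ε) + (z₀ + ε))) * X ^ (-α)) (nhdsWithin 0 (Set.Ioi 0))
      (nhds (C₀ * ((4 * Cmark) ^ α * Cm) * ((u₀ + 0) * ((u₀ + 0) + (z₀ + 0))) * X ^ (-α))) := by
    have hc : Continuous fun ε : ℝ => C₀ * ((4 * Cmark) ^ α * Cm) *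
      ((u₀ + ε) * ((u₀ + ε) + (z₀ + ε))) * X ^ (-α) := by fun_prop
    exact (hc.tendsto 0).mono_left nhdsWithin_le_nhds
  have hlim := ge_of_tendsto hcont (by
    filter_upwards [self_mem_nhdsWithin] with ε hε using key ε hε)
  simpa only [add_zero] using hlim

end Optimality

end Discretization

end GOAFEM

theorem theorem2p4 {d : ℕ} (hd : 2 ≤ d) (Ω : Set (GOAFEM.E d)) (hΩo : IsOpen Ω)
    (hΩb : Bornology.IsBounded Ω)
    (A : GOAFEM.E d → Matrix (Fin d) (Fin d) ℝ) (b : GOAFEM.E d → GOAFEM.E d)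
    (c : GOAFEM.E d → ℝ) (hcoef : GOAFEM.AdmissibleCoefficients Ω A b c)
    (K : GOAFEM.H10 Ω →L[ℝ] GOAFEM.Hneg1 Ω) (hK : IsCompactOperator K)
    (θ Cstab qred Crel : ℝ) (hθ0 : 0 < θ) (hθ1 : θ ≤ 1) (hCstab : 0 < Cstab)
    (hq0 : 0 < qred) (hq1 : qred < 1) (hCrel : 0 < Crel) :
    ∃ (l₀ : ℕ) (Clin qlin : ℝ), 0 < Clin ∧ 0 < qlin ∧ qlin < 1 ∧
      -- (i) linear convergence
      (∀ Cmark Cmesh Cdrel : ℝ, 1 ≤ Cmark → 0 < Cmesh → 0 < Cdrel →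
        ∀ D : GOAFEM.Discretization Ω, D.Admissible A b c K Cmesh Cstab qred Crel Cdrel →
        ∀ 𝒯 : ℕ → GOAFEM.Mesh d, D.IsRun A b c K θ Cmark 𝒯 →
        ∀ l n : ℕ, l₀ ≤ l → l ≤ n →
          D.estProduct A b c K (𝒯 n) ≤ Clin * qlin ^ (n - l) * D.estProduct A b c K (𝒯 l)) ∧
      -- (ii) optimal rates
      (∀ Cmark Cmesh Cdrel α : ℝ, 1 ≤ Cmark → 0 < Cmesh → 0 < Cdrel → 0 < α →
        θ < (1 + Cstab ^ 2 * Cdrel ^ 2)⁻¹ →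
        ∃ Copt : ℝ, 0 < Copt ∧
          ∀ D : GOAFEM.Discretization Ω, D.Admissible A b c K Cmesh Cstab qred Crel Cdrel →
          ∀ 𝒯 : ℕ → GOAFEM.Mesh d, D.IsRun A b c K θ Cmark 𝒯 →
          ∀ s t : ℝ, 0 < s → 0 < t → α = min (2 * s) (s + t) →
          D.approxU A b c s + D.approxZ A b c K t < ⊤ →
          ∀ l : ℕ, l₀ ≤ l → D.T0.card < (𝒯 l).card →
            D.estProduct A b c K (𝒯 l) ≤
              Copt * ((D.approxU A b c s).toReal *
                ((D.approxU A b c s).toReal + (D.approxZ A b c K t).toReal)) *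
                (((𝒯 l).card : ℝ) - D.T0.card) ^ (-α)) := by
  obtain ⟨C, hS⟩ := GOAFEM.exists_solutionBounds (by omega) hΩo hΩb hcoef K
  obtain ⟨Clin, qlin, hClin, hqlin0, hqlin1, hlin⟩ :=
    GOAFEM.Discretization.exists_linear_convergence hS hθ0 hCstab hq0 hq1 hCrel
  -- The contraction already holds from the first step on.
  refine ⟨0, Clin, qlin, hClin, hqlin0, hqlin1, ?_, ?_⟩
  · intro Cmark Cmesh Cdrel _ _ _ D hD 𝒯 hrun l n _ hln
    exact hlin Cmark Cmesh Cdrel D hD 𝒯 hrun l n hln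
  · intro Cmark Cmesh Cdrel α hCmark hCmesh hCdrel hα hθ
    obtain ⟨Copt, hCopt, hopt⟩ := GOAFEM.Discretization.exists_optimal_rates hS hθ0 hCstab hq0 hq1
      hCrel hCdrel hθ hClin hqlin0 hqlin1 (by linarith : 0 < Cmark) hCmesh hα
    refine ⟨Copt, hCopt, fun D hD 𝒯 hrun s t _ _ hst hfin l _ hl => ?_⟩
    exact hopt D hD 𝒯 hrun (hlin Cmark Cmesh Cdrel D hD 𝒯 hrun) s t hst hfin l hl
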